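/- For $\mu>0$, $x>0$, $y\ge 0$ let $$Q_\mu(x,y)=x^{\frac12(1-\mu)}\int_y^\infty t^{\frac12(\mu-1)}e^{-t-x}I_{\mu-1}(2\sqrt{xt})\,dt$$ be the generalized Marcum $Q$-function ($I_\nu$ the modified Bessel function), with $Q_\mu(0,y)=\Gamma(\mu,y)/\Gamma(\mu)$. For $x\ge0$, $y>0$ define $\zeta=\zeta(x,y)$ by $$\tfrac12\zeta^2=x+y-\sqrt{1+4xy}+\ln\frac{1+\sqrt{1+4xy}}{2y},\qquad \operatorname{sign}\zeta=\operatorname{sign}(y-x-1),$$ and, for $y\ne x+1$, $$f(x,y)=\frac{\zeta}{y-x-1}\,\frac{1+2x+\sqrt{1+4xy}}{2(1+4xy)^{1/4}},\qquad d_0(x,y)=\frac1\zeta-\frac{1+2x+\sqrt{1+4xy}}{2(y-x-1)(1+4xy)^{1/4}},$$ $$\zeta_1(x,y)=\frac{\ln f(x,y)}{\zeta(x,y)},$$ while for $y=x+1$ (where $\zeta=0$) $\zeta_1(x,x+1)=-\dfrac{3x+1}{3(2x+1)^{3/2}}$, the limiting value. Then the following hold. 1. For $x\ge0$, $y>0$,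 $y\neq x+1$: $f=-\dfrac{\zeta\,(1+\sqrt{1+4xy})}{(1+\sqrt{1+4xy}-2y)(1+4xy)^{1/4}}=1-\zeta d_0$, and $f>0$. 2. For $\mu>0$ and $0<q<1$ the equation $\frac12\operatorname{erfc}(\zeta_0\sqrt{\mu/2})=q$ has exactly one real solution $\zeta_0$. For $x\ge0$ and every real $\zeta_0$ there is exactly one $y_0>0$ with $\zeta(x,y_0)=\zeta_0$, and for $\mu>0$, $0<q<1$ exactly one $y>0$ with $Q_\mu(\mu x,\mu y)=q$. For $y>0$ and $\zeta_0\le\zeta(0,y)$ there is exactly one $x_0\ge0$ with $\zeta(x_0,y)=\zeta_0$, and for $\mu>0$, $Q_\mu(0,\mu y)<q<1$ exactly one $x\ge0$ with $Q_\mu(\mu x,\mu y)=q$. 3. (Inversion in $y$.) There are functions $\zeta_n(x,\zeta_0)$, $n\ge1$, with $\zeta_1(x,\zeta_0)=\zeta_1(x,y_0)$ whenever $\zeta(x,y_0)=\zeta_0$, such that for every $N\ge0$ $$\zeta(x,y)=\zeta_0+\sum_{n=1}^{N}\frac{\zeta_n(x,\zeta_0)}{\mu^n}+O(\mu^{-N-1}),\qquad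 \mu\to\infty,$$ where $\frac12\operatorname{erfc}(\zeta_0\sqrt{\mu/2})=q$ and $Q_\mu(\mu x,\mu y)=q$. The error is uniform for $x\ge 0$ and $\zeta_0\in\mathbb R$ in bounded sets (so $q$ may be fixed or may vary with $\mu$). 4. (Inversion in $x$.) There are functions $\zeta_n(y,\zeta_0)$, $n\ge1$, with $\zeta_1(y,\zeta_0)=\zeta_1(x_0,y)$ whenever $\zeta(x_0,y)=\zeta_0$, $x_0\ge 0$, such that for every $N\ge0$ $$\zeta(x,y)=\zeta_0+\sum_{n=1}^{N}\frac{\zeta_n(y,\zeta_0)}{\mu^n}+O(\mu^{-N-1}),\qquad \mu\to\infty,$$ where $\frac12\operatorname{erfc}(\zeta_0\sqrt{\mu/2})=q$, $\zeta_0\le\zeta(0,y)$, $x\ge0$ and $Q_\mu(\mu x,\mu y)=q$. The error is uniform for $y$ in compact subsets of $(0,\infty)$ and $\zeta_0$ in bounded sets. 5. (Transition.) If $Q_\mu(\mu x,\mu y)=\frac12$, $y>0$, then $$y=x+1-\frac{3x+1}{3\mu(2x+1)}+O(\mu^{-2}),\qquad\mu\to\infty,$$ uniformly for $x\ge 0$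 in bounded sets. In unscaled variables: if $Q_\mu(x,y)=\frac12$, $y>0$, then $$y=x+\mu-\frac{3\frac{x}{\mu}+1}{3\left(2\frac{x}{\mu}+1\right)}+O(\mu^{-1}),\qquad\mu\to\infty,$$ uniformly for $0\le x\le M\mu$, for every $M>0$. In particular, for fixed $x\ge 0$ the solution $y$ of $Q_\mu(x,y)=\frac12$ satisfies $y\sim x+\mu-\frac{3x+1}{3(2x+1)}$ in the sense that the ratio tends to $1$. -/

import Mathlib

noncomputable section

/-- The complementary error function `erfc z = (2 / √π) ∫_z^∞ exp (-t²) dt`. -/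
def erfc (z : ℝ) : ℝ := 2 / √Real.pi * ∫ t in Set.Ioi z, Real.exp (-t ^ 2)

/-- The modified Bessel function `I_ν(z) = ∑ (z/2)^(ν+2k) / (k! Γ(ν+k+1))`, for real `ν > -1` and
`z > 0`. -/
def besselI (ν z : ℝ) : ℝ :=
  ∑' k : ℕ, (z / 2) ^ (ν + 2 * (k : ℝ)) / ((k.factorial : ℝ) * Real.Gamma (ν + (k : ℝ) + 1))

/-- The generalized Marcum `Q`-function for `μ > 0`, `x ≥ 0`, `y ≥ 0`.  For `x > 0` it is the integral
`x^((1-μ)/2) ∫_y^∞ t^((μ-1)/2) exp (-t-x) I_{μ-1}(2√(xt)) dt`; its value at `x = 0` (the limit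
`x → 0+`) is the normalized incomplete gamma function `Γ(μ, y) / Γ(μ)`. -/
def marcumQ (μ x y : ℝ) : ℝ :=
  if x = 0 then
    (∫ t in Set.Ioi y, t ^ (μ - 1) * Real.exp (-t)) / Real.Gamma μ
  else
    x ^ ((1 - μ) / 2) *
      ∫ t in Set.Ioi y,
        t ^ ((μ - 1) / 2) * Real.exp (-t - x) * besselI (μ - 1) (2 * √(x * t))

/-- `ζ(x, y)`: the number with `ζ²/2 = x + y - √(1+4xy) + ln ((1+√(1+4xy)) / (2y))` and
`sign ζ = sign (y - x - 1)`. -/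
def marcumZeta (x y : ℝ) : ℝ :=
  Real.sign (y - x - 1) *
    √(2 * (x + y - √(1 + 4 * x * y) + Real.log ((1 + √(1 + 4 * x * y)) / (2 * y))))

/-- The coefficient `d₀`, for `y ≠ x + 1`. -/
def marcumD0 (x y : ℝ) : ℝ :=
  1 / marcumZeta x y -
    (1 + 2 * x + √(1 + 4 * x * y)) / (2 * (y - x - 1) * (1 + 4 * x * y) ^ (1 / 4 : ℝ))

/-- The function `f`, for `y ≠ x + 1`. -/
def marcumF (x y : ℝ) : ℝ :=
  marcumZeta x y / (y - x - 1) *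
    ((1 + 2 * x + √(1 + 4 * x * y)) / (2 * (1 + 4 * x * y) ^ (1 / 4 : ℝ)))

/-- The coefficient `ζ₁ = ln f / ζ`.  On the transition line `y = x + 1`, where `ζ = 0` and `f = 1`,
it has the limiting value `-(3x+1) / (3 (2x+1)^(3/2))`. -/
def marcumZeta1 (x y : ℝ) : ℝ :=
  if y = x + 1 then -(3 * x + 1) / (3 * (2 * x + 1) ^ (3 / 2 : ℝ))
  else Real.log (marcumF x y) / marcumZeta x y

end

open Filter Topology Set MeasureTheory

/-! ### Smooth parametric integrals and Hadamard quotients -/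


/-! Everything is smooth in the coordinate `a` defined by `y = a + x a²`. Then `1 + 4xy = (1 +
2xa)²` and `ζ²/2 = x(a-1)² + a - 1 - log a`, so `ζ = (a-1) √(2x + logQuot a)` is smooth and
increasing in `a` through the transition `a = 1`. The same `a` is the optimal Chernoff parameter:
tilting the density by `b = 1/a` bounds `Q` by `exp (-μζ²/2)` for `a ≥ 1`, and `1 - Q` by the same
quantity for `a ≤ 1`.

Expansion of `Q`. After multiplication by `gammaFactor μ`, the derivative of `Q` in `a` is `-√(μ/2π)
exp (-μζ²/2)` times an amplitude containing a Bessel factor at `c = xa`. That factor is expanded in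
`1/μ`, uniformly for `c` in `[0, W]`, by a maximum principle for the Riccati equation of its
logarithmic derivative (`exists_besselRatio_sub_le`, `exists_besselFactor_sub_le`). Repeated
integration by parts follows: from each source subtract the multiple of `∂ζ/∂a` that makes it vanish
at `a = 1`, divide by the derivative of the phase, and differentiate the quotient to feed the next
source. The multiples build the `erfc` term, the quotients the remainder. The error of the truncated
formula has a small derivative and is controlled at both ends by the Chernoff bounds; matching the
two ends also shows that the multiples expand `gammaFactor`, so Stirling's formula is not needed
(`marcum_error_le`, `exists_marcum_expansion`).

Inversion. Let `h = 1/μ`, let `z` be `ζ` at the solution and `η = (z - ζ₀)/h`. A difference of two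
`erfc` terms is a tilted Gaussian integral over `[0, η]` (`tiltInt_eq_erfc_sub`). Hence, after
normalization, truncating the equation `Q = erfc (ζ₀ √(μ/2)) / 2` gives one which is smooth in `h`
down to `h = 0` and, at `h = 0`, strictly increasing in the scaled shift of `a`. At `h = 0` it reads
`(exp (ζη) - 1)/ζ = (f - 1)/ζ`, whose solution is `η = log f / ζ = ζ₁` (`tiltInt_marcumZeta1`). The
implicit function theorem and Taylor expansion give the higher coefficients; monotonicity of `Q`
confines exact solutions to bounded shifts; uniqueness of asymptotic coefficients makes the result
independent of the truncation; compactness makes it uniform (`InversionData.inversion`). The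
argument is stated for abstract data so that it serves twice: in the coordinates `(x, a)` for
inversion in `y`, and `(y, a)` for inversion in `x`. The transition is the case `ζ₀ = 0`, `N = 1`,
combined with `y - x - 1 = √(2x+1) ζ + O(ζ²)`. -/

/-- The Hadamard quotient `(f (θ, t) - f (θ, 0)) / t`, extended to `t = 0` by the derivative. -/
noncomputable def dquot {E : Type} (f : E × ℝ → ℝ) (q : E × ℝ) : ℝ :=
  if q.2 = 0 then deriv (fun s => f (q.1, s)) 0 else (f q - f (q.1, 0)) / q.2

theorem dquot_mul {E : Type} (f : E × ℝ → ℝ) (q : E × ℝ) : f q = f (q.1, 0) + q.2 * dquot f q := by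
  rcases q with ⟨θ, t⟩
  by_cases h : t = 0
  · simp [h]
  · simp only [dquot, h, if_false]
    field_simp
    ring

section Hadamard

variable {E : Type} [NormedAddCommGroup E] [NormedSpace ℝ E] [FiniteDimensional ℝ E]

/-- The integral over `[0, 1]` of a jointly `C^n` function is `C^n` in the parameter. -/
theorem contDiff_integral_zero_one (n : ℕ) :
    ∀ {G : Type} [NormedAddCommGroup G] [NormedSpace ℝ G] {F : E × ℝ → G},
      ContDiff ℝ n F → ContDiff ℝ n (fun e => ∫ s in (0 : ℝ)..1, F (e, s)) := by
  -- The codomain is generalized in the induction because the derivative of the integrand takes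
  -- values in `E →L[ℝ] G`.
  induction n with
  | zero =>
    intro G _ _ F hF
    have hF' : Continuous F := hF.continuous
    refine contDiff_zero.2 ?_
    exact intervalIntegral.continuous_parametric_intervalIntegral_of_continuous'
      (f := fun e s => F (e, s)) hF' 0 1
  | succ n ih =>
    intro G _ _ F hF
    have hF1 : ContDiff ℝ (n + 1) F := by exact_mod_cast hF
    rw [show ((n + 1 : ℕ) : WithTop ℕ∞) = (n : WithTop ℕ∞) + 1 by push_cast; rfl]
    set F' : E × ℝ → E →L[ℝ] G := fun q => (fderiv ℝ F q).comp (ContinuousLinearMap.inl ℝ E ℝ)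
    have hF' : ContDiff ℝ n F' :=
      (hF1.fderiv_right (m := n) le_rfl).clm_comp contDiff_const
    have hd : ∀ e s, HasFDerivAt (fun e => F (e, s)) (F' (e, s)) e := by
      intro e s
      have h1 : HasFDerivAt F (fderiv ℝ F (e, s)) (e, s) :=
        (hF1.differentiable (by simp)).differentiableAt.hasFDerivAt
      exact h1.comp e (hasFDerivAt_prodMk_left e s)
    refine contDiff_succ_iff_hasFDerivAt.2 ⟨fun e => ∫ s in (0 : ℝ)..1, F' (e, s), ih hF', ?_⟩
    intro e
    have hK : IsCompact (Metric.closedBall e 1 ×ˢ Icc (0 : ℝ) 1) :=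
      (isCompact_closedBall e 1).prod isCompact_Icc
    obtain ⟨C, hC⟩ := hK.exists_bound_of_continuousOn hF'.continuous.continuousOn
    refine intervalIntegral.hasFDerivAt_integral_of_dominated_of_fderiv_le
      (F := fun e s => F (e, s)) (F' := fun e s => F' (e, s)) (bound := fun _ => C)
      (Metric.closedBall_mem_nhds e one_pos) ?_ ?_ ?_ ?_ ?_ ?_
    · exact Eventually.of_forall fun x =>
        (hF1.continuous.comp (by fun_prop : Continuous fun s : ℝ => (x, s))).aestronglyMeasurable
    · exact (hF1.continuous.comp
        (by fun_prop : Continuous fun s : ℝ => (e, s))).intervalIntegrable _ _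
    · exact (hF'.continuous.comp (by fun_prop : Continuous fun s : ℝ => (e, s))).aestronglyMeasurable
    · refine Eventually.of_forall fun t ht x hx => hC (x, t) ⟨hx, ?_⟩
      rw [uIoc_of_le zero_le_one] at ht
      exact ⟨ht.1.le, ht.2⟩
    · exact intervalIntegrable_const
    · exact Eventually.of_forall fun t _ x _ => hd x t

/-- The quotient is the average `∫₀¹ ∂ₜf (θ, s t) ds`, at `t = 0` as well, so exactly one derivative
is lost. -/
theorem contDiff_dquot {n : ℕ} {f : E × ℝ → ℝ} (hf : ContDiff ℝ (n + 1) f) :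
    ContDiff ℝ n (dquot f) := by
  set f' : E × ℝ → ℝ := fun q => fderiv ℝ f q (0, 1)
  have hf' : ContDiff ℝ n f' := (hf.fderiv_right (m := n) le_rfl).clm_apply contDiff_const
  have hd : ∀ θ t, HasDerivAt (fun t => f (θ, t)) (f' (θ, t)) t := by
    intro θ t
    have h1 : HasFDerivAt f (fderiv ℝ f (θ, t)) (θ, t) :=
      (hf.differentiable (by simp)).differentiableAt.hasFDerivAt
    have h2 : HasDerivAt (fun t : ℝ => (θ, t)) (0, 1) t :=
      (hasDerivAt_const t θ).prodMk (hasDerivAt_id t)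
    exact h1.comp_hasDerivAt t h2
  have key : dquot f = fun q => ∫ s in (0 : ℝ)..1, f' (q.1, s * q.2) := by
    funext ⟨θ, t⟩
    by_cases h : t = 0
    · simp [dquot, h, (hd θ 0).deriv]
    · simp only [dquot, h, if_false]
      have h3 : ∀ s ∈ uIcc (0 : ℝ) 1,
          HasDerivAt (fun s => f (θ, s * t)) (f' (θ, s * t) * t) s := by
        intro s _
        exact (hd θ (s * t)).comp s (by simpa using (hasDerivAt_id s).mul_const t)
      have h4 := intervalIntegral.integral_eq_sub_of_hasDerivAt h3 (by
        refine Continuous.intervalIntegrable ?_ _ _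
        have := hf'.continuous
        fun_prop)
      rw [intervalIntegral.integral_mul_const] at h4
      simp only [one_mul, zero_mul] at h4
      rw [← h4, mul_div_cancel_right₀ _ h]
  rw [key]
  refine contDiff_integral_zero_one n (F := fun p : (E × ℝ) × ℝ => f' (p.1.1, p.2 * p.1.2)) ?_
  exact hf'.comp (by fun_prop)

/-- A function which is `C^n` at a point agrees near it with a globally `C^n` function. -/
theorem ContDiffAt.exists_contDiff_eventuallyEq {n : ℕ} {f : E → ℝ} {e : E}
    (hf : ContDiffAt ℝ n f e) : ∃ g : E → ℝ, ContDiff ℝ n g ∧ g =ᶠ[𝓝 e] f := by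
  obtain ⟨u, hu, hfu⟩ := hf.contDiffOn (m := n) le_rfl (by simp)
  obtain ⟨r, hr, hru⟩ := Metric.mem_nhds_iff.1 hu
  let χ : ContDiffBump e := ⟨r / 4, r / 2, by positivity, by linarith⟩
  refine ⟨fun x => χ x * f x, ?_, ?_⟩
  · rw [contDiff_iff_contDiffAt]
    intro x
    by_cases hx : x ∈ Metric.ball e r
    · have h1 : ContDiffAt ℝ n f x :=
        (hfu x (hru hx)).contDiffAt (mem_of_superset (Metric.isOpen_ball.mem_nhds hx) hru)
      exact χ.contDiff.contDiffAt.mul h1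
    · have : (fun x => χ x * f x) =ᶠ[𝓝 x] fun _ => 0 := by
        have hx' : x ∈ (Metric.closedBall e (r / 2))ᶜ := by
          simp only [Metric.mem_ball, not_lt] at hx
          simp only [mem_compl_iff, Metric.mem_closedBall, not_le]
          linarith
        filter_upwards [Metric.isClosed_closedBall.isOpen_compl.mem_nhds hx'] with z hz
        have : χ z = 0 := χ.zero_of_le_dist (by
          simp only [mem_compl_iff, Metric.mem_closedBall, not_le] at hz
          exact hz.le)
        simp [this]
      exact contDiffAt_const.congr_of_eventuallyEq this
  · filter_upwards [χ.eventuallyEq_one] with x hx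
    simp [hx]

/-- Near `(θ, 0)` the quotient only sees the germ of `f` there, including its values on the slice `t
= 0`, so `f` may be replaced by a globally smooth function. -/
theorem contDiffAt_dquot_zero {n : ℕ} {f : E × ℝ → ℝ} {θ : E}
    (hf : ContDiffAt ℝ (n + 1) f (θ, 0)) : ContDiffAt ℝ n (dquot f) (θ, 0) := by
  obtain ⟨g, hg, hgf⟩ := ContDiffAt.exists_contDiff_eventuallyEq
    (n := n + 1) (by exact_mod_cast hf)
  have hg' : ContDiff ℝ n (dquot g) := contDiff_dquot (by exact_mod_cast hg)
  refine hg'.contDiffAt.congr_of_eventuallyEq ?_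
  have h1 := hgf.eventually_nhds
  have h2 : ∀ᶠ q : E × ℝ in 𝓝 (θ, 0), g =ᶠ[𝓝 (q.1, (0 : ℝ))] f := by
    have : Tendsto (fun q : E × ℝ => (q.1, (0 : ℝ))) (𝓝 (θ, 0)) (𝓝 (θ, 0)) := by
      have : Continuous (fun q : E × ℝ => (q.1, (0 : ℝ))) := by fun_prop
      exact this.tendsto' _ _ rfl
    exact this.eventually h1
  filter_upwards [hgf, h2] with q hq hq2
  have h3 : (fun s : ℝ => g (q.1, s)) =ᶠ[𝓝 0] fun s => f (q.1, s) := by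
    have : Tendsto (fun s : ℝ => (q.1, s)) (𝓝 0) (𝓝 (q.1, (0 : ℝ))) :=
      (by fun_prop : Continuous fun s : ℝ => (q.1, s)).tendsto' _ _ rfl
    exact this.eventually hq2
  simp only [dquot, h3.deriv_eq, hq, hq2.eq_of_nhds]

/-- Smoothness is needed at two points, because the quotient at `(θ, t)` also involves the value at
`(θ, 0)`. -/
theorem contDiffAt_dquot {n : ℕ} {f : E × ℝ → ℝ} {q : E × ℝ}
    (h0 : ContDiffAt ℝ (n + 1) f (q.1, 0)) (hf : ContDiffAt ℝ (n + 1) f q) :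
    ContDiffAt ℝ n (dquot f) q := by
  rcases q with ⟨θ, t⟩
  by_cases ht : t = 0
  · subst ht
    exact contDiffAt_dquot_zero hf
  · have h1 : ContDiffAt ℝ n (fun q : E × ℝ => (f q - f (q.1, 0)) / q.2) (θ, t) := by
      have hle : (n : WithTop ℕ∞) ≤ n + 1 := by exact_mod_cast Nat.le_succ n
      refine ((hf.of_le hle).sub ?_).div contDiffAt_snd ht
      have h0' : ContDiffAt ℝ n f (θ, (0 : ℝ)) := h0.of_le hle
      exact ContDiffAt.comp (θ, t) (f := fun q : E × ℝ => (q.1, (0 : ℝ))) (g := f) h0'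
        (by fun_prop)
    refine h1.congr_of_eventuallyEq ?_
    have : {q : E × ℝ | q.2 ≠ 0} ∈ 𝓝 (θ, t) :=
      (isOpen_ne_fun continuous_snd continuous_const).mem_nhds ht
    filter_upwards [this] with q hq
    exact if_neg hq

theorem contDiffAt_infty_dquot {f : E × ℝ → ℝ} {q : E × ℝ}
    (h0 : ContDiffAt ℝ (⊤ : ℕ∞) f (q.1, 0)) (hf : ContDiffAt ℝ (⊤ : ℕ∞) f q) :
    ContDiffAt ℝ (⊤ : ℕ∞) (dquot f) q := by
  rw [contDiffAt_infty] at *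
  intro n
  exact contDiffAt_dquot (by exact_mod_cast h0 (n + 1)) (by exact_mod_cast hf (n + 1))

/-- Taylor expansion in the last variable, with a locally uniform remainder. -/
theorem ContDiffAt.exists_taylor (N : ℕ) : ∀ {g : E × ℝ → ℝ} {θ₀ : E},
    ContDiffAt ℝ N g (θ₀, 0) → ∃ (d : E → ℕ → ℝ) (C : ℝ), ∀ᶠ q : E × ℝ in 𝓝 (θ₀, 0),
      |g q - ∑ n ∈ Finset.range N, d q.1 n * q.2 ^ n| ≤ C * |q.2| ^ N := by
  induction N with
  | zero =>
    intro g θ₀ hg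
    refine ⟨fun _ _ => 0, |g (θ₀, 0)| + 1, ?_⟩
    have : ∀ᶠ q in 𝓝 (θ₀, 0), |g q| < |g (θ₀, 0)| + 1 :=
      hg.continuousAt.abs.eventually_lt_const (by linarith)
    filter_upwards [this] with q hq
    simpa using hq.le
  | succ N ih =>
    intro g θ₀ hg
    -- The expansion of the Hadamard quotient, multiplied by `t`, supplies every coefficient except
    -- the constant one.
    obtain ⟨d, C, h⟩ := ih (contDiffAt_dquot_zero (by exact_mod_cast hg) : ContDiffAt ℝ N (dquot g) (θ₀, 0))
    refine ⟨fun θ n => n.casesOn (g (θ, 0)) (fun m => d θ m), C, ?_⟩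
    filter_upwards [h] with q hq
    rw [Finset.sum_range_succ', dquot_mul g q]
    have : g (q.1, 0) + q.2 * dquot g q -
        (∑ n ∈ Finset.range N, d q.1 n * q.2 ^ (n + 1) + g (q.1, 0) * q.2 ^ 0)
        = q.2 * (dquot g q - ∑ n ∈ Finset.range N, d q.1 n * q.2 ^ n) := by
      rw [mul_sub, Finset.mul_sum, pow_zero, mul_one]
      have : ∀ n, d q.1 n * q.2 ^ (n + 1) = q.2 * (d q.1 n * q.2 ^ n) := fun n => by ring
      simp only [this]
      ring
    refine (congrArg (fun z : ℝ => |z|) this).trans_le ?_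
    simp only [abs_mul]
    rw [pow_succ, ← mul_assoc, mul_comm]
    gcongr

end Hadamard

/-- The coefficients of an asymptotic expansion are determined by the function. -/
theorem eq_zero_of_sum_mul_pow_le {N : ℕ} {d : ℕ → ℝ} {C : ℝ}
    (h : ∀ᶠ t : ℝ in 𝓝[>] 0, |∑ n ∈ Finset.range N, d n * t ^ n| ≤ C * t ^ N) :
    ∀ n < N, d n = 0 := by
  induction N generalizing d with
  | zero => intro n hn; omega
  | succ N ih =>
    have h0 : d 0 = 0 := by
      have h1 : Tendsto (fun t : ℝ => |∑ n ∈ Finset.range (N + 1), d n * t ^ n|) (𝓝[>] 0)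
          (𝓝 |∑ n ∈ Finset.range (N + 1), d n * 0 ^ n|) :=
        (Continuous.tendsto (by fun_prop) 0).mono_left nhdsWithin_le_nhds
      have h2 : Tendsto (fun t : ℝ => C * t ^ (N + 1)) (𝓝[>] 0) (𝓝 (C * 0 ^ (N + 1))) :=
        (Continuous.tendsto (by fun_prop) 0).mono_left nhdsWithin_le_nhds
      have h3 := le_of_tendsto_of_tendsto h1 h2 h
      simp only [Finset.sum_range_succ', pow_succ, mul_zero, Finset.sum_const_zero, pow_zero,
        mul_one, zero_add] at h3
      exact abs_nonpos_iff.1 h3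
    have h1 : ∀ᶠ t : ℝ in 𝓝[>] 0, |∑ n ∈ Finset.range N, d (n + 1) * t ^ n| ≤ C * t ^ N := by
      filter_upwards [h, self_mem_nhdsWithin] with t ht htpos
      have htpos : 0 < t := htpos
      rw [Finset.sum_range_succ', h0] at ht
      have : ∑ n ∈ Finset.range N, d (n + 1) * t ^ (n + 1) + 0 * t ^ 0 =
          t * ∑ n ∈ Finset.range N, d (n + 1) * t ^ n := by
        rw [Finset.mul_sum, zero_mul, add_zero]
        exact Finset.sum_congr rfl fun n _ => by ring
      rw [this, abs_mul, abs_of_pos htpos, pow_succ] at ht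
      have : t * |∑ n ∈ Finset.range N, d (n + 1) * t ^ n| ≤ t * (C * t ^ N) := by linarith
      exact le_of_mul_le_mul_left this htpos
    have h2 := ih h1
    intro n hn
    rcases n with _ | n
    · exact h0
    · exact h2 n (by omega)

/-! ### The complementary error function -/

theorem integrable_exp_neg_sq : Integrable fun t : ℝ => Real.exp (-t ^ 2) := by
  simpa using integrable_exp_neg_mul_sq one_pos

theorem erfc_eq (z : ℝ) :
    erfc z = 1 - 2 / √Real.pi * ∫ t in (0 : ℝ)..z, Real.exp (-t ^ 2) := by
  have h1 : ∫ t in Ioi (0 : ℝ), Real.exp (-t ^ 2) = √Real.pi / 2 := by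
    simpa using integral_gaussian_Ioi 1
  have h2 := intervalIntegral.integral_Ioi_sub_Ioi'
    (integrable_exp_neg_sq.integrableOn (s := Ioi 0)) (integrable_exp_neg_sq.integrableOn (s := Ioi z))
  have hpi : √Real.pi ≠ 0 := (Real.sqrt_pos.2 Real.pi_pos).ne'
  rw [erfc, ← h2, h1]
  field_simp
  ring

theorem hasDerivAt_erfc (z : ℝ) : HasDerivAt erfc (-(2 / √Real.pi * Real.exp (-z ^ 2))) z := by
  have h : Continuous fun t : ℝ => Real.exp (-t ^ 2) := by fun_prop
  have h1 := ((h.integral_hasStrictDerivAt 0 z).hasDerivAt.const_mul (2 / √Real.pi)).const_sub 1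
  exact h1.congr_of_eventuallyEq (Eventually.of_forall erfc_eq)

theorem continuous_erfc : Continuous erfc :=
  continuous_iff_continuousAt.2 fun z => (hasDerivAt_erfc z).continuousAt

theorem strictAnti_erfc : StrictAnti erfc := by
  refine strictAnti_of_hasDerivAt_neg (f' := fun z => -(2 / √Real.pi * Real.exp (-z ^ 2)))
    hasDerivAt_erfc fun z => ?_
  have : 0 < √Real.pi := Real.sqrt_pos.2 Real.pi_pos
  rw [neg_lt_zero]
  positivity

@[simp] theorem erfc_zero : erfc 0 = 1 := by simp [erfc_eq]

theorem erfc_neg (z : ℝ) : erfc (-z) = 2 - erfc z := by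
  have : ∫ t in (0 : ℝ)..-z, Real.exp (-t ^ 2) = -∫ t in (0 : ℝ)..z, Real.exp (-t ^ 2) := by
    have := intervalIntegral.integral_comp_neg (a := 0) (b := -z)
      (fun t : ℝ => Real.exp (-t ^ 2))
    simp only [neg_sq, neg_neg, neg_zero] at this
    rw [this, intervalIntegral.integral_symm]
  rw [erfc_eq, erfc_eq, this]
  ring

theorem erfc_pos (z : ℝ) : 0 < erfc z := by
  have h : 0 ≤ erfc (z + 1) := by
    rw [erfc]
    exact mul_nonneg (by positivity) (integral_nonneg fun _ => (Real.exp_pos _).le)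
  exact h.trans_lt (strictAnti_erfc (lt_add_one z))

/-- After the shift `t = s + z` the cross term is dropped: `(s + z)² ≥ s² + z²` for `s, z ≥ 0`. -/
theorem erfc_le_exp {z : ℝ} (hz : 0 ≤ z) : erfc z ≤ Real.exp (-z ^ 2) := by
  have h0 : 0 < √Real.pi := Real.sqrt_pos.2 Real.pi_pos
  have h1 : ∫ t in Ioi z, Real.exp (-t ^ 2) = ∫ s in Ioi (0 : ℝ), Real.exp (-(s + z) ^ 2) := by
    have := (measurePreserving_add_right volume z).setIntegral_preimage_emb
      (MeasurableEquiv.addRight z).measurableEmbedding (fun t : ℝ => Real.exp (-t ^ 2)) (Ioi z)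
    simpa using this.symm
  have h2 : ∫ s in Ioi (0 : ℝ), Real.exp (-(s + z) ^ 2) ≤
      ∫ s in Ioi (0 : ℝ), Real.exp (-z ^ 2) * Real.exp (-s ^ 2) := by
    refine setIntegral_mono_on ?_ ?_ measurableSet_Ioi ?_
    · exact (integrable_exp_neg_sq.comp_add_right z).integrableOn
    · exact (integrable_exp_neg_sq.const_mul _).integrableOn
    · intro s hs
      have hs : 0 < s := hs
      rw [← Real.exp_add]
      gcongr
      nlinarith
  have h3 : ∫ t in Ioi (0 : ℝ), Real.exp (-t ^ 2) = √Real.pi / 2 := by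
    simpa using integral_gaussian_Ioi 1
  rw [integral_const_mul, h3] at h2
  rw [erfc, h1]
  calc 2 / √Real.pi * ∫ s in Ioi (0 : ℝ), Real.exp (-(s + z) ^ 2)
      ≤ 2 / √Real.pi * (Real.exp (-z ^ 2) * (√Real.pi / 2)) := by gcongr
    _ = _ := by field_simp

theorem tendsto_erfc_atTop : Tendsto erfc atTop (𝓝 0) := by
  have h1 : Tendsto (fun z : ℝ => Real.exp (-z ^ 2)) atTop (𝓝 0) :=
    Real.tendsto_exp_neg_atTop_nhds_zero.comp (tendsto_pow_atTop two_ne_zero)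
  refine tendsto_of_tendsto_of_tendsto_of_le_of_le' tendsto_const_nhds h1
    (Eventually.of_forall fun z => (erfc_pos z).le) ?_
  filter_upwards [eventually_ge_atTop 0] with z hz using erfc_le_exp hz

theorem tendsto_erfc_atBot : Tendsto erfc atBot (𝓝 2) := by
  have h := (tendsto_erfc_atTop.comp tendsto_neg_atBot_atTop).const_sub 2
  rw [sub_zero] at h
  refine h.congr fun z => ?_
  simp [erfc_neg]

theorem existsUnique_half_erfc_mul_eq {s q : ℝ} (hs : 0 < s) (hq0 : 0 < q) (hq1 : q < 1) :
    ∃! z : ℝ, 1 / 2 * erfc (z * s) = q := by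
  obtain ⟨b, hb⟩ := (tendsto_erfc_atTop.eventually (gt_mem_nhds (by linarith : 0 < 2 * q))).exists
  obtain ⟨a, ha⟩ := (tendsto_erfc_atBot.eventually (lt_mem_nhds (by linarith : 2 * q < 2))).exists
  obtain ⟨w, hw⟩ : 2 * q ∈ range erfc :=
    mem_range_of_exists_le_of_exists_ge continuous_erfc ⟨b, hb.le⟩ ⟨a, ha.le⟩
  refine ⟨w / s, ?_, fun y hy => ?_⟩
  · simp only [div_mul_cancel₀ _ hs.ne', hw]
    ring
  · have : erfc (y * s) = erfc w := by rw [hw, ← hy]; ring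
    rw [eq_div_iff hs.ne', strictAnti_erfc.injective this]

/-! ### The tilted Gaussian integral -/

/-- `∫_0^η exp (z s - h s² / 2) ds`, written over the unit interval. -/
noncomputable def tiltInt (z h η : ℝ) : ℝ :=
  ∫ s in (0 : ℝ)..1, η * Real.exp (z * (η * s) - h * (η * s) ^ 2 / 2)

theorem tiltInt_eq (z h η : ℝ) :
    tiltInt z h η = ∫ s in (0 : ℝ)..η, Real.exp (z * s - h * s ^ 2 / 2) := by
  have := intervalIntegral.mul_integral_comp_mul_left (a := 0) (b := 1)
    (f := fun s => Real.exp (z * s - h * s ^ 2 / 2)) η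
  simp only [mul_zero, mul_one] at this
  rw [← this, tiltInt, intervalIntegral.integral_const_mul]

theorem contDiff_tiltInt : ContDiff ℝ (⊤ : ℕ∞) fun q : ℝ × ℝ × ℝ => tiltInt q.1 q.2.1 q.2.2 := by
  rw [contDiff_infty]
  intro n
  refine contDiff_integral_zero_one n (F := fun p : (ℝ × ℝ × ℝ) × ℝ =>
    p.1.2.2 * Real.exp (p.1.1 * (p.1.2.2 * p.2) - p.1.2.1 * (p.1.2.2 * p.2) ^ 2 / 2)) ?_
  fun_prop

theorem hasDerivAt_tiltInt (z h η : ℝ) :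
    HasDerivAt (tiltInt z h) (Real.exp (z * η - h * η ^ 2 / 2)) η := by
  have hc : Continuous fun s : ℝ => Real.exp (z * s - h * s ^ 2 / 2) := by fun_prop
  exact (hc.integral_hasStrictDerivAt 0 η).hasDerivAt.congr_of_eventuallyEq
    (Eventually.of_forall (tiltInt_eq z h))

theorem strictMono_tiltInt (z h : ℝ) : StrictMono (tiltInt z h) :=
  strictMono_of_hasDerivAt_pos (hasDerivAt_tiltInt z h) fun _ => Real.exp_pos _

/-- At `h = 0` the tilted integral is elementary. The product form covers `z = 0` too; it turns the
leading-order equation into `exp (ζ ζ₁) = f`. -/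
theorem mul_tiltInt_zero (z η : ℝ) : z * tiltInt z 0 η = Real.exp (z * η) - 1 := by
  have h1 : ∀ s ∈ uIcc 0 η, HasDerivAt (fun s => Real.exp (z * s)) (Real.exp (z * s) * z) s :=
    fun s _ => by simpa using ((hasDerivAt_id s).const_mul z).exp
  have h2 := intervalIntegral.integral_eq_sub_of_hasDerivAt h1
    ((by fun_prop : Continuous fun s => Real.exp (z * s) * z).intervalIntegrable _ _)
  rw [intervalIntegral.integral_mul_const] at h2
  simp only [mul_zero, Real.exp_zero] at h2
  rw [tiltInt_eq, ← h2, mul_comm]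
  simp

theorem tiltInt_zero_left (η : ℝ) : tiltInt 0 0 η = η := by simp [tiltInt_eq]

/-- The tilted integral measures the increment of the complementary error function. -/
theorem tiltInt_eq_erfc_sub {μ : ℝ} (hμ : 0 < μ) (z₀ z : ℝ) :
    tiltInt z μ⁻¹ ((z - z₀) * μ) = √(2 * Real.pi * μ) * Real.exp (μ * z ^ 2 / 2) *
      (1 / 2 * erfc (z₀ * √(μ / 2)) - 1 / 2 * erfc (z * √(μ / 2))) := by
  set s := √(μ / 2)
  have hs : 0 < s := Real.sqrt_pos.2 (by positivity)
  have hs2 : s ^ 2 = μ / 2 := Real.sq_sqrt (by positivity)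
  have hpi : 0 < √Real.pi := Real.sqrt_pos.2 Real.pi_pos
  have h1 : √(2 * Real.pi * μ) = 2 * √Real.pi * s := by
    rw [show 2 * Real.pi * μ = (2 * √Real.pi * s) ^ 2 by
      rw [mul_pow, mul_pow, Real.sq_sqrt Real.pi_pos.le, hs2]; ring]
    exact Real.sqrt_sq (by positivity)
  -- Completing the square: `z r - r²/(2μ) = μ z²/2 - (z s - (s/μ) r)²` with `s² = μ/2`.
  have h2 : tiltInt z μ⁻¹ ((z - z₀) * μ) =
      ∫ r in (0 : ℝ)..((z - z₀) * μ), Real.exp (μ * z ^ 2 / 2) *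
        Real.exp (-(z * s - s / μ * r) ^ 2) := by
    rw [tiltInt_eq]
    refine intervalIntegral.integral_congr fun r _ => ?_
    simp only [← Real.exp_add]
    congr 1
    have : (z * s - s / μ * r) ^ 2 = s ^ 2 * (z - r / μ) ^ 2 := by ring
    rw [this, hs2]
    field_simp
    ring
  rw [h2, intervalIntegral.integral_const_mul,
    intervalIntegral.integral_comp_sub_mul (fun t => Real.exp (-t ^ 2)) (by positivity), erfc_eq,
    erfc_eq, h1]
  have h3 : z * s - s / μ * ((z - z₀) * μ) = z₀ * s := by field_simp; ring
  have hI : ∀ w, IntervalIntegrable (fun t : ℝ => Real.exp (-t ^ 2)) volume 0 w := fun w =>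
    (by fun_prop : Continuous fun t : ℝ => Real.exp (-t ^ 2)).intervalIntegrable _ _
  rw [h3, mul_zero, sub_zero, ← intervalIntegral.integral_interval_sub_left (hI _) (hI _),
    smul_eq_mul]
  have : μ = 2 * s ^ 2 := by rw [hs2]; ring
  rw [show (s / μ)⁻¹ = 2 * s by rw [this]; field_simp]
  field_simp
  ring

/-! ### Inversion of a uniform expansion with an error-function main term -/

/-- The point `(p, a + h α)`, as a function of `(((p, a), h), α)`. -/
def shiftPt (x : ((ℝ × ℝ) × ℝ) × ℝ) : ℝ × ℝ := (x.1.1.1, x.1.1.2 + x.1.2 * x.2)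

/-- The scaled increment `(Z (p, a + h α) - Z (p, a)) / h`, extended smoothly to `h = 0`. -/
noncomputable def scaledIncr (Z : ℝ × ℝ → ℝ) (x : ((ℝ × ℝ) × ℝ) × ℝ) : ℝ :=
  x.2 * dquot (fun r : (ℝ × ℝ) × ℝ => Z (r.1.1, r.1.2 + r.2)) (x.1.1, x.1.2 * x.2)

/-- The `k`-th coefficient of the equation for the scaled shift. -/
noncomputable def eqnCoeff (Z : ℝ × ℝ → ℝ) (σ S : ℕ → ℝ × ℝ → ℝ) (k : ℕ)
    (x : ((ℝ × ℝ) × ℝ) × ℝ) : ℝ :=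
  σ k (shiftPt x) * tiltInt (Z (shiftPt x)) x.1.2 (scaledIncr Z x) - S k (shiftPt x)

/-- The equation for the scaled shift, truncated after `N` terms. -/
noncomputable def truncEqn (Z : ℝ × ℝ → ℝ) (σ S : ℕ → ℝ × ℝ → ℝ) (N : ℕ)
    (x : ((ℝ × ℝ) × ℝ) × ℝ) : ℝ :=
  ∑ k ∈ Finset.range N, x.1.2 ^ k * eqnCoeff Z σ S k x

/-- The partial derivative of `Z` in the second variable. -/
noncomputable def derivSnd (Z : ℝ × ℝ → ℝ) (u : ℝ × ℝ) : ℝ := deriv (fun a => Z (u.1, a)) u.2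

/-- The exact counterpart of `S`: the difference between `Q` and its error-function main term,
suitably normalized. -/
noncomputable def erfcRemainder (Z : ℝ × ℝ → ℝ) (κ : ℝ → ℝ) (Q : ℝ → ℝ × ℝ → ℝ) (μ : ℝ)
    (u : ℝ × ℝ) : ℝ :=
  √(2 * Real.pi * μ) * Real.exp (μ * Z u ^ 2 / 2) * κ μ *
    (Q μ u - 1 / 2 * erfc (Z u * √(μ / 2)))

/-- The data for the inversion of `Q μ (p, a) = erfc (z √(μ / 2)) / 2` with respect to `a`. -/
structure InversionData (U T : Set (ℝ × ℝ)) (Z e : ℝ × ℝ → ℝ) (σ S : ℕ → ℝ × ℝ → ℝ)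
    (κ : ℝ → ℝ) (Q : ℝ → ℝ × ℝ → ℝ) : Prop where
  subset : T ⊆ U
  contDiffAt_Z : ∀ u ∈ U, ContDiffAt ℝ (⊤ : ℕ∞) Z u
  contDiffAt_σ : ∀ k, ∀ u ∈ U, ContDiffAt ℝ (⊤ : ℕ∞) (σ k) u
  contDiffAt_S : ∀ k, ∀ u ∈ U, ContDiffAt ℝ (⊤ : ℕ∞) (S k) u
  σ_zero : ∀ u ∈ U, σ 0 u = 1
  derivSnd_pos : ∀ u ∈ U, 0 < derivSnd Z u
  -- The leading-order equation: it identifies `e` as the first coefficient.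
  tiltInt_e : ∀ u ∈ T, tiltInt (Z u) 0 (e u) = S 0 u
  -- The fibres of `T` are intervals, so points between an exact solution and its base point can be
  -- tested.
  between : ∀ p a b c, (p, a) ∈ T → (p, c) ∈ T → a ≤ b → b ≤ c → (p, b) ∈ T
  anti : ∀ μ p a b, 0 < μ → (p, a) ∈ T → (p, b) ∈ T → a < b → Q μ (p, b) < Q μ (p, a)
  κ_pos : ∀ μ, 0 < μ → 0 < κ μ
  expansion : ∀ N : ℕ, ∀ u ∈ T, ∃ C : ℝ, ∀ᶠ q : (ℝ × ℝ) × ℝ in 𝓝 (u, 0), 0 < q.2 → q.1 ∈ T →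
    |κ q.2⁻¹ - ∑ k ∈ Finset.range N, q.2 ^ k * σ k q.1| ≤ C * q.2 ^ N ∧
    |erfcRemainder Z κ Q q.2⁻¹ q.1 - ∑ k ∈ Finset.range N, q.2 ^ k * S k q.1| ≤ C * q.2 ^ N

section General

variable {Z : ℝ × ℝ → ℝ}

theorem mul_scaledIncr (x : ((ℝ × ℝ) × ℝ) × ℝ) :
    x.1.2 * scaledIncr Z x = Z (shiftPt x) - Z x.1.1 := by
  have := dquot_mul (fun r : (ℝ × ℝ) × ℝ => Z (r.1.1, r.1.2 + r.2)) (x.1.1, x.1.2 * x.2)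
  simp only [add_zero] at this
  rw [scaledIncr, shiftPt, this]
  ring

theorem scaledIncr_zero (u : ℝ × ℝ) (α : ℝ) : scaledIncr Z ((u, 0), α) = α * derivSnd Z u := by
  have := deriv_comp_const_add (f := fun a => Z (u.1, a)) u.2 0
  simp only [add_zero] at this
  simp [scaledIncr, dquot, derivSnd, this]

theorem continuous_shiftPt : Continuous shiftPt := by
  unfold shiftPt
  fun_prop

theorem contDiff_shiftPt : ContDiff ℝ (⊤ : ℕ∞) shiftPt := by
  unfold shiftPt
  fun_prop

@[simp] theorem shiftPt_zero (u : ℝ × ℝ) (α : ℝ) : shiftPt ((u, 0), α) = u := by simp [shiftPt]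

end General

namespace InversionData

variable {U T : Set (ℝ × ℝ)} {Z e : ℝ × ℝ → ℝ} {σ S : ℕ → ℝ × ℝ → ℝ}
    {κ : ℝ → ℝ} {Q : ℝ → ℝ × ℝ → ℝ}

section

variable (D : InversionData U T Z e σ S κ Q)
include D

theorem contDiffAt_scaledIncr {u : ℝ × ℝ} (hu : u ∈ U) (α : ℝ) :
    ContDiffAt ℝ (⊤ : ℕ∞) (scaledIncr Z) ((u, 0), α) := by
  have h1 : ContDiffAt ℝ (⊤ : ℕ∞) (fun r : (ℝ × ℝ) × ℝ => Z (r.1.1, r.1.2 + r.2)) (u, 0) := by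
    refine ContDiffAt.comp (u, (0 : ℝ)) (g := Z) ?_ (by fun_prop)
    simpa using D.contDiffAt_Z u hu
  have h2 := contDiffAt_infty_dquot h1 h1
  refine contDiffAt_snd.mul ?_
  refine ContDiffAt.comp ((u, (0 : ℝ)), α) (g := dquot _)
    (f := fun x : ((ℝ × ℝ) × ℝ) × ℝ => (x.1.1, x.1.2 * x.2)) ?_ (by fun_prop)
  simpa using h2

theorem contDiffAt_eqnCoeff {u : ℝ × ℝ} (hu : u ∈ U) (α : ℝ) (k : ℕ) :
    ContDiffAt ℝ (⊤ : ℕ∞) (eqnCoeff Z σ S k) ((u, 0), α) := by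
  have hc : ∀ {f : ℝ × ℝ → ℝ}, ContDiffAt ℝ (⊤ : ℕ∞) f u →
      ContDiffAt ℝ (⊤ : ℕ∞) (fun x => f (shiftPt x)) ((u, 0), α) := by
    intro f hf
    refine ContDiffAt.comp ((u, (0 : ℝ)), α) (g := f) ?_ contDiff_shiftPt.contDiffAt
    simpa using hf
  refine ((hc (D.contDiffAt_σ k u hu)).mul ?_).sub (hc (D.contDiffAt_S k u hu))
  exact contDiff_tiltInt.contDiffAt.comp ((u, (0 : ℝ)), α)
    ((hc (D.contDiffAt_Z u hu)).prodMk
      ((by fun_prop : ContDiffAt ℝ (⊤ : ℕ∞) (fun x : ((ℝ × ℝ) × ℝ) × ℝ => x.1.2) _).prodMk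
        (D.contDiffAt_scaledIncr hu α)))

theorem contDiffAt_truncEqn {u : ℝ × ℝ} (hu : u ∈ U) (α : ℝ) (N : ℕ) :
    ContDiffAt ℝ (⊤ : ℕ∞) (truncEqn Z σ S N) ((u, 0), α) := by
  unfold truncEqn
  refine ContDiffAt.sum fun k _ => ?_
  exact ContDiffAt.mul (by fun_prop) (D.contDiffAt_eqnCoeff hu α k)

theorem truncEqn_zero {u : ℝ × ℝ} (hu : u ∈ U) (α : ℝ) (N : ℕ) :
    truncEqn Z σ S (N + 1) ((u, 0), α) = tiltInt (Z u) 0 (α * derivSnd Z u) - S 0 u := by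
  simp [truncEqn, Finset.sum_range_succ', eqnCoeff, scaledIncr_zero, D.σ_zero u hu]

theorem truncEqn_zero_root {u : ℝ × ℝ} (hu : u ∈ T) (N : ℕ) :
    truncEqn Z σ S (N + 1) ((u, 0), e u / derivSnd Z u) = 0 := by
  rw [D.truncEqn_zero (D.subset hu), div_mul_cancel₀ _ (D.derivSnd_pos u (D.subset hu)).ne',
    D.tiltInt_e u hu, sub_self]

theorem strictMono_truncEqn_zero {u : ℝ × ℝ} (hu : u ∈ T) (N : ℕ) :
    StrictMono fun α => truncEqn Z σ S (N + 1) ((u, 0), α) := by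
  intro α β h
  simp only [D.truncEqn_zero (D.subset hu)]
  have := strictMono_tiltInt (Z u) 0
    (mul_lt_mul_of_pos_right h (D.derivSnd_pos u (D.subset hu)))
  linarith

/-- The derivative in `α` is an exponential times `derivSnd Z u`, hence positive; this is the
nondegeneracy required by the implicit function theorem. -/
theorem hasDerivAt_truncEqn_zero {u : ℝ × ℝ} (hu : u ∈ T) (N : ℕ) (α : ℝ) :
    ∃ d, 0 < d ∧ HasDerivAt (fun α => truncEqn Z σ S (N + 1) ((u, 0), α)) d α := by
  have hd := D.derivSnd_pos u (D.subset hu)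
  have h1 := ((hasDerivAt_tiltInt (Z u) 0 (α * derivSnd Z u)).comp α
    (by simpa using (hasDerivAt_id α).mul_const (derivSnd Z u))).sub_const (S 0 u)
  refine ⟨_, ?_, h1.congr_of_eventuallyEq (Eventually.of_forall fun β =>
    D.truncEqn_zero (D.subset hu) β N)⟩
  positivity

/-- Local solution of the truncated equation, its expansion, and the stability of the latter. -/
theorem exists_expansion {u : ℝ × ℝ} (hu : u ∈ T) (N : ℕ) :
    ∃ (d : ℝ × ℝ → ℕ → ℝ) (C : ℝ) (A : (ℝ × ℝ) × ℝ → ℝ),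
      (∀ᶠ q in 𝓝 (u, 0), ContinuousAt A q) ∧ A (u, 0) = e u / derivSnd Z u ∧
      (∀ᶠ q in 𝓝 (u, 0), truncEqn Z σ S (N + 1) (q, A q) = 0) ∧
      ∀ᶠ x in 𝓝 ((u, 0), e u / derivSnd Z u),
        |scaledIncr Z x - ∑ n ∈ Finset.range N, d x.1.1 n * x.1.2 ^ n| ≤
          C * (|truncEqn Z σ S (N + 1) x| + |x.1.2| ^ N) := by
  set f := truncEqn Z σ S (N + 1)
  set α₀ := e u / derivSnd Z u
  set x₀ : ((ℝ × ℝ) × ℝ) × ℝ := ((u, 0), α₀)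
  have hf : ContDiffAt ℝ (⊤ : ℕ∞) f x₀ := D.contDiffAt_truncEqn (D.subset hu) α₀ (N + 1)
  have hf0 : f x₀ = 0 := D.truncEqn_zero_root hu N
  have htop : ((⊤ : ℕ∞) : WithTop ℕ∞) ≠ 0 := by simp
  have hstrict := hf.hasStrictFDerivAt htop
  obtain ⟨d, hd, hder⟩ := D.hasDerivAt_truncEqn_zero hu N α₀
  have hdf : ∀ β : ℝ, fderiv ℝ f x₀ (0, β) = d * β := by
    intro β
    have h1 : HasDerivAt (fun α : ℝ => ((u, (0 : ℝ)), α)) (0, 1) α₀ :=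
      (hasDerivAt_const α₀ (u, (0 : ℝ))).prodMk (hasDerivAt_id α₀)
    have h2 := (hstrict.hasFDerivAt.comp_hasDerivAt α₀ h1).unique hder
    have h3 : ((0 : (ℝ × ℝ) × ℝ), β) = β • ((0 : (ℝ × ℝ) × ℝ), (1 : ℝ)) := by simp
    rw [h3, map_smul, h2, smul_eq_mul, mul_comm]
  have hinv : (fderiv ℝ f x₀ ∘L .inr ℝ ((ℝ × ℝ) × ℝ) ℝ).IsInvertible := by
    refine ⟨ContinuousLinearEquiv.unitsEquivAut ℝ (Units.mk0 d hd.ne'), ?_⟩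
    ext
    simp [hdf]
  set A := hf.implicitFunction htop hinv
  have hA : ContDiffAt ℝ (⊤ : ℕ∞) A (u, 0) := hf.contDiffAt_implicitFunction htop hinv
  have hA0 : A (u, 0) = α₀ := hf.implicitFunction_apply_self htop hinv
  have hAeq : ∀ᶠ q in 𝓝 (u, 0), f (q, A q) = 0 := by
    have := hf.eventually_apply_implicitFunction htop hinv
    rw [hf0] at this
    exact this
  have hI : ContDiffAt ℝ (⊤ : ℕ∞) (scaledIncr Z) x₀ := D.contDiffAt_scaledIncr (D.subset hu) α₀
  have hg : ContDiffAt ℝ (⊤ : ℕ∞) (fun q => scaledIncr Z (q, A q)) (u, 0) := by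
    refine ContDiffAt.comp (u, (0 : ℝ)) (g := scaledIncr Z) ?_ (contDiffAt_id.prodMk hA)
    simpa [hA0] using hI
  obtain ⟨c, C₁, hC₁⟩ := (hg.of_le (m := N) (by exact_mod_cast le_top)).exists_taylor N
  obtain ⟨K, t, ht, hK⟩ := (hI.of_le (m := 1) (by exact_mod_cast le_top)).exists_lipschitzOnWith
  have hcontA : ∀ᶠ q in 𝓝 (u, 0), ContinuousAt A q := by
    have h1 : ContDiffAt ℝ 1 A (u, 0) := hA.of_le (by exact_mod_cast le_top)
    filter_upwards [h1.eventually (by simp)] with q hq using hq.continuousAt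
  have hxA : Tendsto (fun x : ((ℝ × ℝ) × ℝ) × ℝ => (x.1, A x.1)) (𝓝 x₀) (𝓝 x₀) := by
    have h1 : Tendsto (fun x : ((ℝ × ℝ) × ℝ) × ℝ => x.1) (𝓝 x₀) (𝓝 (u, 0)) :=
      continuous_fst.tendsto x₀
    have h2 := hA.continuousAt.tendsto.comp h1
    rw [hA0] at h2
    exact h1.prodMk_nhds h2
  -- Stability of the root: strict differentiability is applied to `x` and `(x.1, A x.1)`, which
  -- differ only in the last coordinate, where the derivative is `d > 0`. Half of `d` absorbs the
  -- error term.
  have hpair : ∀ᶠ x in 𝓝 x₀, |x.2 - A x.1| ≤ 2 / d * |f x| := by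
    have h1 := hstrict.isLittleO.bound (half_pos hd)
    have h2 : Tendsto (fun x : ((ℝ × ℝ) × ℝ) × ℝ => (x, (x.1, A x.1))) (𝓝 x₀) (𝓝 (x₀, x₀)) :=
      tendsto_id.prodMk_nhds hxA
    have h3 : Tendsto (fun x : ((ℝ × ℝ) × ℝ) × ℝ => x.1) (𝓝 x₀) (𝓝 (u, 0)) :=
      continuous_fst.tendsto x₀
    filter_upwards [h2.eventually h1, h3.eventually hAeq] with x hx hx0
    have h4 : x - (x.1, A x.1) = ((0 : (ℝ × ℝ) × ℝ), x.2 - A x.1) := by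
      ext <;> simp
    simp only [hx0, sub_zero, h4, hdf, Real.norm_eq_abs, Prod.norm_mk, norm_zero] at hx
    rw [max_eq_right (abs_nonneg _)] at hx
    have h5 : d * |x.2 - A x.1| ≤ |f x| + d / 2 * |x.2 - A x.1| := by
      calc d * |x.2 - A x.1| = |f x - (f x - d * (x.2 - A x.1))| := by
            rw [sub_sub_cancel, abs_mul, abs_of_pos hd]
        _ ≤ |f x| + |f x - d * (x.2 - A x.1)| := abs_sub _ _
        _ ≤ _ := by gcongr
    rw [div_mul_eq_mul_div, le_div_iff₀ hd]
    linarith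
  refine ⟨c, K * (2 / d) + |C₁|, A, hcontA, hA0, hAeq, ?_⟩
  have h3 : Tendsto (fun x : ((ℝ × ℝ) × ℝ) × ℝ => x.1) (𝓝 x₀) (𝓝 (u, 0)) :=
    continuous_fst.tendsto x₀
  filter_upwards [hpair, h3.eventually hC₁, ht, hxA.eventually ht] with x hx1 hx2 hx3 hx4
  have h5 : |scaledIncr Z x - scaledIncr Z (x.1, A x.1)| ≤ K * |x.2 - A x.1| := by
    have := hK.dist_le_mul x hx3 _ hx4
    rw [Real.dist_eq] at this
    refine this.trans_eq ?_
    rw [dist_eq_norm, show x - (x.1, A x.1) = ((0 : (ℝ × ℝ) × ℝ), x.2 - A x.1) by ext <;> simp,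
      Prod.norm_mk, norm_zero, max_eq_right (norm_nonneg _), Real.norm_eq_abs]
  calc |scaledIncr Z x - ∑ n ∈ Finset.range N, c x.1.1 n * x.1.2 ^ n|
      ≤ |scaledIncr Z x - scaledIncr Z (x.1, A x.1)| +
        |scaledIncr Z (x.1, A x.1) - ∑ n ∈ Finset.range N, c x.1.1 n * x.1.2 ^ n| :=
        abs_sub_le _ _ _
    _ ≤ K * (2 / d * |f x|) + |C₁| * |x.1.2| ^ N := by
        refine add_le_add (h5.trans (by gcongr)) (hx2.trans ?_)
        gcongr
        exact le_abs_self _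
    _ ≤ (K * (2 / d) + |C₁|) * (|f x| + |x.1.2| ^ N) := by
        have h6 : 0 ≤ K * (2 / d) := by positivity
        have h7 := mul_nonneg h6 (pow_nonneg (abs_nonneg x.1.2) N)
        have h8 := mul_nonneg (abs_nonneg C₁) (abs_nonneg (f x))
        nlinarith

end

end InversionData

/-! ### Coefficients of approximate solutions, confinement of exact solutions, and the local
inversion theorem. -/

namespace InversionData

variable {U T : Set (ℝ × ℝ)} {Z e : ℝ × ℝ → ℝ} {σ S : ℕ → ℝ × ℝ → ℝ}
    {κ : ℝ → ℝ} {Q : ℝ → ℝ × ℝ → ℝ}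

/-- The sequence `c` gives the expansion, up to order `N`, of the scaled increment of an
approximate solution of the truncated equation at the base point `u`. -/
def IsExpansion (Z e : ℝ × ℝ → ℝ) (σ S : ℕ → ℝ × ℝ → ℝ) (u : ℝ × ℝ) (N : ℕ) (c : ℕ → ℝ) :
    Prop :=
  ∃ (C : ℝ) (α : ℝ → ℝ), Tendsto α (𝓝[>] 0) (𝓝 (e u / derivSnd Z u)) ∧
    ∀ᶠ h in 𝓝[>] 0, |truncEqn Z σ S (N + 1) ((u, h), α h)| ≤ C * h ^ N ∧
      |scaledIncr Z ((u, h), α h) - ∑ n ∈ Finset.range N, c n * h ^ n| ≤ C * h ^ N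

theorem tendsto_pair {u : ℝ × ℝ} {α : ℝ → ℝ} {α₀ : ℝ} (h : Tendsto α (𝓝[>] 0) (𝓝 α₀)) :
    Tendsto (fun h : ℝ => ((u, h), α h)) (𝓝[>] 0) (𝓝 ((u, 0), α₀)) :=
  (tendsto_const_nhds.prodMk_nhds (tendsto_id.mono_left nhdsWithin_le_nhds)).prodMk_nhds h

/-- The normalized difference of the two sides of the equation to be inverted. -/
theorem exact_eqn {x : ((ℝ × ℝ) × ℝ) × ℝ} (hx : 0 < x.1.2) :
    κ x.1.2⁻¹ * tiltInt (Z (shiftPt x)) x.1.2 (scaledIncr Z x) -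
        erfcRemainder Z κ Q x.1.2⁻¹ (shiftPt x) =
      √(2 * Real.pi * x.1.2⁻¹) * Real.exp (x.1.2⁻¹ * Z (shiftPt x) ^ 2 / 2) * κ x.1.2⁻¹ *
        (1 / 2 * erfc (Z x.1.1 * √(x.1.2⁻¹ / 2)) - Q x.1.2⁻¹ (shiftPt x)) := by
  have h1 := tiltInt_eq_erfc_sub (inv_pos.2 hx) (Z x.1.1) (Z (shiftPt x))
  have h2 : (Z (shiftPt x) - Z x.1.1) * x.1.2⁻¹ = scaledIncr Z x := by
    rw [← mul_scaledIncr]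
    field_simp
  rw [inv_inv, h2] at h1
  rw [h1, erfcRemainder]
  ring

section

variable (D : InversionData U T Z e σ S κ Q)
include D

/-- The last term of the equation and the last term of the expansion are both `O(h ^ N)` along `α`,
since `eqnCoeff` is continuous at the limit point. -/
theorem isExpansion_truncate {u : ℝ × ℝ} (hu : u ∈ T) {N : ℕ} {c : ℕ → ℝ}
    (h : IsExpansion Z e σ S u (N + 1) c) : IsExpansion Z e σ S u N c := by
  obtain ⟨C, α, hα, hC⟩ := h
  have hG := (D.contDiffAt_eqnCoeff (D.subset hu) (e u / derivSnd Z u) (N + 1)).continuousAt.abs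
  have hG' := ((hG.tendsto.comp (tendsto_pair hα)).eventually_lt_const (lt_add_one _))
  have hlt : ∀ᶠ h : ℝ in 𝓝[>] 0, h < 1 := nhdsWithin_le_nhds (gt_mem_nhds one_pos)
  refine ⟨|C| + (|eqnCoeff Z σ S (N + 1) ((u, 0), e u / derivSnd Z u)| + 1) + |c N|, α, hα, ?_⟩
  filter_upwards [hC, hG', hlt, self_mem_nhdsWithin] with h hh hb h1 h0
  have h0 : 0 < h := h0
  set B := |eqnCoeff Z σ S (N + 1) ((u, 0), e u / derivSnd Z u)|
  have hpow : h ^ (N + 1) ≤ h ^ N := pow_le_pow_of_le_one h0.le h1.le (Nat.le_succ N)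
  have hCp : C * h ^ (N + 1) ≤ |C| * h ^ N := by
    calc C * h ^ (N + 1) ≤ |C| * h ^ (N + 1) := by gcongr; exact le_abs_self C
      _ ≤ _ := by gcongr
  have hpN : 0 < h ^ N := pow_pos h0 N
  constructor
  · have h2 := hh.1
    rw [truncEqn, Finset.sum_range_succ] at h2
    change |truncEqn Z σ S (N + 1) ((u, h), α h) + h ^ (N + 1) * _| ≤ _ at h2
    have h3 : |h ^ (N + 1) * eqnCoeff Z σ S (N + 1) ((u, h), α h)| ≤ (B + 1) * h ^ N := by
      rw [abs_mul, abs_of_pos (pow_pos h0 _), mul_comm]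
      exact mul_le_mul hb.le hpow (pow_pos h0 _).le (by positivity)
    have h4 := abs_sub_abs_le_abs_sub (truncEqn Z σ S (N + 1) ((u, h), α h))
      (-(h ^ (N + 1) * eqnCoeff Z σ S (N + 1) ((u, h), α h)))
    rw [abs_neg, sub_neg_eq_add] at h4
    have h5 := mul_nonneg (abs_nonneg (c N)) hpN.le
    nlinarith
  · have h2 := hh.2
    rw [Finset.sum_range_succ, ← sub_sub] at h2
    have h4 := abs_sub_abs_le_abs_sub
      (scaledIncr Z ((u, h), α h) - ∑ n ∈ Finset.range N, c n * h ^ n) (c N * h ^ N)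
    rw [abs_mul, abs_of_pos hpN] at h4
    have h5 : 0 ≤ (B + 1) * h ^ N := by positivity
    nlinarith

theorem isExpansion_mono {u : ℝ × ℝ} (hu : u ∈ T) {N N' : ℕ} (hN : N ≤ N') {c : ℕ → ℝ}
    (h : IsExpansion Z e σ S u N' c) : IsExpansion Z e σ S u N c := by
  induction N', hN using Nat.le_induction with
  | base => exact h
  | succ n _ ih => exact ih (D.isExpansion_truncate hu h)

/-- Both sequences come from approximate roots, and by stability each such root has the expansion
`d` of the implicit function up to `O(h ^ N)`. Hence both agree with `d`. -/
theorem isExpansion_unique {u : ℝ × ℝ} (hu : u ∈ T) {N : ℕ} {c c' : ℕ → ℝ}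
    (h : IsExpansion Z e σ S u N c) (h' : IsExpansion Z e σ S u N c') :
    ∀ n < N, c n = c' n := by
  obtain ⟨d, C, -, -, -, -, hd⟩ := D.exists_expansion hu N
  have key : ∀ {c : ℕ → ℝ}, IsExpansion Z e σ S u N c → ∀ n < N, c n = d u n := by
    rintro c ⟨C₁, α, hα, hC₁⟩ n hn
    have := eq_zero_of_sum_mul_pow_le (N := N) (d := fun n => c n - d u n)
      (C := C₁ + |C| * (C₁ + 1)) ?_ n hn
    · linarith
    filter_upwards [hC₁, (tendsto_pair hα).eventually hd, self_mem_nhdsWithin] with h h1 h2 h0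
    have h0 : 0 < h := h0
    simp only [abs_of_pos h0] at h2
    have h3 : ∑ n ∈ Finset.range N, (c n - d u n) * h ^ n =
        (scaledIncr Z ((u, h), α h) - ∑ n ∈ Finset.range N, d u n * h ^ n) -
        (scaledIncr Z ((u, h), α h) - ∑ n ∈ Finset.range N, c n * h ^ n) := by
      simp only [sub_mul, Finset.sum_sub_distrib]
      ring
    rw [h3]
    refine (abs_sub _ _).trans ?_
    have h4 : C * (|truncEqn Z σ S (N + 1) ((u, h), α h)| + h ^ N) ≤
        |C| * (C₁ * h ^ N + h ^ N) := by
      gcongr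
      · exact le_abs_self C
      · exact h1.1
    nlinarith [h1.2]
  intro n hn
  rw [key h n hn, key h' n hn]

/-- The local expansion provides the coefficients at all nearby base points. -/
theorem exists_expansion' {u : ℝ × ℝ} (hu : u ∈ T) (N : ℕ) :
    ∃ (d : ℝ × ℝ → ℕ → ℝ) (C : ℝ),
      (∀ᶠ v in 𝓝 u, v ∈ T → IsExpansion Z e σ S v N (d v)) ∧
      ∀ᶠ x in 𝓝 ((u, (0 : ℝ)), e u / derivSnd Z u),
        |scaledIncr Z x - ∑ n ∈ Finset.range N, d x.1.1 n * x.1.2 ^ n| ≤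
          C * (|truncEqn Z σ S (N + 1) x| + |x.1.2| ^ N) := by
  obtain ⟨d, C, A, hA, hA0, hAeq, hd⟩ := D.exists_expansion hu N
  refine ⟨d, C, ?_, hd⟩
  have hAu : ContinuousAt A (u, 0) := hA.self_of_nhds
  have h1 : Tendsto (fun q : (ℝ × ℝ) × ℝ => (q, A q)) (𝓝 (u, 0))
      (𝓝 ((u, (0 : ℝ)), e u / derivSnd Z u)) := by
    have := hAu.tendsto
    rw [hA0] at this
    exact tendsto_id.prodMk_nhds this
  have h2 := (hAeq.and (h1.eventually hd)).eventually_nhds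
  have h3 : Tendsto (fun v : ℝ × ℝ => (v, (0 : ℝ))) (𝓝 u) (𝓝 (u, 0)) :=
    tendsto_id.prodMk_nhds tendsto_const_nhds
  filter_upwards [h3.eventually h2, h3.eventually hA] with v hv hvA hvT
  -- Uniqueness of the root at `h = 0` identifies the implicit function there; no continuity of `e`
  -- is assumed.
  have h4 : A (v, 0) = e v / derivSnd Z v := by
    refine (D.strictMono_truncEqn_zero hvT N).injective ?_
    simp only [D.truncEqn_zero_root hvT N]
    exact hv.self_of_nhds.1
  have h5 : Tendsto (fun h : ℝ => (v, h)) (𝓝[>] 0) (𝓝 (v, 0)) :=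
    tendsto_const_nhds.prodMk_nhds (tendsto_id.mono_left nhdsWithin_le_nhds)
  refine ⟨max C 0, fun h => A (v, h), ?_, ?_⟩
  · rw [← h4]
    exact hvA.tendsto.comp h5
  · filter_upwards [h5.eventually hv, self_mem_nhdsWithin] with h hh h0
    have h0 : 0 < h := h0
    have h6 := hh.2
    simp only [hh.1, abs_zero, zero_add, abs_of_pos h0] at h6 ⊢
    exact ⟨by positivity, h6.trans (by gcongr; exact le_max_left C 0)⟩

/-- The coefficients of the inversion exist, to all orders. -/
theorem exists_coeff : ∃ c : ℝ × ℝ → ℕ → ℝ, ∀ u ∈ T, c u 0 = e u ∧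
    ∀ N, IsExpansion Z e σ S u N (c u) := by
  have hex : ∀ u : T, ∀ N, ∃ c, IsExpansion Z e σ S u N c := by
    intro u N
    obtain ⟨d, C, h1, -⟩ := D.exists_expansion' u.2 N
    exact ⟨d u, h1.self_of_nhds u.2⟩
  choose d hd using hex
  classical
  -- The `n`-th coefficient is read off from an expansion of order `n + 1`, the first one that
  -- determines it. Uniqueness makes this diagonal choice valid at every order.
  refine ⟨fun u n => if hu : u ∈ T then d ⟨u, hu⟩ (n + 1) n else 0, fun u hu => ?_⟩
  have hall : ∀ N, IsExpansion Z e σ S u N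
      (fun n => if hu : u ∈ T then d ⟨u, hu⟩ (n + 1) n else 0) := by
    intro N
    obtain ⟨C, α, hα, hC⟩ := hd ⟨u, hu⟩ N
    refine ⟨C, α, hα, ?_⟩
    filter_upwards [hC] with h hh
    refine ⟨hh.1, ?_⟩
    convert hh.2 using 5 with n hn
    simp only [hu, dif_pos]
    refine D.isExpansion_unique hu (hd ⟨u, hu⟩ (n + 1)) ?_ n (Nat.lt_succ_self n)
    exact D.isExpansion_mono hu (Finset.mem_range.1 hn) (hd ⟨u, hu⟩ N)
  refine ⟨?_, hall⟩
  obtain ⟨C, α, hα, hC⟩ := hall 1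
  set c₀ := (if hu : u ∈ T then d ⟨u, hu⟩ (0 + 1) 0 else 0)
  -- The constant coefficient is the limit of the scaled increment, that is `α₀ · derivSnd Z u = e
  -- u`.
  have h1 : Tendsto (fun h : ℝ => scaledIncr Z ((u, h), α h)) (𝓝[>] 0) (𝓝 (e u)) := by
    have h2 := (D.contDiffAt_scaledIncr (D.subset hu) (e u / derivSnd Z u)).continuousAt.tendsto
    rw [scaledIncr_zero, div_mul_cancel₀ _ (D.derivSnd_pos u (D.subset hu)).ne'] at h2
    exact h2.comp (tendsto_pair hα)
  have h2 : Tendsto (fun h : ℝ => |scaledIncr Z ((u, h), α h) - c₀|) (𝓝[>] 0)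
      (𝓝 |e u - c₀|) := (h1.sub_const c₀).abs
  have h3 : Tendsto (fun h : ℝ => C * h) (𝓝[>] 0) (𝓝 (C * 0)) :=
    (Continuous.tendsto (by fun_prop) 0).mono_left nhdsWithin_le_nhds
  have h4 := le_of_tendsto_of_tendsto h2 h3 (by
    filter_upwards [hC] with h hh
    simpa using hh.2)
  rw [mul_zero] at h4
  exact (sub_eq_zero.1 (abs_nonpos_iff.1 h4)).symm

/-- The truncated equation approximates the exact one, uniformly for bounded shifts. -/
theorem truncEqn_approx {u : ℝ × ℝ} (hu : u ∈ T) (N : ℕ) (B : ℝ) :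
    ∃ C : ℝ, ∀ᶠ q : (ℝ × ℝ) × ℝ in 𝓝 (u, 0), 0 < q.2 → ∀ α ∈ Icc (-B) B,
      shiftPt (q, α) ∈ T →
      |truncEqn Z σ S N (q, α) -
        (κ q.2⁻¹ * tiltInt (Z (shiftPt (q, α))) q.2 (scaledIncr Z (q, α)) -
          erfcRemainder Z κ Q q.2⁻¹ (shiftPt (q, α)))| ≤ C * q.2 ^ N := by
  obtain ⟨C, hC⟩ := D.expansion N u hu
  set tilt : ((ℝ × ℝ) × ℝ) × ℝ → ℝ := fun x => tiltInt (Z (shiftPt x)) x.1.2 (scaledIncr Z x)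
  have htilt : ∀ α, ContinuousAt tilt ((u, 0), α) := by
    intro α
    have h1 : ContinuousAt (fun x => Z (shiftPt x)) ((u, 0), α) :=
      ContinuousAt.comp (g := Z) (by simpa using (D.contDiffAt_Z u (D.subset hu)).continuousAt)
        continuous_shiftPt.continuousAt
    exact contDiff_tiltInt.continuous.continuousAt.comp (h1.prodMk
      ((by fun_prop : ContinuousAt (fun x : ((ℝ × ℝ) × ℝ) × ℝ => x.1.2) _).prodMk
        (D.contDiffAt_scaledIncr (D.subset hu) α).continuousAt))
  have hcont : ContinuousOn (fun α => tilt ((u, 0), α)) (Icc (-B) B) := fun α _ =>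
    (ContinuousAt.comp (x := α) (htilt α)
      (by fun_prop : ContinuousAt (fun α : ℝ => ((u, (0 : ℝ)), α)) α)).continuousWithinAt
  obtain ⟨K, hK⟩ := isCompact_Icc.exists_bound_of_continuousOn hcont
  -- By the tube lemma a single neighbourhood of `(u, 0)` works for all `α` in the compact interval.
  have hK' : ∀ᶠ q : (ℝ × ℝ) × ℝ in 𝓝 (u, 0), ∀ α ∈ Icc (-B) B, |tilt (q, α)| < |K| + 1 := by
    refine isCompact_Icc.eventually_forall_of_forall_eventually fun α hα => ?_
    refine (htilt α).abs.eventually_lt_const ?_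
    have := hK α hα
    rw [Real.norm_eq_abs] at this
    linarith [le_abs_self K]
  have hpt : ∀ᶠ q : (ℝ × ℝ) × ℝ in 𝓝 (u, 0), ∀ α ∈ Icc (-B) B,
      (0 < q.2 → shiftPt (q, α) ∈ T →
      |κ q.2⁻¹ - ∑ k ∈ Finset.range N, q.2 ^ k * σ k (shiftPt (q, α))| ≤ C * q.2 ^ N ∧
      |erfcRemainder Z κ Q q.2⁻¹ (shiftPt (q, α)) -
        ∑ k ∈ Finset.range N, q.2 ^ k * S k (shiftPt (q, α))| ≤ C * q.2 ^ N) := by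
    refine isCompact_Icc.eventually_forall_of_forall_eventually fun α hα => ?_
    have h1 : Tendsto (fun x : ((ℝ × ℝ) × ℝ) × ℝ => (shiftPt x, x.1.2)) (𝓝 ((u, 0), α))
        (𝓝 (u, 0)) := by
      have : Continuous fun x : ((ℝ × ℝ) × ℝ) × ℝ => (shiftPt x, x.1.2) :=
        continuous_shiftPt.prodMk (by fun_prop)
      exact this.tendsto' _ _ (by simp)
    exact h1.eventually hC
  refine ⟨|C| * (|K| + 1) + |C|, ?_⟩
  filter_upwards [hK', hpt] with q h1 h2 h0 α hα hT
  obtain ⟨h3, h4⟩ := h2 α hα h0 hT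
  have h5 : truncEqn Z σ S N (q, α) -
        (κ q.2⁻¹ * tilt (q, α) - erfcRemainder Z κ Q q.2⁻¹ (shiftPt (q, α))) =
      -((κ q.2⁻¹ - ∑ k ∈ Finset.range N, q.2 ^ k * σ k (shiftPt (q, α))) * tilt (q, α)) +
      (erfcRemainder Z κ Q q.2⁻¹ (shiftPt (q, α)) -
        ∑ k ∈ Finset.range N, q.2 ^ k * S k (shiftPt (q, α))) := by
    simp only [truncEqn, eqnCoeff, mul_sub, Finset.sum_sub_distrib, sub_mul, Finset.sum_mul, tilt,
      mul_assoc]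
    ring
  rw [h5]
  refine (abs_add_le _ _).trans ?_
  rw [abs_neg, abs_mul]
  have hp : 0 < q.2 ^ N := pow_pos h0 N
  have h6 : C * q.2 ^ N ≤ |C| * q.2 ^ N := by gcongr; exact le_abs_self C
  have h7 := mul_le_mul (h3.trans h6) (h1 α hα).le (abs_nonneg _) (by positivity)
  nlinarith

/-- Exact solutions have bounded scaled shift. -/
theorem shift_bounded {u : ℝ × ℝ} (hu : u ∈ T) :
    ∀ᶠ q : (ℝ × ℝ) × ℝ in 𝓝 (u, 0), 0 < q.2 → q.1 ∈ T → ∀ α, shiftPt (q, α) ∈ T →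
      Q q.2⁻¹ (shiftPt (q, α)) = 1 / 2 * erfc (Z q.1 * √(q.2⁻¹ / 2)) →
      α ∈ Icc (-(|e u / derivSnd Z u| + 1)) (|e u / derivSnd Z u| + 1) := by
  set α₀ := e u / derivSnd Z u
  set B := |α₀| + 1
  have hB : 0 < B := by positivity
  have hαB : α₀ < B := (le_abs_self α₀).trans_lt (lt_add_one _)
  have hαB' : -B < α₀ := by
    have := neg_abs_le α₀
    simp only [B]
    linarith
  obtain ⟨C, hC⟩ := D.truncEqn_approx hu 1 B
  have hmono := D.strictMono_truncEqn_zero hu 0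
  have hroot := D.truncEqn_zero_root hu 0
  have hpos : 0 < truncEqn Z σ S 1 ((u, 0), B) := by
    exact hroot.symm.trans_lt (hmono hαB)
  have hneg : truncEqn Z σ S 1 ((u, 0), -B) < 0 := by
    exact (hmono hαB').trans_eq hroot
  have hc : ∀ β, ContinuousAt (fun q : (ℝ × ℝ) × ℝ => truncEqn Z σ S 1 (q, β) ) (u, 0) :=
    fun β => ContinuousAt.comp (x := (u, (0 : ℝ))) (f := fun q : (ℝ × ℝ) × ℝ => (q, β))
      (D.contDiffAt_truncEqn (D.subset hu) β 1).continuousAt (by fun_prop)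
  have hq : ∀ c : ℝ, ContinuousAt (fun q : (ℝ × ℝ) × ℝ => c * q.2 ^ 1) (u, 0) := by
    intro c
    fun_prop
  have h1 : ∀ᶠ q : (ℝ × ℝ) × ℝ in 𝓝 (u, 0), C * q.2 ^ 1 < truncEqn Z σ S 1 (q, B) :=
    (hq C).eventually_lt (hc B) (by simpa using hpos)
  have h2 : ∀ᶠ q : (ℝ × ℝ) × ℝ in 𝓝 (u, 0), truncEqn Z σ S 1 (q, -B) < -C * q.2 ^ 1 :=
    (hc (-B)).eventually_lt (hq (-C)) (by simpa using hneg)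
  filter_upwards [hC, h1, h2] with q h3 h4 h5 h0 hqT α hαT hQ
  have hfac : 0 < √(2 * Real.pi * q.2⁻¹) := by
    have := Real.pi_pos
    positivity
  have hκ := D.κ_pos q.2⁻¹ (inv_pos.2 h0)
  constructor
  -- If `α < -B`, the point with shift `-B` lies between the solution and the base point.
  -- Monotonicity of `Q` makes the exact equation nonnegative there, whereas the truncated one is
  -- below `-C h`, which contradicts their `C h` closeness. The other end is symmetric.
  · by_contra! hlt
    have hmem : shiftPt (q, -B) ∈ T := by
      refine D.between q.1.1 (q.1.2 + q.2 * α) _ q.1.2 hαT hqT ?_ ?_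
      · simp only; gcongr
      · simp only; nlinarith
    have h6 := h3 h0 (-B) ⟨le_rfl, by linarith⟩ hmem
    rw [exact_eqn (x := (q, -B)) h0] at h6
    have h7 := (abs_le.1 h6).1
    have h8 : Q q.2⁻¹ (shiftPt (q, -B)) < Q q.2⁻¹ (shiftPt (q, α)) := by
      refine D.anti q.2⁻¹ q.1.1 _ _ (inv_pos.2 h0) hαT hmem ?_
      simp only; gcongr
    rw [hQ] at h8
    have h9 : 0 ≤ √(2 * Real.pi * q.2⁻¹) * Real.exp (q.2⁻¹ * Z (shiftPt (q, -B)) ^ 2 / 2) *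
        κ q.2⁻¹ * (1 / 2 * erfc (Z q.1 * √(q.2⁻¹ / 2)) - Q q.2⁻¹ (shiftPt (q, -B))) :=
      mul_nonneg (by positivity) (by linarith)
    linarith
  · by_contra! hlt
    have hmem : shiftPt (q, B) ∈ T := by
      refine D.between q.1.1 q.1.2 _ (q.1.2 + q.2 * α) hqT hαT ?_ ?_
      · simp only; nlinarith
      · simp only; gcongr
    have h6 := h3 h0 B ⟨by linarith, le_rfl⟩ hmem
    rw [exact_eqn (x := (q, B)) h0] at h6
    have h7 := (abs_le.1 h6).2
    have h8 : Q q.2⁻¹ (shiftPt (q, α)) < Q q.2⁻¹ (shiftPt (q, B)) := by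
      refine D.anti q.2⁻¹ q.1.1 _ _ (inv_pos.2 h0) hmem hαT ?_
      simp only; gcongr
    rw [hQ] at h8
    have h9 : √(2 * Real.pi * q.2⁻¹) * Real.exp (q.2⁻¹ * Z (shiftPt (q, B)) ^ 2 / 2) *
        κ q.2⁻¹ * (1 / 2 * erfc (Z q.1 * √(q.2⁻¹ / 2)) - Q q.2⁻¹ (shiftPt (q, B))) ≤ 0 :=
      mul_nonpos_of_nonneg_of_nonpos (by positivity) (by linarith)
    linarith

/-- Local form of the inversion theorem. -/
theorem inversion_local {c : ℝ × ℝ → ℕ → ℝ} (hc : ∀ u ∈ T, ∀ N, IsExpansion Z e σ S u N (c u))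
    {u : ℝ × ℝ} (hu : u ∈ T) (N : ℕ) :
    ∃ C : ℝ, ∀ᶠ q : (ℝ × ℝ) × ℝ in 𝓝 (u, 0), 0 < q.2 → q.1 ∈ T → ∀ a, (q.1.1, a) ∈ T →
      Q q.2⁻¹ (q.1.1, a) = 1 / 2 * erfc (Z q.1 * √(q.2⁻¹ / 2)) →
      |Z (q.1.1, a) - (Z q.1 + ∑ n ∈ Finset.range N, c q.1 n * q.2 ^ (n + 1))| ≤
        C * q.2 ^ (N + 1) := by
  obtain ⟨d, C₁, hd, hexp⟩ := D.exists_expansion' hu N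
  set α₀ := e u / derivSnd Z u
  set B := |α₀| + 1
  obtain ⟨C₂, hC₂⟩ := D.truncEqn_approx hu (N + 1) B
  obtain ⟨C₃, hC₃⟩ := D.truncEqn_approx hu 1 B
  -- The shifts of exact solutions satisfy the first-order equation up to `C₃ h`. Away from `α₀`
  -- that equation is bounded away from zero, so the premise fails there; near `α₀` the local
  -- expansion applies. Compactness joins the two cases.
  have hloc : ∀ᶠ q : (ℝ × ℝ) × ℝ in 𝓝 (u, 0), ∀ α ∈ Icc (-B) B,
      (|truncEqn Z σ S 1 (q, α)| ≤ C₃ * q.2 ^ 1 →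
        |scaledIncr Z (q, α) - ∑ n ∈ Finset.range N, d q.1 n * q.2 ^ n| ≤
          C₁ * (|truncEqn Z σ S (N + 1) (q, α)| + |q.2| ^ N)) := by
    refine isCompact_Icc.eventually_forall_of_forall_eventually fun α _ => ?_
    by_cases hα : α = α₀
    · subst hα
      filter_upwards [hexp] with x hx _ using hx
    · have h1 : truncEqn Z σ S 1 ((u, 0), α) ≠ 0 := by
        intro h
        exact hα ((D.strictMono_truncEqn_zero hu 0).injective
          (h.trans (D.truncEqn_zero_root hu 0).symm))
      have h2 : ∀ᶠ x : ((ℝ × ℝ) × ℝ) × ℝ in 𝓝 ((u, 0), α),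
          C₃ * x.1.2 ^ 1 < |truncEqn Z σ S 1 x| := by
        refine ContinuousAt.eventually_lt (by fun_prop)
          (D.contDiffAt_truncEqn (D.subset hu) α 1).continuousAt.abs ?_
        simpa using h1
      filter_upwards [h2] with x hx hx'
      exact absurd hx' (not_le.2 hx)
  have hfst : Tendsto (fun q : (ℝ × ℝ) × ℝ => q.1) (𝓝 (u, 0)) (𝓝 u) :=
    continuous_fst.tendsto' _ _ rfl
  have hlt : ∀ᶠ q : (ℝ × ℝ) × ℝ in 𝓝 (u, 0), q.2 < 1 :=
    (by fun_prop : ContinuousAt (fun q : (ℝ × ℝ) × ℝ => q.2) (u, 0)).eventually_lt_const one_pos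
  refine ⟨|C₁| * (|C₂| + 1), ?_⟩
  filter_upwards [hloc, hC₂, hC₃, D.shift_bounded hu, hfst.eventually hd, hlt]
    with q h1 h2 h3 h4 h5 h6 h0 hqT a haT hQ
  set α := (a - q.1.2) / q.2
  have hα : shiftPt (q, α) = (q.1.1, a) := by
    simp only [shiftPt, α]
    rw [mul_div_cancel₀ _ h0.ne']
    simp
  rw [← hα] at haT hQ
  have hαB := h4 h0 hqT α haT hQ
  have h7 := h2 h0 α hαB haT
  have h8 := h3 h0 α hαB haT
  rw [exact_eqn (x := (q, α)) h0, hQ, sub_self, mul_zero, sub_zero] at h7 h8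
  have h9 := h1 α hαB h8
  -- The coefficients `d` depend on the neighbourhood and on `N`; uniqueness replaces them by the
  -- global `c`.
  have h10 : ∀ n ∈ Finset.range N, d q.1 n * q.2 ^ n = c q.1 n * q.2 ^ n := fun n hn => by
    rw [D.isExpansion_unique hqT (h5 hqT) (hc q.1 hqT N) n (Finset.mem_range.1 hn)]
  rw [Finset.sum_congr rfl h10, abs_of_pos h0] at h9
  have h11 := mul_scaledIncr (Z := Z) (q, α)
  rw [hα] at h11
  have h12 : Z (q.1.1, a) - (Z q.1 + ∑ n ∈ Finset.range N, c q.1 n * q.2 ^ (n + 1)) =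
      q.2 * (scaledIncr Z (q, α) - ∑ n ∈ Finset.range N, c q.1 n * q.2 ^ n) := by
    rw [mul_sub, h11, Finset.mul_sum]
    have : ∀ n, q.2 * (c q.1 n * q.2 ^ n) = c q.1 n * q.2 ^ (n + 1) := fun n => by ring
    simp only [this]
    ring
  rw [h12, abs_mul, abs_of_pos h0, pow_succ, mul_comm q.2, ← mul_assoc]
  gcongr
  have hp : 0 < q.2 ^ N := pow_pos h0 N
  have h13 : |truncEqn Z σ S (N + 1) (q, α)| ≤ |C₂| * q.2 ^ N := by
    refine h7.trans ?_
    calc C₂ * q.2 ^ (N + 1) ≤ |C₂| * q.2 ^ (N + 1) := by gcongr; exact le_abs_self _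
      _ ≤ |C₂| * q.2 ^ N := by
        gcongr ?_ * ?_
        exact pow_le_pow_of_le_one h0.le h6.le (Nat.le_succ N)
  calc _ ≤ C₁ * (|truncEqn Z σ S (N + 1) (q, α)| + q.2 ^ N) := h9
    _ ≤ |C₁| * (|C₂| * q.2 ^ N + q.2 ^ N) := by
      gcongr
      exact le_abs_self _
    _ = _ := by ring

end

end InversionData

/-- A locally uniform bound for small positive parameters is uniform on compact sets. -/
theorem exists_uniform_bound {K : Set (ℝ × ℝ)} (hK : IsCompact K) {P : (ℝ × ℝ) × ℝ → ℝ → Prop}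
    (hP : ∀ q C C', C ≤ C' → 0 < q.2 → P q C → P q C')
    (h : ∀ u ∈ K, ∃ C : ℝ, ∀ᶠ q : (ℝ × ℝ) × ℝ in 𝓝 (u, 0), 0 < q.2 → P q C) :
    ∃ C μ₀ : ℝ, 0 < μ₀ ∧ ∀ μ, μ₀ ≤ μ → ∀ u ∈ K, P (u, μ⁻¹) C := by
  have h1 : ∀ u ∈ K, ∃ V ∈ 𝓝 u, ∃ (C δ : ℝ), 0 < δ ∧
      ∀ v ∈ V, ∀ t, 0 < t → t < δ → P (v, t) C := by
    intro u hu
    obtain ⟨C, hC⟩ := h u hu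
    rw [nhds_prod_eq, eventually_prod_iff] at hC
    obtain ⟨pa, ha, pb, hb, hab⟩ := hC
    obtain ⟨δ, hδ, hδb⟩ := Metric.eventually_nhds_iff.1 hb
    refine ⟨{v | pa v}, ha, C, δ, hδ, fun v hv t ht htδ => hab hv (hδb ?_) ht⟩
    rwa [Real.dist_eq, sub_zero, abs_of_pos ht]
  have h2 : ∃ (C δ : ℝ), 0 < δ ∧ ∀ v ∈ K, ∀ t, 0 < t → t < δ → P (v, t) C := by
    refine hK.induction_on (p := fun s => ∃ (C δ : ℝ), 0 < δ ∧
      ∀ v ∈ s, ∀ t, 0 < t → t < δ → P (v, t) C) ⟨0, 1, one_pos, by simp⟩ ?_ ?_ ?_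
    · rintro s t hst ⟨C, δ, hδ, hC⟩
      exact ⟨C, δ, hδ, fun v hv => hC v (hst hv)⟩
    · rintro s t ⟨C, δ, hδ, hC⟩ ⟨C', δ', hδ', hC'⟩
      refine ⟨max C C', min δ δ', lt_min hδ hδ', ?_⟩
      rintro v (hv | hv) r hr hrd
      · exact hP _ _ _ (le_max_left _ _) hr (hC v hv r hr (hrd.trans_le (min_le_left _ _)))
      · exact hP _ _ _ (le_max_right _ _) hr (hC' v hv r hr (hrd.trans_le (min_le_right _ _)))
    · intro u hu
      obtain ⟨V, hV, C, δ, hδ, hC⟩ := h1 u hu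
      exact ⟨V, mem_nhdsWithin_of_mem_nhds hV, C, δ, hδ, hC⟩
  obtain ⟨C, δ, hδ, hC⟩ := h2
  -- With `μ ≥ 2/δ` one has `μ⁻¹ ≤ δ/2`, strictly below `δ`.
  refine ⟨C, 2 / δ, by positivity, fun μ hμ u hu => hC u hu _ ?_ ?_⟩
  · exact inv_pos.2 ((by positivity : 0 < 2 / δ).trans_le hμ)
  · have h3 : 0 < 2 / δ := by positivity
    calc μ⁻¹ ≤ (2 / δ)⁻¹ := inv_anti₀ h3 hμ
      _ = δ / 2 := by rw [inv_div]
      _ < δ := half_lt_self hδ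

/-- The inversion theorem: the coefficients exist, the first one is `e`, and the expansion is
uniform on compact sets. -/
theorem InversionData.inversion {U T : Set (ℝ × ℝ)} {Z e : ℝ × ℝ → ℝ} {σ S : ℕ → ℝ × ℝ → ℝ}
    {κ : ℝ → ℝ} {Q : ℝ → ℝ × ℝ → ℝ} (D : InversionData U T Z e σ S κ Q) :
    ∃ c : ℝ × ℝ → ℕ → ℝ, (∀ u ∈ T, c u 1 = e u) ∧
      ∀ (N : ℕ) (K : Set (ℝ × ℝ)), IsCompact K → K ⊆ T → ∃ C μ₀ : ℝ, 0 < μ₀ ∧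
        ∀ μ, μ₀ ≤ μ → ∀ u ∈ K, ∀ a, (u.1, a) ∈ T →
          Q μ (u.1, a) = 1 / 2 * erfc (Z u * √(μ / 2)) →
          |Z (u.1, a) - (Z u + ∑ n ∈ Finset.Icc 1 N, c u n / μ ^ n)| ≤ C / μ ^ (N + 1) := by
  obtain ⟨c, hc⟩ := D.exists_coeff
  -- Index shift: `c` expands the increment of `Z` divided by `h`, starting with `h ^ 0`.
  refine ⟨fun u n => c u (n - 1), fun u hu => (hc u hu).1, fun N K hK hKT => ?_⟩
  obtain ⟨C, μ₀, hμ₀, h⟩ := exists_uniform_bound (K := K) hK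
    (P := fun q C => q.1 ∈ T → ∀ a, (q.1.1, a) ∈ T →
      Q q.2⁻¹ (q.1.1, a) = 1 / 2 * erfc (Z q.1 * √(q.2⁻¹ / 2)) →
      |Z (q.1.1, a) - (Z q.1 + ∑ n ∈ Finset.range N, c q.1 n * q.2 ^ (n + 1))| ≤
        C * q.2 ^ (N + 1))
    (fun q C C' hCC h0 h hq a ha hQ => (h hq a ha hQ).trans (by gcongr))
    (fun u hu => D.inversion_local (fun v hv => (hc v hv).2) (hKT hu) N)
  refine ⟨C, μ₀, hμ₀, fun μ hμ u hu a ha hQ => ?_⟩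
  have h1 := h μ hμ u hu (hKT hu) a ha (by simpa using hQ)
  have h2 : ∑ n ∈ Finset.Icc 1 N, c u (n - 1) / μ ^ n =
      ∑ n ∈ Finset.range N, c u n * μ⁻¹ ^ (n + 1) := by
    have h3 := Finset.sum_Ico_add' (fun n => c u (n - 1) * μ⁻¹ ^ n) 0 N 1
    simp only [Nat.add_sub_cancel] at h3
    rw [Finset.range_eq_Ico, h3]
    refine Finset.sum_congr (by ext; simp) fun n _ => ?_
    rw [inv_pow, div_eq_mul_inv]
  rw [h2, div_eq_mul_inv, ← inv_pow]
  exact h1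

/-! ### The entire function `∑ z ^ k / (k! Γ (μ + k))` -/

/-- The entire function `∑ z ^ k / (k! Γ (μ + k))`. -/
noncomputable def besselSeries (μ z : ℝ) : ℝ :=
  ∑' k : ℕ, z ^ k / ((k.factorial : ℝ) * Real.Gamma (μ + k))

/-- `Γ` need not increase from `μ` to `μ + 1`, but from `μ + 1 ≥ 1` on, `Γ (s + 1) = s Γ s ≥ Γ s`.
So the first two values decide. -/
theorem exists_le_Gamma_add_nat {μ : ℝ} (hμ : 0 < μ) :
    ∃ c, 0 < c ∧ ∀ k : ℕ, c ≤ Real.Gamma (μ + k) := by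
  refine ⟨min (Real.Gamma μ) (Real.Gamma (μ + 1)),
    lt_min (Real.Gamma_pos_of_pos hμ) (Real.Gamma_pos_of_pos (by linarith)), fun k => ?_⟩
  rcases k with _ | k
  · simp
  · refine (min_le_right _ _).trans ?_
    induction k with
    | zero => simp
    | succ k ih =>
      refine ih.trans ?_
      have h1 : μ + ((k + 1 + 1 : ℕ) : ℝ) = μ + (k + 1 : ℕ) + 1 := by push_cast; ring
      rw [h1, Real.Gamma_add_one (by positivity)]
      refine le_mul_of_one_le_left (Real.Gamma_pos_of_pos (by positivity)).le ?_
      push_cast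
      linarith [(Nat.cast_nonneg k : (0 : ℝ) ≤ k)]

theorem summable_besselSeries {μ : ℝ} (hμ : 0 < μ) (z : ℝ) :
    Summable fun k : ℕ => z ^ k / ((k.factorial : ℝ) * Real.Gamma (μ + k)) := by
  obtain ⟨c, hc, hcG⟩ := exists_le_Gamma_add_nat hμ
  refine Summable.of_norm_bounded ((Real.summable_pow_div_factorial |z|).mul_left c⁻¹) fun k => ?_
  have h1 := Real.Gamma_pos_of_pos (by positivity : 0 < μ + k)
  rw [norm_div, norm_pow, Real.norm_eq_abs, Real.norm_eq_abs, abs_of_pos (by positivity : 0 < (k.factorial : ℝ) * Real.Gamma (μ + k)),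
    mul_comm (k.factorial : ℝ), ← div_div, div_right_comm, div_eq_inv_mul (_ / _)]
  gcongr
  exact hcG k

/-- Termwise differentiation: the factor `k` cancels against `k!`, and the index shift moves `μ` to
`μ + 1`. -/
theorem hasDerivAt_besselSeries {μ : ℝ} (hμ : 0 < μ) (z : ℝ) :
    HasDerivAt (besselSeries μ) (besselSeries (μ + 1) z) z := by
  obtain ⟨c, hc, hcG⟩ := exists_le_Gamma_add_nat hμ
  set R := |z| + 1
  have hu : Summable fun k : ℕ => (k : ℝ) * R ^ (k - 1) / (k.factorial : ℝ) * c⁻¹ := by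
    refine Summable.mul_right _ ?_
    rw [← summable_nat_add_iff 1]
    refine (Real.summable_pow_div_factorial R).congr fun k => ?_
    rw [Nat.factorial_succ, Nat.add_sub_cancel]
    push_cast
    field_simp
  have h1 := hasDerivAt_tsum_of_isPreconnected (𝕜 := ℝ) (F := ℝ)
    (g := fun (k : ℕ) z => z ^ k / ((k.factorial : ℝ) * Real.Gamma (μ + k)))
    (g' := fun (k : ℕ) z => (k : ℝ) * z ^ (k - 1) / ((k.factorial : ℝ) * Real.Gamma (μ + k)))
    (t := Metric.ball 0 R) (y₀ := z) (y := z) hu Metric.isOpen_ball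
    (convex_ball 0 R).isPreconnected
    (fun k y _ => (hasDerivAt_pow k y).div_const _) (fun k y hy => ?_) (by simp [R])
    (summable_besselSeries hμ z) (by simp [R])
  · have h2 : ∑' k : ℕ, (k : ℝ) * z ^ (k - 1) / ((k.factorial : ℝ) * Real.Gamma (μ + k)) =
        besselSeries (μ + 1) z := by
      have hs : Summable fun k : ℕ =>
          (k : ℝ) * z ^ (k - 1) / ((k.factorial : ℝ) * Real.Gamma (μ + k)) := by
        rw [← summable_nat_add_iff 1]
        refine (summable_besselSeries (μ := μ + 1) (by linarith) z).congr fun k => ?_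
        rw [Nat.factorial_succ, Nat.add_sub_cancel,
          show μ + ((k + 1 : ℕ) : ℝ) = μ + 1 + k by push_cast; ring]
        push_cast
        field_simp
      rw [hs.tsum_eq_zero_add]
      simp only [Nat.cast_zero, zero_mul, zero_div, zero_add]
      refine tsum_congr fun k => ?_
      rw [Nat.factorial_succ, Nat.add_sub_cancel,
        show μ + ((k + 1 : ℕ) : ℝ) = μ + 1 + k by push_cast; ring]
      push_cast
      field_simp
    rw [← h2]
    exact h1
  · have h3 := Real.Gamma_pos_of_pos (by positivity : 0 < μ + k)
    have hy' : |y| ≤ R := by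
      rw [mem_ball_zero_iff, Real.norm_eq_abs] at hy
      exact hy.le
    rw [norm_div, norm_mul, norm_pow, Real.norm_eq_abs, Real.norm_eq_abs, Real.norm_eq_abs,
      abs_of_nonneg (Nat.cast_nonneg k), abs_of_pos (by positivity : 0 < (k.factorial : ℝ) * Real.Gamma (μ + k)), ← div_div,
      div_eq_mul_inv _ (Real.Gamma _)]
    gcongr
    exact hcG k

theorem continuous_besselSeries {μ : ℝ} (hμ : 0 < μ) : Continuous (besselSeries μ) :=
  continuous_iff_continuousAt.2 fun z => (hasDerivAt_besselSeries hμ z).continuousAt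

theorem besselSeries_zero (μ : ℝ) : besselSeries μ 0 = (Real.Gamma μ)⁻¹ := by
  rw [besselSeries, tsum_eq_single 0 fun k hk => by simp [hk]]
  simp

theorem besselSeries_pos {μ z : ℝ} (hμ : 0 < μ) (hz : 0 ≤ z) : 0 < besselSeries μ z := by
  refine (summable_besselSeries hμ z).tsum_pos (fun k => ?_) 0 ?_
  · have := Real.Gamma_pos_of_pos (by positivity : 0 < μ + k)
    positivity
  · have := Real.Gamma_pos_of_pos hμ
    simpa using this

/-- Termwise, `Γ (μ + k + 1) = (μ + k) Γ (μ + k)`, with `μ + k` split into its two summands. Since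
raising `μ` by one is differentiation, this is the differential equation `g = μ g' + z g''`. -/
theorem besselSeries_rec {μ : ℝ} (hμ : 0 < μ) (z : ℝ) :
    besselSeries μ z = μ * besselSeries (μ + 1) z + z * besselSeries (μ + 2) z := by
  have h1 := summable_besselSeries (μ := μ + 1) (by linarith) z
  have h2 := summable_besselSeries (μ := μ + 2) (by linarith) z
  have hterm : ∀ k : ℕ, z * (z ^ k / ((k.factorial : ℝ) * Real.Gamma (μ + 2 + k))) =
      ((k + 1 : ℕ) : ℝ) * z ^ (k + 1) /
        (((k + 1).factorial : ℝ) * Real.Gamma (μ + 1 + (k + 1 : ℕ))) := by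
    intro k
    have h := Real.Gamma_pos_of_pos (by positivity : 0 < μ + 2 + k)
    rw [Nat.factorial_succ, show μ + 1 + ((k + 1 : ℕ) : ℝ) = μ + 2 + k by push_cast; ring]
    push_cast
    field_simp
    ring
  have h3 : Summable fun k : ℕ =>
      (k : ℝ) * z ^ k / ((k.factorial : ℝ) * Real.Gamma (μ + 1 + k)) := by
    rw [← summable_nat_add_iff 1]
    exact (h2.mul_left z).congr hterm
  have h4 : z * besselSeries (μ + 2) z =
      ∑' k : ℕ, (k : ℝ) * z ^ k / ((k.factorial : ℝ) * Real.Gamma (μ + 1 + k)) := by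
    rw [h3.tsum_eq_zero_add, besselSeries, ← tsum_mul_left]
    simp only [Nat.cast_zero, zero_mul, zero_div, zero_add]
    exact tsum_congr hterm
  rw [h4, besselSeries, besselSeries, ← tsum_mul_left, ← (h1.mul_left μ).tsum_add h3]
  refine tsum_congr fun k => ?_
  have h := Real.Gamma_pos_of_pos (by positivity : 0 < μ + k)
  rw [show μ + 1 + (k : ℝ) = μ + k + 1 by ring, Real.Gamma_add_one (by positivity)]
  have h5 : (0 : ℝ) < μ + k := by positivity
  field_simp

/-! ### The density of the Marcum function -/

/-- Termwise Gamma integrals cancel the `Γ (μ + k)` in the series and leave an exponential series.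
The case `b = 1` normalizes the density; other `b` give the Chernoff bounds. -/
theorem integral_rpow_exp_besselSeries {μ b X : ℝ} (hμ : 0 < μ) (hb : 0 < b) (hX : 0 ≤ X) :
    ∫ t in Ioi (0 : ℝ), t ^ (μ - 1) * Real.exp (-(b * t)) * besselSeries μ (X * t) =
      b ^ (-μ) * Real.exp (X / b) := by
  have hG : ∀ k : ℕ, 0 < Real.Gamma (μ + k) := fun k =>
    Real.Gamma_pos_of_pos (by positivity)
  set F : ℕ → ℝ → ℝ := fun k t => X ^ k / ((k.factorial : ℝ) * Real.Gamma (μ + k)) *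
    (t ^ (μ + k - 1) * Real.exp (-(b * t)))
  have hFt : ∀ t ∈ Ioi (0 : ℝ), t ^ (μ - 1) * Real.exp (-(b * t)) * besselSeries μ (X * t) =
      ∑' k, F k t := by
    intro t ht
    have ht : 0 < t := ht
    rw [besselSeries, ← tsum_mul_left]
    refine tsum_congr fun k => ?_
    simp only [F]
    rw [show μ + (k : ℝ) - 1 = μ - 1 + k by ring, Real.rpow_add ht, Real.rpow_natCast, mul_pow]
    ring
  have hint : ∀ k : ℕ, IntegrableOn (fun t : ℝ => t ^ (μ + k - 1) * Real.exp (-(b * t))) (Ioi 0) := by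
    intro k
    -- The integral of a nonintegrable function is `0` by convention, while the Gamma formula gives
    -- a positive value.
    by_contra h
    have h1 := Real.integral_rpow_mul_exp_neg_mul_Ioi (a := μ + k) (r := b) (by positivity) hb
    rw [integral_undef h] at h1
    have := hG k
    have : 0 < (1 / b) ^ (μ + (k : ℝ)) * Real.Gamma (μ + k) := by positivity
    linarith
  have hval : ∀ k : ℕ, ∫ t in Ioi (0 : ℝ), F k t = b ^ (-μ) * ((X / b) ^ k / k.factorial) := by
    intro k
    simp only [F]
    rw [integral_const_mul, Real.integral_rpow_mul_exp_neg_mul_Ioi (by positivity) hb, one_div,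
      Real.inv_rpow hb.le, ← Real.rpow_neg hb.le, neg_add, Real.rpow_add hb, Real.rpow_neg hb.le k,
      Real.rpow_natCast, div_pow]
    have := (hG k).ne'
    field_simp
  have hnorm : ∀ k : ℕ, ∫ t in Ioi (0 : ℝ), ‖F k t‖ = ∫ t in Ioi (0 : ℝ), F k t := by
    intro k
    refine setIntegral_congr_fun measurableSet_Ioi fun t ht => ?_
    have ht : 0 < t := ht
    have := hG k
    simp only [F]
    rw [Real.norm_of_nonneg (by positivity)]
  have hexp : HasSum (fun k : ℕ => b ^ (-μ) * ((X / b) ^ k / k.factorial))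
      (b ^ (-μ) * Real.exp (X / b)) := by
    rw [Real.exp_eq_exp_ℝ]
    exact (NormedSpace.expSeries_div_hasSum_exp (X / b)).mul_left _
  have h := hasSum_integral_of_summable_integral_norm (F := F) (μ := volume.restrict (Ioi 0))
    (fun k => (hint k).const_mul _) (by simpa only [hnorm, hval] using hexp.summable)
  rw [setIntegral_congr_fun measurableSet_Ioi hFt]
  simp only [hval] at h
  exact h.unique hexp

theorem integrableOn_rpow_exp_besselSeries {μ b X : ℝ} (hμ : 0 < μ) (hb : 0 < b) (hX : 0 ≤ X) :
    IntegrableOn (fun t => t ^ (μ - 1) * Real.exp (-(b * t)) * besselSeries μ (X * t))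
      (Ioi 0) := by
  by_contra h
  have h1 := integral_rpow_exp_besselSeries hμ hb hX
  rw [integral_undef h] at h1
  have : 0 < b ^ (-μ) * Real.exp (X / b) := by positivity
  linarith

/-- The density of `1 - marcumQ μ X`. -/
noncomputable def marcumDensity (μ X t : ℝ) : ℝ :=
  t ^ (μ - 1) * Real.exp (-t - X) * besselSeries μ (X * t)

theorem marcumDensity_eq (μ X t : ℝ) : marcumDensity μ X t =
    Real.exp (-X) * (t ^ (μ - 1) * Real.exp (-(1 * t)) * besselSeries μ (X * t)) := by
  rw [marcumDensity, show -t - X = -X + -(1 * t) by ring, Real.exp_add]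
  ring

theorem marcumDensity_pos {μ X t : ℝ} (hμ : 0 < μ) (hX : 0 ≤ X) (ht : 0 < t) :
    0 < marcumDensity μ X t := by
  have := besselSeries_pos hμ (by positivity : 0 ≤ X * t)
  rw [marcumDensity]
  positivity

theorem integrableOn_marcumDensity {μ X : ℝ} (hμ : 0 < μ) (hX : 0 ≤ X) :
    IntegrableOn (marcumDensity μ X) (Ioi 0) := by
  simp only [funext (marcumDensity_eq μ X)]
  exact (integrableOn_rpow_exp_besselSeries hμ one_pos hX).const_mul _

theorem integral_marcumDensity {μ X : ℝ} (hμ : 0 < μ) (hX : 0 ≤ X) :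
    ∫ t in Ioi 0, marcumDensity μ X t = 1 := by
  simp only [marcumDensity_eq μ X]
  rw [integral_const_mul, integral_rpow_exp_besselSeries hμ one_pos hX, Real.one_rpow, one_mul,
    div_one, ← Real.exp_add, neg_add_cancel, Real.exp_zero]

/-- Extracting `(Xt)^((μ-1)/2)` from the Bessel function cancels the power of `X` in front, so a
single density covers `X = 0` as well. -/
theorem marcumQ_eq_integral {μ X Y : ℝ} (hX : 0 ≤ X) (hY : 0 ≤ Y) :
    marcumQ μ X Y = ∫ t in Ioi Y, marcumDensity μ X t := by
  rw [marcumQ]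
  split_ifs with h
  · subst h
    rw [← integral_div]
    refine setIntegral_congr_fun measurableSet_Ioi fun t _ => ?_
    simp [marcumDensity, besselSeries_zero, div_eq_mul_inv]
  · have hX : 0 < X := lt_of_le_of_ne hX (Ne.symm h)
    rw [← integral_const_mul]
    refine setIntegral_congr_fun measurableSet_Ioi fun t ht => ?_
    have ht : 0 < t := hY.trans_lt ht
    have hXt : 0 < X * t := by positivity
    have h1 : besselI (μ - 1) (2 * √(X * t)) =
        (X * t) ^ ((μ - 1) / 2) * besselSeries μ (X * t) := by
      rw [besselI, besselSeries, ← tsum_mul_left]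
      refine tsum_congr fun k => ?_
      rw [mul_div_cancel_left₀ _ two_ne_zero, Real.sqrt_eq_rpow, ← Real.rpow_mul hXt.le,
        show 1 / 2 * (μ - 1 + 2 * (k : ℝ)) = (μ - 1) / 2 + k by ring, Real.rpow_add hXt,
        Real.rpow_natCast, show μ - 1 + (k : ℝ) + 1 = μ + k by ring, mul_div_assoc]
    rw [h1, Real.mul_rpow hX.le ht.le, marcumDensity]
    have h2 : X ^ ((1 - μ) / 2) * X ^ ((μ - 1) / 2) = 1 := by
      rw [← Real.rpow_add hX, show (1 - μ) / 2 + (μ - 1) / 2 = 0 by ring, Real.rpow_zero]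
    have h3 : t ^ ((μ - 1) / 2) * t ^ ((μ - 1) / 2) = t ^ (μ - 1) := by
      rw [← Real.rpow_add ht, add_halves]
    rw [← h3]
    linear_combination (t ^ ((μ - 1) / 2) * t ^ ((μ - 1) / 2) * Real.exp (-t - X) *
      besselSeries μ (X * t)) * h2

/-! ### Monotonicity, limits and exponential bounds for the Marcum function -/

theorem intervalIntegrable_marcumDensity {μ X : ℝ} (hμ : 0 < μ) (hX : 0 ≤ X) {a b : ℝ}
    (ha : 0 ≤ a) (hb : 0 ≤ b) : IntervalIntegrable (marcumDensity μ X) volume a b := by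
  rw [intervalIntegrable_iff]
  refine (integrableOn_marcumDensity hμ hX).mono_set fun t ht => ?_
  exact (le_min ha hb).trans_lt ht.1

theorem marcumQ_eq_one_sub {μ X Y : ℝ} (hμ : 0 < μ) (hX : 0 ≤ X) (hY : 0 ≤ Y) :
    marcumQ μ X Y = 1 - ∫ t in (0 : ℝ)..Y, marcumDensity μ X t := by
  have h := integrableOn_marcumDensity hμ hX
  rw [marcumQ_eq_integral hX hY, ← integral_marcumDensity hμ hX,
    ← intervalIntegral.integral_Ioi_sub_Ioi' h (h.mono_set (Ioi_subset_Ioi hY))]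
  ring

theorem continuousOn_marcumDensity {μ : ℝ} (hμ : 0 < μ) (X : ℝ) :
    ContinuousOn (marcumDensity μ X) (Ioi 0) := by
  have h := continuous_besselSeries hμ
  unfold marcumDensity
  refine ContinuousOn.mul (ContinuousOn.mul ?_ (by fun_prop)) (by fun_prop)
  exact fun t ht => (Real.continuousAt_rpow_const t _ (Or.inl (ne_of_gt ht))).continuousWithinAt

theorem hasDerivAt_marcumQ {μ X Y : ℝ} (hμ : 0 < μ) (hX : 0 ≤ X) (hY : 0 < Y) :
    HasDerivAt (marcumQ μ X) (-marcumDensity μ X Y) Y := by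
  have hc : ContinuousAt (marcumDensity μ X) Y :=
    (continuousOn_marcumDensity hμ X).continuousAt (Ioi_mem_nhds hY)
  have hm : StronglyMeasurableAtFilter (marcumDensity μ X) (𝓝 Y) :=
    (continuousOn_marcumDensity hμ X).stronglyMeasurableAtFilter isOpen_Ioi Y hY
  have h1 := (intervalIntegral.integral_hasDerivAt_right
    (intervalIntegrable_marcumDensity hμ hX le_rfl hY.le) hm hc).const_sub 1
  refine h1.congr_of_eventuallyEq ?_
  filter_upwards [Ioi_mem_nhds hY] with y hy
  exact marcumQ_eq_one_sub hμ hX (le_of_lt hy)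

theorem marcumQ_strictAntiOn {μ X : ℝ} (hμ : 0 < μ) (hX : 0 ≤ X) :
    StrictAntiOn (marcumQ μ X) (Ici 0) := by
  intro a ha b hb hab
  have ha : 0 ≤ a := ha
  have hb : 0 ≤ b := hb
  have h1 : 0 < ∫ t in a..b, marcumDensity μ X t :=
    intervalIntegral.intervalIntegral_pos_of_pos_on
      (intervalIntegrable_marcumDensity hμ hX ha hb)
      (fun t ht => marcumDensity_pos hμ hX (ha.trans_lt ht.1)) hab
  have h2 := intervalIntegral.integral_interval_sub_left
    (intervalIntegrable_marcumDensity hμ hX le_rfl hb)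
    (intervalIntegrable_marcumDensity hμ hX le_rfl ha)
  rw [marcumQ_eq_one_sub hμ hX ha, marcumQ_eq_one_sub hμ hX hb]
  linarith

theorem marcumQ_zero_right {μ X : ℝ} (hμ : 0 < μ) (hX : 0 ≤ X) : marcumQ μ X 0 = 1 := by
  simp [marcumQ_eq_one_sub hμ hX le_rfl]

theorem marcumQ_nonneg {μ X Y : ℝ} (hμ : 0 < μ) (hX : 0 ≤ X) (hY : 0 ≤ Y) :
    0 ≤ marcumQ μ X Y := by
  rw [marcumQ_eq_integral hX hY]
  exact setIntegral_nonneg measurableSet_Ioi fun t ht =>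
    (marcumDensity_pos hμ hX (hY.trans_lt ht)).le

theorem marcumQ_le_one {μ X Y : ℝ} (hμ : 0 < μ) (hX : 0 ≤ X) (hY : 0 ≤ Y) :
    marcumQ μ X Y ≤ 1 := by
  rw [← marcumQ_zero_right hμ hX]
  exact (marcumQ_strictAntiOn hμ hX).antitoneOn (mem_Ici.2 le_rfl) hY hY

theorem continuousOn_marcumQ {μ X : ℝ} (hμ : 0 < μ) (hX : 0 ≤ X) (B : ℝ) :
    ContinuousOn (marcumQ μ X) (Icc 0 B) := by
  rcases lt_or_ge B 0 with hB | hB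
  · simp [Icc_eq_empty_of_lt hB]
  · have h1 : IntegrableOn (marcumDensity μ X) (uIcc 0 B) := by
      rw [uIcc_of_le hB, integrableOn_Icc_iff_integrableOn_Ioc]
      exact (integrableOn_marcumDensity hμ hX).mono_set Ioc_subset_Ioi_self
    have h2 := intervalIntegral.continuousOn_primitive_interval h1
    rw [uIcc_of_le hB] at h2
    refine ((continuousOn_const (c := (1 : ℝ))).sub h2).congr fun y hy => ?_
    exact marcumQ_eq_one_sub hμ hX hy.1

theorem marcumDensity_eq_tilt (μ X b t : ℝ) : marcumDensity μ X t =
    Real.exp (-X - (1 - b) * t) * (t ^ (μ - 1) * Real.exp (-(b * t)) * besselSeries μ (X * t)) := by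
  rw [marcumDensity, show -t - X = (-X - (1 - b) * t) + -(b * t) by ring, Real.exp_add]
  ring

/-- Exponential bound for the integral of the density over a set on which the tilting factor is
bounded. -/
theorem setIntegral_marcumDensity_le {μ X Y b : ℝ} (hμ : 0 < μ) (hX : 0 ≤ X) (hb : 0 < b)
    {s : Set ℝ} (hs : MeasurableSet s) (hs0 : s ⊆ Ioi 0)
    (hsY : ∀ t ∈ s, (1 - b) * Y ≤ (1 - b) * t) :
    ∫ t in s, marcumDensity μ X t ≤
      Real.exp (-X - (1 - b) * Y) * (b ^ (-μ) * Real.exp (X / b)) := by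
  have hI := integrableOn_rpow_exp_besselSeries hμ hb hX
  have hpos : ∀ t ∈ Ioi (0 : ℝ),
      0 ≤ t ^ (μ - 1) * Real.exp (-(b * t)) * besselSeries μ (X * t) := by
    intro t ht
    have ht : 0 < t := ht
    have := besselSeries_pos hμ (by positivity : 0 ≤ X * t)
    positivity
  calc ∫ t in s, marcumDensity μ X t
      ≤ ∫ t in s, Real.exp (-X - (1 - b) * Y) *
        (t ^ (μ - 1) * Real.exp (-(b * t)) * besselSeries μ (X * t)) := by
        refine setIntegral_mono_on ((integrableOn_marcumDensity hμ hX).mono_set hs0)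
          ((hI.mono_set hs0).const_mul _) hs fun t ht => ?_
        rw [marcumDensity_eq_tilt μ X b t]
        refine mul_le_mul_of_nonneg_right ?_ (hpos t (hs0 ht))
        have := hsY t ht
        gcongr
    _ = Real.exp (-X - (1 - b) * Y) *
        ∫ t in s, t ^ (μ - 1) * Real.exp (-(b * t)) * besselSeries μ (X * t) :=
        integral_const_mul _ _
    _ ≤ Real.exp (-X - (1 - b) * Y) *
        ∫ t in Ioi 0, t ^ (μ - 1) * Real.exp (-(b * t)) * besselSeries μ (X * t) := by
        refine mul_le_mul_of_nonneg_left ?_ (Real.exp_pos _).le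
        exact setIntegral_mono_set hI ((ae_restrict_iff' measurableSet_Ioi).2
          (Eventually.of_forall hpos)) hs0.eventuallyLE
    _ = _ := by rw [integral_rpow_exp_besselSeries hμ hb hX]

/-- Chernoff bound: for `b ≤ 1` the tilting factor `exp (-(1 - b) t)` is largest at the left end `t
= Y`. -/
theorem marcumQ_le_exp {μ X Y b : ℝ} (hμ : 0 < μ) (hX : 0 ≤ X) (hY : 0 ≤ Y) (hb : 0 < b)
    (hb1 : b ≤ 1) :
    marcumQ μ X Y ≤ Real.exp (-X - (1 - b) * Y) * (b ^ (-μ) * Real.exp (X / b)) := by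
  rw [marcumQ_eq_integral hX hY]
  refine setIntegral_marcumDensity_le hμ hX hb measurableSet_Ioi (Ioi_subset_Ioi hY) fun t ht => ?_
  have ht : Y < t := ht
  have : 0 ≤ 1 - b := by linarith
  gcongr

theorem one_sub_marcumQ_le_exp {μ X Y b : ℝ} (hμ : 0 < μ) (hX : 0 ≤ X) (hY : 0 ≤ Y)
    (hb1 : 1 ≤ b) :
    1 - marcumQ μ X Y ≤ Real.exp (-X - (1 - b) * Y) * (b ^ (-μ) * Real.exp (X / b)) := by
  rw [marcumQ_eq_one_sub hμ hX hY, sub_sub_cancel, intervalIntegral.integral_of_le hY]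
  refine setIntegral_marcumDensity_le hμ hX (by linarith) measurableSet_Ioc Ioc_subset_Ioi_self
    fun t ht => ?_
  exact mul_le_mul_of_nonpos_left ht.2 (by linarith)

theorem tendsto_marcumQ_atTop {μ X : ℝ} (hμ : 0 < μ) (hX : 0 ≤ X) :
    Tendsto (marcumQ μ X) atTop (𝓝 0) := by
  have h1 : Tendsto (fun Y : ℝ => Real.exp (-X - (1 - 1 / 2) * Y) *
      ((1 / 2) ^ (-μ) * Real.exp (X / (1 / 2)))) atTop (𝓝 0) := by
    rw [← zero_mul ((1 / 2 : ℝ) ^ (-μ) * Real.exp (X / (1 / 2)))]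
    refine Tendsto.mul_const _ (Real.tendsto_exp_atBot.comp ?_)
    refine tendsto_const_nhds.add_atBot ?_
    exact tendsto_neg_atTop_atBot.comp (tendsto_id.const_mul_atTop (by norm_num))
  refine tendsto_of_tendsto_of_tendsto_of_le_of_le' tendsto_const_nhds h1 ?_ ?_
  · filter_upwards [eventually_ge_atTop 0] with Y hY using marcumQ_nonneg hμ hX hY
  · filter_upwards [eventually_ge_atTop 0] with Y hY
    exact marcumQ_le_exp hμ hX hY (by norm_num) (by norm_num)

/-- The lower Chernoff bound with `b = 2` decays like `exp (-X/2)`. -/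
theorem tendsto_marcumQ_left_atTop {μ Y : ℝ} (hμ : 0 < μ) (hY : 0 ≤ Y) :
    Tendsto (fun X => marcumQ μ X Y) atTop (𝓝 1) := by
  have h1 : Tendsto (fun X : ℝ => 1 - Real.exp (Y - 1 / 2 * X) * 2 ^ (-μ)) atTop (𝓝 1) := by
    have : Tendsto (fun X : ℝ => Real.exp (Y - 1 / 2 * X)) atTop (𝓝 0) := by
      refine Real.tendsto_exp_atBot.comp ?_
      refine tendsto_const_nhds.add_atBot ?_
      exact tendsto_neg_atTop_atBot.comp (tendsto_id.const_mul_atTop (by norm_num))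
    simpa using (this.mul_const (2 ^ (-μ) : ℝ)).const_sub 1
  refine tendsto_of_tendsto_of_tendsto_of_le_of_le' h1 tendsto_const_nhds ?_ ?_
  · filter_upwards [eventually_ge_atTop 0] with X hX
    have h2 := one_sub_marcumQ_le_exp hμ hX hY (b := 2) (by norm_num)
    have h3 : Real.exp (-X - (1 - 2) * Y) * (2 ^ (-μ) * Real.exp (X / 2)) =
        Real.exp (Y - 1 / 2 * X) * 2 ^ (-μ) := by
      rw [mul_comm (2 ^ (-μ) : ℝ), ← mul_assoc, ← Real.exp_add]
      ring_nf
    linarith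
  · filter_upwards [eventually_ge_atTop 0] with X hX using marcumQ_le_one hμ hX hY

theorem existsUnique_marcumQ_right {μ X q : ℝ} (hμ : 0 < μ) (hX : 0 ≤ X) (hq0 : 0 < q)
    (hq1 : q < 1) : ∃! Y, 0 < Y ∧ marcumQ μ X Y = q := by
  obtain ⟨B, hB, hB0⟩ := (((tendsto_marcumQ_atTop hμ hX).eventually_lt_const hq0).and
    (eventually_ge_atTop 0)).exists
  obtain ⟨Y, hY, hYq⟩ := intermediate_value_Icc' hB0 (continuousOn_marcumQ hμ hX B)
    ⟨hB.le, hq1.le.trans_eq (marcumQ_zero_right hμ hX).symm⟩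
  refine ⟨Y, ⟨lt_of_le_of_ne hY.1 ?_, hYq⟩, fun y hy => ?_⟩
  · rintro rfl
    rw [marcumQ_zero_right hμ hX] at hYq
    linarith
  · exact (marcumQ_strictAntiOn hμ hX).injOn hy.1.le hY.1 (hy.2.trans hYq.symm)

/-- The derivative of the Marcum function in its first variable, for the primitive of the density,
which is defined for all real values of that variable. -/
theorem hasDerivAt_integral_marcumDensity {μ Y : ℝ} (hμ : 0 < μ) (hY : 0 < Y) (X : ℝ) :
    HasDerivAt (fun X => ∫ t in (0 : ℝ)..Y, marcumDensity μ X t)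
      (-(Y ^ μ * Real.exp (-Y - X) * besselSeries (μ + 1) (X * Y))) X := by
  have hg := continuous_besselSeries hμ
  have hg1 := continuous_besselSeries (μ := μ + 1) (by linarith)
  set k : ℝ → ℝ → ℝ := fun X t => Real.exp (-t - X) * besselSeries μ (X * t)
  set k' : ℝ → ℝ → ℝ := fun X t =>
    Real.exp (-t - X) * (t * besselSeries (μ + 1) (X * t) - besselSeries μ (X * t))
  have hk : ∀ X t, HasDerivAt (fun X => k X t) (k' X t) X := by
    intro X t
    have h1 : HasDerivAt (fun X : ℝ => Real.exp (-t - X)) (Real.exp (-t - X) * (-1)) X := by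
      simpa using ((hasDerivAt_id X).const_sub (-t)).exp
    have h2 : HasDerivAt (fun X : ℝ => besselSeries μ (X * t))
        (besselSeries (μ + 1) (X * t) * t) X := by
      have h3 : HasDerivAt (fun X : ℝ => X * t) t X := by
        simpa using (hasDerivAt_id X).mul_const t
      exact (hasDerivAt_besselSeries hμ (X * t)).comp X h3
    refine (h1.mul h2).congr_deriv ?_
    simp only [k']
    ring
  have hrpow : IntervalIntegrable (fun t : ℝ => t ^ (μ - 1)) volume 0 Y :=
    intervalIntegral.intervalIntegrable_rpow' (by linarith)
  have hdens : ∀ X, marcumDensity μ X = fun t => t ^ (μ - 1) * k X t := by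
    intro X
    funext t
    simp only [marcumDensity, k]
    ring
  have hint : ∀ X, IntervalIntegrable (marcumDensity μ X) volume 0 Y := by
    intro X
    rw [hdens]
    exact hrpow.mul_continuousOn (by simp only [k]; fun_prop)
  have hint' : ∀ X, IntervalIntegrable (fun t : ℝ => t ^ (μ - 1) * k' X t) volume 0 Y := by
    intro X
    exact hrpow.mul_continuousOn (by simp only [k']; fun_prop)
  obtain ⟨C, hC⟩ := ((isCompact_closedBall X 1).prod (isCompact_Icc (a := 0) (b := Y))).exists_bound_of_continuousOn
    (f := fun p : ℝ × ℝ => k' p.1 p.2) (by simp only [k']; fun_prop)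
  have h := (intervalIntegral.hasDerivAt_integral_of_dominated_loc_of_deriv_le
    (F := fun X t => marcumDensity μ X t) (F' := fun X t => t ^ (μ - 1) * k' X t)
    (bound := fun t => t ^ (μ - 1) * C) (a := 0) (b := Y) (μ := volume)
    (Metric.closedBall_mem_nhds X one_pos)
    (Eventually.of_forall fun X => (hint X).aestronglyMeasurable_restrict_uIoc) (hint X)
    (hint' X).aestronglyMeasurable_restrict_uIoc
    (Eventually.of_forall fun t ht x hx => ?_) (hrpow.mul_const C)
    (Eventually.of_forall fun t ht x hx => ?_)).2
  -- The differentiated integrand is itself the `t`-derivative of `-t^μ exp (-t-X) besselSeries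
  -- (μ+1) (Xt)`, by the three-term recurrence; the boundary term at `0` vanishes because `μ > 0`.
  · have hval : ∫ t in (0 : ℝ)..Y, t ^ (μ - 1) * k' X t =
        -(Y ^ μ * Real.exp (-Y - X) * besselSeries (μ + 1) (X * Y)) := by
      have hG : ContinuousOn (fun t : ℝ => -(t ^ μ * Real.exp (-t - X) *
          besselSeries (μ + 1) (X * t))) (Icc 0 Y) := by
        refine ContinuousOn.neg (ContinuousOn.mul (ContinuousOn.mul ?_ (by fun_prop)) (by fun_prop))
        exact (Real.continuous_rpow_const hμ.le).continuousOn
      have hG' : ∀ t ∈ Ioo 0 Y, HasDerivAt (fun t : ℝ => -(t ^ μ * Real.exp (-t - X) *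
          besselSeries (μ + 1) (X * t))) (t ^ (μ - 1) * k' X t) t := by
        intro t ht
        have h1 := Real.hasDerivAt_rpow_const (p := μ) (Or.inl ht.1.ne')
        have h2 : HasDerivAt (fun t : ℝ => Real.exp (-t - X)) (Real.exp (-t - X) * (-1)) t := by
          simpa using ((hasDerivAt_id t).neg.sub_const X).exp
        have h3 : HasDerivAt (fun t : ℝ => besselSeries (μ + 1) (X * t))
            (besselSeries (μ + 2) (X * t) * X) t := by
          have := hasDerivAt_besselSeries (μ := μ + 1) (by linarith) (X * t)
          rw [show μ + 1 + 1 = μ + 2 by ring] at this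
          have h4 : HasDerivAt (fun t : ℝ => X * t) X t := by
            simpa using (hasDerivAt_id t).const_mul X
          exact this.comp t h4
        refine ((h1.mul h2).mul h3).neg.congr_deriv ?_
        simp only [k', Pi.mul_apply]
        have hrec := besselSeries_rec hμ (X * t)
        have hp : t ^ μ = t * t ^ (μ - 1) := by
          rw [Real.rpow_sub_one ht.1.ne', mul_div_cancel₀ _ ht.1.ne']
        rw [hp, hrec]
        ring
      rw [intervalIntegral.integral_eq_sub_of_hasDerivAt_of_le hY.le hG hG' (hint' X)]
      simp [Real.zero_rpow hμ.ne']
    rw [hval] at h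
    exact h
  · rw [uIoc_of_le hY.le] at ht
    rw [norm_mul, Real.norm_of_nonneg (Real.rpow_nonneg ht.1.le _)]
    exact mul_le_mul_of_nonneg_left (hC (x, t) ⟨hx, ht.1.le, ht.2⟩) (Real.rpow_nonneg ht.1.le _)
  · simp only [hdens]
    exact (hk x t).const_mul _

theorem marcumQ_strictMonoOn_left {μ Y : ℝ} (hμ : 0 < μ) (hY : 0 < Y) :
    StrictMonoOn (fun X => marcumQ μ X Y) (Ici 0) := by
  have h1 : StrictMonoOn (fun X => 1 - ∫ t in (0 : ℝ)..Y, marcumDensity μ X t) (Ici 0) := by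
    refine strictMonoOn_of_hasDerivWithinAt_pos (convex_Ici 0) (f' := fun X =>
      Y ^ μ * Real.exp (-Y - X) * besselSeries (μ + 1) (X * Y)) ?_ ?_ ?_
    · exact fun X _ => ((hasDerivAt_integral_marcumDensity hμ hY X).const_sub 1).continuousAt.continuousWithinAt
    · intro X _
      simpa using ((hasDerivAt_integral_marcumDensity hμ hY X).const_sub 1).hasDerivWithinAt
    · intro X hX
      rw [interior_Ici] at hX
      have hX : 0 < X := hX
      have := besselSeries_pos (μ := μ + 1) (by linarith) (by positivity : 0 ≤ X * Y)
      positivity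
  exact h1.congr fun X hX => (marcumQ_eq_one_sub hμ hX hY.le).symm

theorem continuousOn_marcumQ_left {μ Y : ℝ} (hμ : 0 < μ) (hY : 0 < Y) :
    ContinuousOn (fun X => marcumQ μ X Y) (Ici 0) := by
  have h1 : ContinuousOn (fun X => 1 - ∫ t in (0 : ℝ)..Y, marcumDensity μ X t) (Ici 0) := fun X _ =>
    ((hasDerivAt_integral_marcumDensity hμ hY X).const_sub 1).continuousAt.continuousWithinAt
  exact h1.congr fun X hX => marcumQ_eq_one_sub hμ hX hY.le

theorem existsUnique_marcumQ_left {μ Y q : ℝ} (hμ : 0 < μ) (hY : 0 < Y)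
    (hq0 : marcumQ μ 0 Y ≤ q) (hq1 : q < 1) : ∃! X, 0 ≤ X ∧ marcumQ μ X Y = q := by
  obtain ⟨B, hB, hB0⟩ := (((tendsto_marcumQ_left_atTop hμ hY.le).eventually_const_lt hq1).and
    (eventually_ge_atTop 0)).exists
  obtain ⟨X, hX, hXq⟩ := intermediate_value_Icc hB0
    ((continuousOn_marcumQ_left hμ hY).mono Icc_subset_Ici_self) ⟨hq0, hB.le⟩
  exact ⟨X, ⟨hX.1, hXq⟩, fun x hx =>
    (marcumQ_strictMonoOn_left hμ hY).injOn hx.1 hX.1 (hx.2.trans hXq.symm)⟩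

/-! ### The phase as the optimal Chernoff exponent. -/

/-- The phase function, as a function of `x` and of the parameter `a` with `y = a + x a²`. -/
noncomputable def marcumPhase (x a : ℝ) : ℝ := x * (a - 1) ^ 2 + (a - 1 - Real.log a)

/-- The choice `b = 1/a` is the stationary point of the Chernoff exponent in `b`: stationarity reads
`y = 1/b + x/b²`. The minimal exponent is the phase, so the bounds have exactly the decay of the
`erfc` term. -/
theorem exp_tilt_eq_marcumPhase {μ x a : ℝ} (ha : 0 < a) :
    Real.exp (-(μ * x) - (1 - a⁻¹) * (μ * (a + x * a ^ 2))) *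
      (a⁻¹ ^ (-μ) * Real.exp (μ * x / a⁻¹)) = Real.exp (-(μ * marcumPhase x a)) := by
  rw [Real.inv_rpow ha.le, ← Real.rpow_neg ha.le, neg_neg, Real.rpow_def_of_pos ha,
    ← Real.exp_add, ← Real.exp_add, marcumPhase]
  congr 1
  field_simp
  ring

theorem marcumQ_le_exp_phase {μ x a : ℝ} (hμ : 0 < μ) (hx : 0 ≤ x) (ha : 1 ≤ a) :
    marcumQ μ (μ * x) (μ * (a + x * a ^ 2)) ≤ Real.exp (-(μ * marcumPhase x a)) := by
  have ha0 : 0 < a := by linarith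
  rw [← exp_tilt_eq_marcumPhase ha0]
  exact marcumQ_le_exp hμ (by positivity) (by positivity) (by positivity) (inv_le_one_of_one_le₀ ha)

theorem one_sub_marcumQ_le_exp_phase {μ x a : ℝ} (hμ : 0 < μ) (hx : 0 ≤ x) (ha0 : 0 < a)
    (ha : a ≤ 1) :
    1 - marcumQ μ (μ * x) (μ * (a + x * a ^ 2)) ≤ Real.exp (-(μ * marcumPhase x a)) := by
  rw [← exp_tilt_eq_marcumPhase ha0]
  exact one_sub_marcumQ_le_exp hμ (by positivity) (by positivity) ((one_le_inv₀ ha0).2 ha)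

/-! ### The geometry of `ζ` -/

/-- The smooth function equal to `2 (a - 1 - log a) / (a - 1) ^ 2` for `a ≠ 1`. -/
noncomputable def logQuot (a : ℝ) : ℝ :=
  2 * dquot (dquot fun q : ℝ × ℝ => q.2 - Real.log (1 + q.2)) (0, a - 1)

theorem contDiffAt_logQuot {a : ℝ} (ha : 0 < a) : ContDiffAt ℝ (⊤ : ℕ∞) logQuot a := by
  have h0 : ∀ q : ℝ × ℝ, 0 < 1 + q.2 →
      ContDiffAt ℝ (⊤ : ℕ∞) (fun q : ℝ × ℝ => q.2 - Real.log (1 + q.2)) q := fun q hq =>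
    contDiffAt_snd.sub ((by fun_prop : ContDiffAt ℝ (⊤ : ℕ∞) (fun q : ℝ × ℝ => 1 + q.2) q).log hq.ne')
  have h1 : ∀ q : ℝ × ℝ, 0 < 1 + q.2 →
      ContDiffAt ℝ (⊤ : ℕ∞) (dquot fun q : ℝ × ℝ => q.2 - Real.log (1 + q.2)) q := fun q hq =>
    contDiffAt_infty_dquot (h0 _ (by simp)) (h0 q hq)
  have h2 := contDiffAt_infty_dquot (q := ((0 : ℝ), a - 1)) (h1 _ (by simp)) (h1 _ (by simpa))
  refine contDiffAt_const.mul ?_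
  exact ContDiffAt.comp a (g := dquot _) (f := fun a : ℝ => ((0 : ℝ), a - 1)) h2 (by fun_prop)

/-- Two Hadamard quotients can be taken, since `t - log (1 + t)` and its first derivative vanish at
`t = 0`. -/
theorem sq_mul_logQuot (a : ℝ) : (a - 1) ^ 2 * logQuot a = 2 * (a - 1 - Real.log a) := by
  set f : ℝ × ℝ → ℝ := fun q => q.2 - Real.log (1 + q.2)
  have h1 := dquot_mul f (0, a - 1)
  have h2 := dquot_mul (dquot f) (0, a - 1)
  have h3 : dquot f (0, 0) = 0 := by
    have : HasDerivAt (fun s : ℝ => s - Real.log (1 + s)) (1 - 1 / (1 + 0)) 0 :=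
      (hasDerivAt_id (0 : ℝ)).sub (((hasDerivAt_id (0 : ℝ)).const_add 1).log (by simp))
    simp [dquot, f, this.deriv]
  simp only [h3, zero_add] at h2
  rw [h2] at h1
  have h4 : f (0, a - 1) = a - 1 - Real.log a := by simp [f]
  have h5 : f (0, 0) = 0 := by simp [f]
  simp only [h4, h5, zero_add] at h1
  rw [logQuot, h1]
  ring

theorem hasDerivAt_logQuot {a : ℝ} (ha : 0 < a) : HasDerivAt logQuot (deriv logQuot a) a :=
  ((contDiffAt_logQuot ha).differentiableAt (by simp)).hasDerivAt

theorem contDiffAt_deriv_logQuot {a : ℝ} (ha : 0 < a) :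
    ContDiffAt ℝ (⊤ : ℕ∞) (deriv logQuot) a := by
  have h : ContDiffOn ℝ (⊤ : ℕ∞) logQuot (Ioi 0) := fun b hb =>
    (contDiffAt_logQuot hb).contDiffWithinAt
  exact ((contDiffOn_infty_iff_deriv_of_isOpen isOpen_Ioi).1 h).2.contDiffAt (Ioi_mem_nhds ha)

/-- Two functions continuous at `c` which agree elsewhere near `c` agree at `c`. -/
theorem eq_of_eventuallyEq_nhdsNE {f g : ℝ → ℝ} {c : ℝ} (hf : ContinuousAt f c)
    (hg : ContinuousAt g c) (h : ∀ᶠ a in 𝓝[≠] c, f a = g a) : f c = g c :=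
  tendsto_nhds_unique_of_eventuallyEq (hf.tendsto.mono_left nhdsWithin_le_nhds)
    (hg.tendsto.mono_left nhdsWithin_le_nhds) h

/-- Differentiate `(a-1)² logQuot a = 2 (a - 1 - log a)` and divide by `2 (a-1)`; the value at `a =
1` follows by continuity. -/
theorem logQuot_add_deriv {a : ℝ} (ha : 0 < a) :
    logQuot a + (a - 1) / 2 * deriv logQuot a = a⁻¹ := by
  have key : ∀ b : ℝ, 0 < b → b ≠ 1 → logQuot b + (b - 1) / 2 * deriv logQuot b = b⁻¹ := by
    intro b hb hb1
    have h1 : HasDerivAt (fun b : ℝ => (b - 1) ^ 2 * logQuot b)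
        (2 * (b - 1) * logQuot b + (b - 1) ^ 2 * deriv logQuot b) b := by
      have h2 : HasDerivAt (fun b : ℝ => (b - 1) ^ 2) (2 * (b - 1)) b := by
        exact (((hasDerivAt_id b).sub_const 1).pow 2).congr_deriv (by simp)
      exact h2.mul (hasDerivAt_logQuot hb)
    have h3 : HasDerivAt (fun b : ℝ => 2 * (b - 1 - Real.log b)) (2 * (1 - b⁻¹)) b :=
      (((hasDerivAt_id b).sub_const 1).sub (Real.hasDerivAt_log hb.ne')).const_mul 2
    have h4 := (h1.congr_of_eventuallyEq
      (Eventually.of_forall fun b => (sq_mul_logQuot b).symm)).unique h3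
    have h5 : b - 1 ≠ 0 := sub_ne_zero.2 hb1
    have h6 : 2 * (b - 1) * (logQuot b + (b - 1) / 2 * deriv logQuot b) = 2 * (b - 1) * b⁻¹ := by
      have : 1 - b⁻¹ = (b - 1) * b⁻¹ := by field_simp
      rw [this] at h4
      linear_combination h4
    exact mul_left_cancel₀ (mul_ne_zero two_ne_zero h5) h6
  by_cases h1 : a = 1
  · have hc := (contDiffAt_logQuot ha).continuousAt
    have hc' := (contDiffAt_deriv_logQuot ha).continuousAt
    refine eq_of_eventuallyEq_nhdsNE (f := fun a => logQuot a + (a - 1) / 2 * deriv logQuot a)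
      (g := fun a => a⁻¹) (by fun_prop) (continuousAt_inv₀ ha.ne') ?_
    filter_upwards [nhdsWithin_le_nhds (Ioi_mem_nhds ha), self_mem_nhdsWithin] with b hb hb1
    exact key b hb (by rwa [← h1])
  · exact key a ha h1

@[simp] theorem logQuot_one : logQuot 1 = 1 := by
  simpa using logQuot_add_deriv one_pos

/-- Differentiating the previous identity at `1` gives `(3/2) logQuot' 1 = -1`. -/
theorem deriv_logQuot_one : deriv logQuot 1 = -(2 / 3) := by
  have h1 := ((contDiffAt_deriv_logQuot one_pos).differentiableAt (by simp)).hasDerivAt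
  have h2 : HasDerivAt (fun a : ℝ => (a - 1) / 2) (1 / 2) 1 :=
    ((hasDerivAt_id (1 : ℝ)).sub_const 1).div_const 2
  have h3 := (hasDerivAt_logQuot one_pos).add (h2.mul h1)
  have h4 := hasDerivAt_inv (one_ne_zero (α := ℝ))
  have h5 := (h3.congr_of_eventuallyEq (f₁ := fun a : ℝ => a⁻¹) (by
    filter_upwards [Ioi_mem_nhds (one_pos (α := ℝ))] with a ha
    exact (logQuot_add_deriv ha).symm)).unique h4
  norm_num at h5
  linarith

theorem logQuot_pos {a : ℝ} (ha : 0 < a) : 0 < logQuot a := by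
  by_cases h1 : a = 1
  · simp [h1]
  · have h2 := sq_mul_logQuot a
    have h3 := Real.log_lt_sub_one_of_pos ha h1
    have h4 : 0 < (a - 1) ^ 2 := by
      have := sub_ne_zero.2 h1
      positivity
    by_contra! h5
    nlinarith

/-- The function `ζ` in the coordinates `(x, a)`, where `y = a + x a²`. -/
noncomputable def zetaParam (u : ℝ × ℝ) : ℝ := (u.2 - 1) * √(2 * u.1 + logQuot u.2)

/-- The domain of the coordinates `(x, a)`. -/
def paramDomain : Set (ℝ × ℝ) :=
  {u | 0 < u.2 ∧ 0 < 1 + 2 * u.1 * u.2 ∧ 0 < 2 * u.1 + logQuot u.2 ∧ 0 < 1 + 2 * u.1}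

theorem mem_paramDomain {x a : ℝ} (hx : 0 ≤ x) (ha : 0 < a) : (x, a) ∈ paramDomain := by
  have := logQuot_pos ha
  refine ⟨ha, ?_, ?_, ?_⟩ <;> simp only <;> positivity

theorem one_mem_paramDomain {u : ℝ × ℝ} (hu : u ∈ paramDomain) : (u.1, (1 : ℝ)) ∈ paramDomain := by
  obtain ⟨-, -, -, h⟩ := hu
  refine ⟨one_pos, ?_, ?_, h⟩ <;> simp <;> linarith

theorem contDiffAt_logQuot_snd {u : ℝ × ℝ} (hu : 0 < u.2) :
    ContDiffAt ℝ (⊤ : ℕ∞) (fun u : ℝ × ℝ => logQuot u.2) u :=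
  ContDiffAt.comp u (g := logQuot) (contDiffAt_logQuot hu) contDiffAt_snd

theorem contDiffAt_zetaParam {u : ℝ × ℝ} (hu : u ∈ paramDomain) :
    ContDiffAt ℝ (⊤ : ℕ∞) zetaParam u := by
  have h1 := contDiffAt_logQuot_snd hu.1
  exact ContDiffAt.mul (by fun_prop) (ContDiffAt.sqrt (by fun_prop) hu.2.2.1.ne')

/-- This is `ζ ζ_a = (a-1)(2x + 1/a)` with the zero at `a = 1` divided out; `logQuot_add_deriv`
performs the division. -/
theorem hasDerivAt_zetaParam {u : ℝ × ℝ} (hu : u ∈ paramDomain) :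
    HasDerivAt (fun a => zetaParam (u.1, a)) ((2 * u.1 + u.2⁻¹) / √(2 * u.1 + logQuot u.2)) u.2 := by
  have h0 := Real.sqrt_pos.2 hu.2.2.1
  have h1 := ((hasDerivAt_logQuot hu.1).const_add (2 * u.1)).sqrt hu.2.2.1.ne'
  refine (((hasDerivAt_id u.2).sub_const 1).mul h1).congr_deriv ?_
  have h2 := logQuot_add_deriv hu.1
  have h3 := Real.mul_self_sqrt hu.2.2.1.le
  simp only [id]
  field_simp
  rw [one_div, ← h2, Real.sq_sqrt hu.2.2.1.le]
  ring

theorem derivSnd_zetaParam {u : ℝ × ℝ} (hu : u ∈ paramDomain) :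
    derivSnd zetaParam u = (2 * u.1 + u.2⁻¹) / √(2 * u.1 + logQuot u.2) :=
  (hasDerivAt_zetaParam hu).deriv

theorem two_mul_add_inv_pos {u : ℝ × ℝ} (hu : u ∈ paramDomain) : 0 < 2 * u.1 + u.2⁻¹ := by
  have : 2 * u.1 + u.2⁻¹ = (1 + 2 * u.1 * u.2) / u.2 := by
    have := hu.1.ne'
    field_simp
    ring
  rw [this]
  exact div_pos hu.2.1 hu.1

theorem derivSnd_zetaParam_pos {u : ℝ × ℝ} (hu : u ∈ paramDomain) : 0 < derivSnd zetaParam u := by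
  rw [derivSnd_zetaParam hu]
  exact div_pos (two_mul_add_inv_pos hu) (Real.sqrt_pos.2 hu.2.2.1)

theorem zetaParam_sq {x a : ℝ} (hx : 0 ≤ x) (ha : 0 < a) :
    zetaParam (x, a) ^ 2 / 2 = marcumPhase x a := by
  have h := sq_mul_logQuot a
  have := logQuot_pos ha
  rw [zetaParam, mul_pow, Real.sq_sqrt (by simp only; positivity), marcumPhase]
  simp only
  linarith

theorem log_phase_le_zetaParam_sq {x a : ℝ} (hx : 0 ≤ x) (ha : 0 < a) :
    a - 1 - Real.log a ≤ zetaParam (x, a) ^ 2 / 2 := by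
  rw [zetaParam_sq hx ha, marcumPhase]
  have : 0 ≤ x * (a - 1) ^ 2 := by positivity
  linarith

/-- Outside a compact interval the phase is large. -/
theorem exists_log_phase_ge (K : ℝ) : ∃ ℓ L : ℝ, 0 < ℓ ∧ ℓ < 1 ∧ 1 < L ∧
    (∀ a, 0 < a → a ≤ ℓ → K < a - 1 - Real.log a) ∧
    ∀ a, L ≤ a → K < a - 1 - Real.log a := by
  have h1 : Tendsto (fun a : ℝ => a - 1 - Real.log a) (𝓝[>] 0) atTop := by
    have h2 : Tendsto (fun a : ℝ => a - 1) (𝓝[>] 0) (𝓝 (0 - 1)) :=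
      (Continuous.tendsto (by fun_prop) 0).mono_left nhdsWithin_le_nhds
    have h3 := tendsto_neg_atBot_atTop.comp Real.tendsto_log_nhdsGT_zero
    exact h2.add_atTop h3
  have h4 : Tendsto (fun a : ℝ => a - 1 - Real.log a) atTop atTop := by
    have h5 : ∀ᶠ a : ℝ in atTop, 1 / 2 * a - 1 ≤ a - 1 - Real.log a := by
      have := (Real.isLittleO_log_id_atTop).bound (by norm_num : (0 : ℝ) < 1 / 2)
      filter_upwards [this, eventually_ge_atTop 0] with a ha ha0
      have := (le_abs_self _).trans ha
      simp only [id, Real.norm_eq_abs, abs_of_nonneg ha0] at this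
      linarith
    refine tendsto_atTop_mono' _ h5 ?_
    exact tendsto_atTop_add_const_right _ _ (tendsto_id.const_mul_atTop (by norm_num))
  obtain ⟨ℓ, hℓ, hℓ'⟩ := mem_nhdsGT_iff_exists_Ioc_subset.1 (h1.eventually_gt_atTop K)
  obtain ⟨L, hL⟩ := eventually_atTop.1 (h4.eventually_gt_atTop K)
  have hℓ : 0 < ℓ := hℓ
  refine ⟨min ℓ (1 / 2), max L 2, by positivity, (min_le_right _ _).trans_lt (by norm_num),
    lt_of_lt_of_le (by norm_num) (le_max_right _ _), fun a ha hal => ?_, fun a ha => ?_⟩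
  · exact hℓ' ⟨ha, hal.trans (min_le_left _ _)⟩
  · exact hL a ((le_max_left _ _).trans ha)

theorem zetaParam_nonneg {u : ℝ × ℝ} (h : 1 ≤ u.2) : 0 ≤ zetaParam u :=
  mul_nonneg (by linarith) (Real.sqrt_nonneg _)

theorem zetaParam_nonpos {u : ℝ × ℝ} (h : u.2 ≤ 1) : zetaParam u ≤ 0 :=
  mul_nonpos_of_nonpos_of_nonneg (by linarith) (Real.sqrt_nonneg _)

theorem zetaParam_lt_of_small {x a ζ : ℝ} (hx : 0 ≤ x) (ha : 0 < a) (ha1 : a ≤ 1)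
    (h : ζ ^ 2 / 2 < a - 1 - Real.log a) : zetaParam (x, a) < ζ := by
  have h1 := log_phase_le_zetaParam_sq hx ha
  have h2 : zetaParam (x, a) ≤ 0 := zetaParam_nonpos ha1
  nlinarith

theorem lt_zetaParam_of_large {x a ζ : ℝ} (hx : 0 ≤ x) (ha1 : 1 ≤ a)
    (h : ζ ^ 2 / 2 < a - 1 - Real.log a) : ζ < zetaParam (x, a) := by
  have h1 := log_phase_le_zetaParam_sq hx (by linarith : 0 < a)
  have h2 : 0 ≤ zetaParam (x, a) := zetaParam_nonneg ha1
  nlinarith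

theorem zetaParam_strictMonoOn {x : ℝ} (hx : 0 ≤ x) :
    StrictMonoOn (fun a => zetaParam (x, a)) (Ioi 0) := by
  refine strictMonoOn_of_hasDerivWithinAt_pos (convex_Ioi 0)
    (f' := fun a => (2 * x + a⁻¹) / √(2 * x + logQuot a)) ?_ ?_ ?_
  · exact fun a ha =>
      (hasDerivAt_zetaParam (mem_paramDomain hx ha)).continuousAt.continuousWithinAt
  · intro a ha
    rw [interior_Ioi] at ha
    exact (hasDerivAt_zetaParam (mem_paramDomain hx ha)).hasDerivWithinAt
  · intro a ha
    rw [interior_Ioi] at ha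
    rw [← derivSnd_zetaParam (mem_paramDomain hx ha)]
    exact derivSnd_zetaParam_pos (mem_paramDomain hx ha)

theorem exists_zetaParam_eq {x : ℝ} (hx : 0 ≤ x) (ζ : ℝ) : ∃ a, 0 < a ∧ zetaParam (x, a) = ζ := by
  obtain ⟨ℓ, L, hℓ, hℓ1, hL1, h1, h2⟩ := exists_log_phase_ge (ζ ^ 2 / 2)
  have hc : ContinuousOn (fun a => zetaParam (x, a)) (Icc ℓ L) := fun a ha =>
    (hasDerivAt_zetaParam (mem_paramDomain hx (hℓ.trans_le ha.1))).continuousAt.continuousWithinAt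
  obtain ⟨a, ha, haζ⟩ := intermediate_value_Icc (by linarith : ℓ ≤ L) hc
    ⟨(zetaParam_lt_of_small hx hℓ hℓ1.le (h1 ℓ hℓ le_rfl)).le,
      (lt_zetaParam_of_large hx hL1.le (h2 L le_rfl)).le⟩
  exact ⟨a, hℓ.trans_le ha.1, haζ⟩

/-! ### Fixed `y` -/

/-- The point `(x, a)` with `a + x a² = y`, as a function of `(y, a)`. -/
noncomputable def paramOfSnd (v : ℝ × ℝ) : ℝ × ℝ := ((v.1 - v.2) / v.2 ^ 2, v.2)

/-- The domain of the coordinates `(y, a)`. -/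
def paramDomainSnd : Set (ℝ × ℝ) := {v | paramOfSnd v ∈ paramDomain}

theorem contDiffAt_paramOfSnd {v : ℝ × ℝ} (hv : 0 < v.2) :
    ContDiffAt ℝ (⊤ : ℕ∞) paramOfSnd v := by
  refine ContDiffAt.prodMk ?_ contDiffAt_snd
  exact ContDiffAt.div (by fun_prop) (by fun_prop) (by positivity)

theorem mem_paramDomainSnd {y a : ℝ} (ha : 0 < a) (hay : a ≤ y) : (y, a) ∈ paramDomainSnd :=
  mem_paramDomain (div_nonneg (sub_nonneg.2 hay) (by positivity)) ha

/-- With `y` fixed, `dx/da = -1/a² - 2x/a`, and the total derivative factors as `(1 + 2xa)/a · (1 -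
(a-1)/a)` over the square root. It is positive, so `a` parametrizes this direction too. -/
theorem hasDerivAt_zetaParam_paramOfSnd {v : ℝ × ℝ} (hv : v ∈ paramDomainSnd) :
    HasDerivAt (fun a => zetaParam (paramOfSnd (v.1, a)))
      ((1 + 2 * (paramOfSnd v).1 * v.2) /
        (v.2 ^ 2 * √(2 * (paramOfSnd v).1 + logQuot v.2))) v.2 := by
  have ha : 0 < v.2 := hv.1
  have hs : 0 < 2 * (paramOfSnd v).1 + logQuot v.2 := hv.2.2.1
  have hsq := Real.sqrt_pos.2 hs
  have h1 : HasDerivAt (fun a : ℝ => (v.1 - a) / a ^ 2)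
      (-(v.2 ^ 2)⁻¹ - 2 * (paramOfSnd v).1 * v.2⁻¹) v.2 := by
    have := ((hasDerivAt_id v.2).const_sub v.1).div (hasDerivAt_pow 2 v.2)
      (by positivity : v.2 ^ 2 ≠ 0)
    refine this.congr_deriv ?_
    simp only [paramOfSnd, id]
    field_simp
    ring
  have h2 := ((h1.const_mul 2).add (hasDerivAt_logQuot ha)).sqrt hs.ne'
  refine (((hasDerivAt_id v.2).sub_const 1).mul h2).congr_deriv ?_
  have h3 := logQuot_add_deriv ha
  have h4 : deriv logQuot v.2 * (v.2 - 1) = 2 * (v.2⁻¹ - logQuot v.2) := by linarith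
  simp only [id, Pi.add_apply]
  change 1 * √(2 * (paramOfSnd v).1 + logQuot v.2) + (v.2 - 1) * ((_ + deriv logQuot v.2) /
    (2 * √(2 * (paramOfSnd v).1 + logQuot v.2))) = _
  set s := √(2 * (paramOfSnd v).1 + logQuot v.2)
  have h5 : s * s = 2 * (paramOfSnd v).1 + logQuot v.2 := Real.mul_self_sqrt hs.le
  rw [eq_div_iff (by positivity)]
  have h6 : (v.2 - 1) * ((2 * (-(v.2 ^ 2)⁻¹ - 2 * (paramOfSnd v).1 * v.2⁻¹) + deriv logQuot v.2) /
      (2 * s)) * s = (v.2 - 1) * (-(v.2 ^ 2)⁻¹ - 2 * (paramOfSnd v).1 * v.2⁻¹) +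
        (v.2⁻¹ - logQuot v.2) := by
    rw [mul_assoc, div_mul_eq_mul_div, mul_div_mul_right _ _ hsq.ne']
    linear_combination (1 / 2) * h4
  calc _ = v.2 ^ 2 * (s * s + (v.2 - 1) * ((2 * (-(v.2 ^ 2)⁻¹ -
        2 * (paramOfSnd v).1 * v.2⁻¹) + deriv logQuot v.2) / (2 * s)) * s) := by ring
    _ = _ := by
      rw [h6, h5]
      field_simp
      ring

theorem derivSnd_zetaParam_paramOfSnd_pos {v : ℝ × ℝ} (hv : v ∈ paramDomainSnd) :
    0 < derivSnd (fun v => zetaParam (paramOfSnd v)) v := by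
  rw [derivSnd, (hasDerivAt_zetaParam_paramOfSnd hv).deriv]
  exact div_pos hv.2.1 (mul_pos (pow_pos hv.1 2) (Real.sqrt_pos.2 hv.2.2.1))

theorem zetaParam_paramOfSnd_strictMonoOn (y : ℝ) :
    StrictMonoOn (fun a => zetaParam (paramOfSnd (y, a))) (Ioc 0 y) := by
  refine strictMonoOn_of_hasDerivWithinAt_pos (convex_Ioc 0 y)
    (f' := fun a => derivSnd (fun v => zetaParam (paramOfSnd v)) (y, a)) ?_ ?_ ?_
  · exact fun a ha => (hasDerivAt_zetaParam_paramOfSnd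
      (mem_paramDomainSnd ha.1 ha.2)).continuousAt.continuousWithinAt
  · intro a ha
    have ha := interior_subset ha
    rw [derivSnd, (hasDerivAt_zetaParam_paramOfSnd (mem_paramDomainSnd ha.1 ha.2)).deriv]
    exact (hasDerivAt_zetaParam_paramOfSnd (mem_paramDomainSnd ha.1 ha.2)).hasDerivWithinAt
  · intro a ha
    have ha := interior_subset ha
    exact derivSnd_zetaParam_paramOfSnd_pos (mem_paramDomainSnd ha.1 ha.2)

theorem exists_zetaParam_paramOfSnd_eq {y ζ : ℝ} (hy : 0 < y) (hζ : ζ ≤ zetaParam (0, y)) :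
    ∃ a ∈ Ioc 0 y, zetaParam (paramOfSnd (y, a)) = ζ := by
  obtain ⟨ℓ, L, hℓ, hℓ1, hL1, h1, h2⟩ := exists_log_phase_ge (ζ ^ 2 / 2)
  set m := min ℓ y
  have hm : 0 < m := lt_min hℓ hy
  have hmy : m ≤ y := min_le_right _ _
  have hc : ContinuousOn (fun a => zetaParam (paramOfSnd (y, a))) (Icc m y) := fun a ha =>
    (hasDerivAt_zetaParam_paramOfSnd
      (mem_paramDomainSnd (hm.trans_le ha.1) ha.2)).continuousAt.continuousWithinAt
  have h3 : zetaParam (paramOfSnd (y, m)) < ζ :=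
    zetaParam_lt_of_small (div_nonneg (sub_nonneg.2 hmy) (by positivity)) hm
      ((min_le_left _ _).trans hℓ1.le) (h1 m hm (min_le_left _ _))
  obtain ⟨a, ha, haζ⟩ := intermediate_value_Icc hmy hc ⟨h3.le, by simpa [paramOfSnd] using hζ⟩
  exact ⟨a, ⟨hm.trans_le ha.1, ha.2⟩, haζ⟩

theorem exists_param {x y : ℝ} (hx : 0 ≤ x) (hy : 0 < y) : ∃ a, 0 < a ∧ y = a + x * a ^ 2 := by
  set r := √(1 + 4 * x * y)
  have hr : r ^ 2 = 1 + 4 * x * y := Real.sq_sqrt (by positivity)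
  have hr0 : 0 ≤ r := Real.sqrt_nonneg _
  -- The positive root of `x a² + a = y` in rationalized form, valid also for `x = 0`.
  refine ⟨2 * y / (1 + r), by positivity, ?_⟩
  field_simp
  linear_combination hr

theorem param_injOn {x : ℝ} (hx : 0 ≤ x) : InjOn (fun a => a + x * a ^ 2) (Ioi 0) := by
  refine StrictMonoOn.injOn fun a ha b hb hab => ?_
  have ha : 0 < a := ha
  have h := mul_le_mul_of_nonneg_left (pow_le_pow_left₀ ha.le hab.le 2) hx
  change a + x * a ^ 2 < b + x * b ^ 2
  linarith

/-! ### The functions of the statement in the coordinates `(x, a)` -/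

theorem sqrt_param {x a : ℝ} (hx : 0 ≤ x) (ha : 0 < a) :
    √(1 + 4 * x * (a + x * a ^ 2)) = 1 + 2 * x * a := by
  rw [show 1 + 4 * x * (a + x * a ^ 2) = (1 + 2 * x * a) ^ 2 by ring]
  exact Real.sqrt_sq (by positivity)

theorem rpow_param {x a : ℝ} (hx : 0 ≤ x) (ha : 0 < a) :
    (1 + 4 * x * (a + x * a ^ 2)) ^ (1 / 4 : ℝ) = √(1 + 2 * x * a) := by
  have h : 0 ≤ 1 + 2 * x * a := by positivity
  rw [show 1 + 4 * x * (a + x * a ^ 2) = (1 + 2 * x * a) ^ (2 : ℝ) by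
    rw [Real.rpow_two]; ring, ← Real.rpow_mul h, Real.sqrt_eq_rpow]
  norm_num

/-- The argument of the logarithm is `1/a`, and `y - x - 1 = (a-1)(1 + x(a+1))` has the sign of `a -
1`. -/
theorem marcumZeta_param {x a : ℝ} (hx : 0 ≤ x) (ha : 0 < a) :
    marcumZeta x (a + x * a ^ 2) = zetaParam (x, a) := by
  have h1 : (1 + (1 + 2 * x * a)) / (2 * (a + x * a ^ 2)) = a⁻¹ := by
    field_simp
    ring
  have h2 : x + (a + x * a ^ 2) - (1 + 2 * x * a) + Real.log a⁻¹ = marcumPhase x a := by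
    rw [Real.log_inv, marcumPhase]
    ring
  rw [marcumZeta, sqrt_param hx ha, h1, h2, ← zetaParam_sq hx ha, mul_div_cancel₀ _ two_ne_zero,
    Real.sqrt_sq_eq_abs, show a + x * a ^ 2 - x - 1 = (a - 1) * (1 + x * (a + 1)) by ring]
  have h3 : 0 < 1 + x * (a + 1) := by positivity
  rcases lt_trichotomy a 1 with h | h | h
  · rw [Real.sign_of_neg (mul_neg_of_neg_of_pos (by linarith) h3),
      abs_of_nonpos (zetaParam_nonpos h.le)]
    ring
  · subst h
    simp [zetaParam]
  · rw [Real.sign_of_pos (mul_pos (by linarith) h3), abs_of_nonneg (zetaParam_nonneg h.le)]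
    ring

theorem param_ne {x a : ℝ} (h : a + x * a ^ 2 ≠ x + 1) : a ≠ 1 := by
  rintro rfl
  exact h (by ring)

theorem param_eq_iff {x a : ℝ} (hx : 0 ≤ x) (ha : 0 < a) : a + x * a ^ 2 = x + 1 ↔ a = 1 := by
  refine ⟨fun h => ?_, by rintro rfl; ring⟩
  exact param_injOn hx ha (mem_Ioi.2 one_pos) (by simp only; linarith)

/-- The factors `a - 1` and `1 + x(a+1)` cancel, so the resulting expression is regular across the
transition line. -/
theorem marcumF_param {x a : ℝ} (hx : 0 ≤ x) (ha : 0 < a) (h1 : a ≠ 1) :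
    marcumF x (a + x * a ^ 2) = √(2 * x + logQuot a) / √(1 + 2 * x * a) := by
  have h2 : a - 1 ≠ 0 := sub_ne_zero.2 h1
  have h3 : 0 < √(1 + 2 * x * a) := Real.sqrt_pos.2 (by positivity)
  have h4 : 0 < 1 + x * (a + 1) := by positivity
  rw [marcumF, marcumZeta_param hx ha, sqrt_param hx ha, rpow_param hx ha, zetaParam,
    show a + x * a ^ 2 - x - 1 = (a - 1) * (1 + x * (a + 1)) by ring]
  simp only
  field_simp
  ring

theorem zetaParam_ne_zero {x a : ℝ} (hx : 0 ≤ x) (ha : 0 < a) (h1 : a ≠ 1) :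
    zetaParam (x, a) ≠ 0 := by
  have := logQuot_pos ha
  exact mul_ne_zero (sub_ne_zero.2 h1) (Real.sqrt_pos.2 (by simp only; positivity)).ne'

theorem marcumF_identities {x y : ℝ} (hx : 0 ≤ x) (hy : 0 < y) (hxy : y ≠ x + 1) :
    marcumF x y = -(marcumZeta x y * (1 + √(1 + 4 * x * y))) /
        ((1 + √(1 + 4 * x * y) - 2 * y) * (1 + 4 * x * y) ^ (1 / 4 : ℝ)) ∧
      marcumF x y = 1 - marcumZeta x y * marcumD0 x y ∧ 0 < marcumF x y := by
  obtain ⟨a, ha, rfl⟩ := exists_param hx hy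
  have h1 := param_ne hxy
  have h2 : a - 1 ≠ 0 := sub_ne_zero.2 h1
  have hr : 0 < √(1 + 2 * x * a) := Real.sqrt_pos.2 (by positivity)
  have hu := logQuot_pos ha
  have hs : 0 < √(2 * x + logQuot a) := Real.sqrt_pos.2 (by positivity)
  refine ⟨?_, ?_, ?_⟩
  · rw [marcumF_param hx ha h1, marcumZeta_param hx ha, sqrt_param hx ha, rpow_param hx ha,
      zetaParam, show 1 + (1 + 2 * x * a) - 2 * (a + x * a ^ 2) =
        -((a - 1) * (2 * (1 + x * a))) by ring]
    have h4 : 0 < 1 + x * a := by positivity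
    simp only
    field_simp
    ring
  · have h5 : marcumZeta x (a + x * a ^ 2) ≠ 0 := by
      rw [marcumZeta_param hx ha]
      exact zetaParam_ne_zero hx ha h1
    rw [marcumD0, marcumF, mul_sub, mul_one_div, div_self h5, sub_sub_cancel, div_mul_eq_mul_div,
      mul_div_assoc, div_div]
    congr 2
    ring
  · rw [marcumF_param hx ha h1]
    positivity

theorem marcumZeta1_param {x a : ℝ} (hx : 0 ≤ x) (ha : 0 < a) (h1 : a ≠ 1) :
    marcumZeta1 x (a + x * a ^ 2) =
      Real.log (√(2 * x + logQuot a) / √(1 + 2 * x * a)) / zetaParam (x, a) := by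
  rw [marcumZeta1, if_neg (mt (param_eq_iff hx ha).1 h1), marcumF_param hx ha h1,
    marcumZeta_param hx ha]

theorem existsUnique_marcumZeta_right {x : ℝ} (hx : 0 ≤ x) (ζ : ℝ) :
    ∃! y, 0 < y ∧ marcumZeta x y = ζ := by
  obtain ⟨a, ha, haζ⟩ := exists_zetaParam_eq hx ζ
  refine ⟨a + x * a ^ 2, ⟨by positivity, (marcumZeta_param hx ha).trans haζ⟩, ?_⟩
  rintro y ⟨hy, hyζ⟩
  obtain ⟨b, hb, rfl⟩ := exists_param hx hy
  rw [marcumZeta_param hx hb] at hyζ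
  rw [(zetaParam_strictMonoOn hx).injOn hb ha (hyζ.trans haζ.symm)]

theorem paramOfSnd_param {x a : ℝ} (ha : 0 < a) : paramOfSnd (a + x * a ^ 2, a) = (x, a) := by
  simp only [paramOfSnd]
  congr 1
  field_simp
  ring

theorem marcumZeta_zero_left {y : ℝ} (hy : 0 < y) : marcumZeta 0 y = zetaParam (0, y) := by
  have := marcumZeta_param (x := 0) le_rfl hy
  rwa [zero_mul, add_zero] at this

theorem marcumZeta_paramOfSnd {y a : ℝ} (ha : 0 < a) (hay : a ≤ y) :
    marcumZeta (paramOfSnd (y, a)).1 y = zetaParam (paramOfSnd (y, a)) := by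
  have h := marcumZeta_param (x := (paramOfSnd (y, a)).1)
    (div_nonneg (sub_nonneg.2 hay) (by positivity)) ha
  have h1 : a + (paramOfSnd (y, a)).1 * a ^ 2 = y := by
    simp only [paramOfSnd]
    field_simp
    ring
  rwa [h1] at h

theorem existsUnique_marcumZeta_left {y ζ : ℝ} (hy : 0 < y) (hζ : ζ ≤ marcumZeta 0 y) :
    ∃! x, 0 ≤ x ∧ marcumZeta x y = ζ := by
  rw [marcumZeta_zero_left hy] at hζ
  obtain ⟨a, ha, haζ⟩ := exists_zetaParam_paramOfSnd_eq hy hζ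
  refine ⟨(paramOfSnd (y, a)).1, ⟨div_nonneg (sub_nonneg.2 ha.2) (by positivity),
    (marcumZeta_paramOfSnd ha.1 ha.2).trans haζ⟩, ?_⟩
  rintro x ⟨hx, hxζ⟩
  obtain ⟨b, hb, rfl⟩ := exists_param hx hy
  rw [marcumZeta_param hx hb, ← paramOfSnd_param hb, ← haζ] at hxζ
  have hby : b ≤ b + x * b ^ 2 := by
    have : 0 ≤ x * b ^ 2 := by positivity
    linarith
  have := (zetaParam_paramOfSnd_strictMonoOn _).injOn ⟨hb, hby⟩ ha hxζ
  rw [← this, paramOfSnd_param hb]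

/-! ### The uniform expansion of the Bessel factor -/

/-- Smooth functions on `(-1/2, ∞)`. -/
def SmoothHalf (f : ℝ → ℝ) : Prop := ∀ c : ℝ, -(1 / 2) < c → ContDiffAt ℝ (⊤ : ℕ∞) f c

theorem SmoothHalf.contDiffOn {f : ℝ → ℝ} (hf : SmoothHalf f) :
    ContDiffOn ℝ (⊤ : ℕ∞) f (Ioi (-(1 / 2))) := fun c hc => (hf c hc).contDiffWithinAt

theorem SmoothHalf.hasDerivAt {f : ℝ → ℝ} (hf : SmoothHalf f) {c : ℝ} (hc : -(1 / 2) < c) :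
    HasDerivAt f (deriv f c) c := ((hf c hc).differentiableAt (by simp)).hasDerivAt

theorem SmoothHalf.deriv {f : ℝ → ℝ} (hf : SmoothHalf f) : SmoothHalf (deriv f) := fun _ hc =>
  ((contDiffOn_infty_iff_deriv_of_isOpen isOpen_Ioi).1 hf.contDiffOn).2.contDiffAt
    (Ioi_mem_nhds hc)

theorem SmoothHalf.continuousOn {f : ℝ → ℝ} (hf : SmoothHalf f) {W : ℝ} :
    ContinuousOn f (Icc 0 W) := fun c hc =>
  (hf c (by linarith [hc.1])).continuousAt.continuousWithinAt

theorem SmoothHalf.hasDerivAt_integral {f : ℝ → ℝ} (hf : SmoothHalf f) {c : ℝ}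
    (hc : -(1 / 2) < c) : HasDerivAt (fun c => ∫ s in (0 : ℝ)..c, f s) (f c) c := by
  have hcont : ContinuousOn f (Ioi (-(1 / 2))) := hf.contDiffOn.continuousOn
  refine intervalIntegral.integral_hasDerivAt_right ?_
    (hcont.stronglyMeasurableAtFilter isOpen_Ioi c hc) (hf c hc).continuousAt
  refine (hcont.mono fun s hs => ?_).intervalIntegrable
  exact (lt_min (by norm_num) hc).trans_le hs.1

theorem SmoothHalf.integral {f : ℝ → ℝ} (hf : SmoothHalf f) :
    SmoothHalf (fun c => ∫ s in (0 : ℝ)..c, f s) := by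
  have h : ContDiffOn ℝ (⊤ : ℕ∞) (fun c => ∫ s in (0 : ℝ)..c, f s) (Ioi (-(1 / 2))) := by
    refine (contDiffOn_infty_iff_deriv_of_isOpen isOpen_Ioi).2 ⟨?_, ?_⟩
    · exact fun c hc => (hf.hasDerivAt_integral hc).differentiableAt.differentiableWithinAt
    · exact hf.contDiffOn.congr fun c hc => (hf.hasDerivAt_integral hc).deriv
  exact fun c hc => h.contDiffAt (Ioi_mem_nhds hc)

/-- The second-order part of the transport operator. -/
noncomputable def wkbOp (A : ℝ → ℝ) : ℝ → ℝ := deriv fun c => deriv A c / (1 + 2 * c)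

theorem SmoothHalf.div_lin {f : ℝ → ℝ} (hf : SmoothHalf f) :
    SmoothHalf fun c => f c / (1 + 2 * c) := fun c hc =>
  (hf c hc).div (by fun_prop) (by linarith)

theorem SmoothHalf.wkbOp {A : ℝ → ℝ} (hA : SmoothHalf A) : SmoothHalf (wkbOp A) :=
  hA.deriv.div_lin.deriv

/-- The coefficients of the expansion of the Bessel factor. -/
noncomputable def wkbCoeff : ℕ → ℝ → ℝ
  | 0 => fun c => (1 + c) / √(1 + 2 * c)
  | k + 1 => fun c => -((1 + c) / √(1 + 2 * c) *
      ∫ s in (0 : ℝ)..c, s / √(1 + 2 * s) * wkbOp (wkbCoeff k) s)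

theorem smoothHalf_sqrt : SmoothHalf fun c => √(1 + 2 * c) := fun c hc =>
  ContDiffAt.sqrt (by fun_prop) (by linarith)

theorem sqrt_lin_pos {c : ℝ} (hc : -(1 / 2) < c) : 0 < √(1 + 2 * c) :=
  Real.sqrt_pos.2 (by linarith)

theorem smoothHalf_wkbCoeff_zero : SmoothHalf (wkbCoeff 0) := fun c hc =>
  ContDiffAt.div (by fun_prop) (smoothHalf_sqrt c hc) (sqrt_lin_pos hc).ne'

theorem SmoothHalf.wkb_integrand {A : ℝ → ℝ} (hA : SmoothHalf A) :
    SmoothHalf fun s => s / √(1 + 2 * s) * _root_.wkbOp A s := fun c hc =>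
  (ContDiffAt.div (by fun_prop) (smoothHalf_sqrt c hc) (sqrt_lin_pos hc).ne').mul (hA.wkbOp c hc)

theorem smoothHalf_wkbCoeff (k : ℕ) : SmoothHalf (wkbCoeff k) := by
  induction k with
  | zero => exact smoothHalf_wkbCoeff_zero
  | succ k ih => exact fun c hc =>
      ((smoothHalf_wkbCoeff_zero c hc).mul (ih.wkb_integrand.integral c hc)).neg

/-- The leading coefficient solves the homogeneous transport equation, with value `1` at `c = 0`. -/
theorem hasDerivAt_wkbCoeff_zero {c : ℝ} (hc : -(1 / 2) < c) :
    HasDerivAt (wkbCoeff 0) (c / ((1 + c) * (1 + 2 * c)) * wkbCoeff 0 c) c := by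
  have h0 := sqrt_lin_pos hc
  have h1 : HasDerivAt (fun c : ℝ => 1 + 2 * c) 2 c := by
    simpa using ((hasDerivAt_id c).const_mul 2).const_add 1
  have h2 := ((hasDerivAt_id c).const_add 1).div (h1.sqrt (by linarith)) h0.ne'
  refine h2.congr_deriv ?_
  have h3 : (1 + c) ≠ 0 := by linarith
  have h4 : √(1 + 2 * c) ^ 2 = 1 + 2 * c := Real.sq_sqrt (by linarith)
  have h5 : 1 + 2 * c = √(1 + 2 * c) ^ 2 := h4.symm
  have h6 : (1 + 2 * c) ≠ 0 := by linarith
  simp only [wkbCoeff, id]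
  field_simp
  rw [h4]
  ring

/-- Variation of constants: the integral in `wkbCoeff` is built to produce this source term, and it
vanishes at `c = 0`, as the normalization `besselFactor μ 0 = 1` requires. -/
theorem hasDerivAt_wkbCoeff_succ (k : ℕ) {c : ℝ} (hc : -(1 / 2) < c) :
    HasDerivAt (wkbCoeff (k + 1)) (c / ((1 + c) * (1 + 2 * c)) * wkbCoeff (k + 1) c -
      c * (1 + c) / (1 + 2 * c) * wkbOp (wkbCoeff k) c) c := by
  have h1 := ((hasDerivAt_wkbCoeff_zero hc).mul
    ((smoothHalf_wkbCoeff k).wkb_integrand.hasDerivAt_integral hc)).neg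
  refine h1.congr_deriv ?_
  have h5 : wkbCoeff 0 c * (c / √(1 + 2 * c) * wkbOp (wkbCoeff k) c) =
      c * (1 + c) / (1 + 2 * c) * wkbOp (wkbCoeff k) c := by
    have h6 : √(1 + 2 * c) * √(1 + 2 * c) = 1 + 2 * c := Real.mul_self_sqrt (by linarith)
    simp only [wkbCoeff]
    rw [← mul_assoc, div_mul_div_comm, h6, mul_comm (1 + c)]
  rw [h5]
  simp only [wkbCoeff]
  ring

theorem one_le_wkbCoeff_zero {c : ℝ} (hc : 0 ≤ c) : 1 ≤ wkbCoeff 0 c := by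
  have h0 := sqrt_lin_pos (by linarith : -(1 / 2) < c)
  rw [wkbCoeff, one_le_div h0]
  exact Real.sqrt_le_iff.2 ⟨by linarith, by nlinarith⟩

/-- The truncated expansion. -/
noncomputable def wkbSum (N : ℕ) (h c : ℝ) : ℝ := ∑ k ∈ Finset.range N, h ^ k * wkbCoeff k c

theorem hasDerivAt_wkbSum (N : ℕ) (h : ℝ) {c : ℝ} (hc : -(1 / 2) < c) :
    HasDerivAt (wkbSum N h) (∑ k ∈ Finset.range N, h ^ k * deriv (wkbCoeff k) c) c :=
  HasDerivAt.fun_sum fun k _ => ((smoothHalf_wkbCoeff k).hasDerivAt hc).const_mul _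

theorem hasDerivAt_deriv_wkbSum (N : ℕ) (h : ℝ) {c : ℝ} (hc : -(1 / 2) < c) :
    HasDerivAt (fun c => (∑ k ∈ Finset.range N, h ^ k * deriv (wkbCoeff k) c) / (1 + 2 * c))
      (∑ k ∈ Finset.range N, h ^ k * wkbOp (wkbCoeff k) c) c := by
  have h1 : HasDerivAt (fun c => ∑ k ∈ Finset.range N, h ^ k * (deriv (wkbCoeff k) c / (1 + 2 * c)))
      (∑ k ∈ Finset.range N, h ^ k * wkbOp (wkbCoeff k) c) c :=
    HasDerivAt.fun_sum fun k _ =>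
      ((smoothHalf_wkbCoeff k).deriv.div_lin.hasDerivAt hc).const_mul _
  refine h1.congr_of_eventuallyEq (Eventually.of_forall fun c => ?_)
  simp only [Finset.sum_div, mul_div_assoc]

/-- The transport equation, up to a residual of high order. -/
theorem wkbSum_transport (N : ℕ) (h : ℝ) {c : ℝ} (hc : -(1 / 2) < c) :
    ∑ k ∈ Finset.range (N + 1), h ^ k * deriv (wkbCoeff k) c =
      c / ((1 + c) * (1 + 2 * c)) * wkbSum (N + 1) h c -
      h * (c * (1 + c) / (1 + 2 * c)) *
        ∑ k ∈ Finset.range (N + 1), h ^ k * wkbOp (wkbCoeff k) c +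
      h ^ (N + 1) * (c * (1 + c) / (1 + 2 * c) * wkbOp (wkbCoeff N) c) := by
  induction N with
  | zero =>
    simp only [wkbSum, zero_add, Finset.sum_range_one, pow_zero, one_mul, pow_one,
      (hasDerivAt_wkbCoeff_zero hc).deriv]
    ring
  | succ N ih =>
    rw [Finset.sum_range_succ, ih, (hasDerivAt_wkbCoeff_succ N hc).deriv, wkbSum, wkbSum,
      Finset.sum_range_succ (fun k => h ^ k * wkbCoeff k c) (N + 1),
      Finset.sum_range_succ (fun k => h ^ k * wkbOp (wkbCoeff k) c) (N + 1)]
    ring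

/-! ### The Bessel factor, its Riccati equation, and stability of the latter. -/

/-- The Bessel factor. -/
noncomputable def besselFactor (μ c : ℝ) : ℝ :=
  Real.Gamma μ * besselSeries μ (μ ^ 2 * (c * (1 + c))) *
    Real.exp (-(μ * (2 * c - Real.log (1 + c))))

/-- The normalized logarithmic derivative of the Bessel series. -/
noncomputable def besselRatio (μ c : ℝ) : ℝ :=
  μ * besselSeries (μ + 1) (μ ^ 2 * (c * (1 + c))) / besselSeries μ (μ ^ 2 * (c * (1 + c)))

theorem besselFactor_pos {μ c : ℝ} (hμ : 0 < μ) (hc : 0 ≤ c) : 0 < besselFactor μ c := by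
  have h1 := besselSeries_pos hμ (by positivity : 0 ≤ μ ^ 2 * (c * (1 + c)))
  have h2 := Real.Gamma_pos_of_pos hμ
  rw [besselFactor]
  positivity

theorem besselFactor_zero {μ : ℝ} (hμ : 0 < μ) : besselFactor μ 0 = 1 := by
  simp [besselFactor, besselSeries_zero, (Real.Gamma_pos_of_pos hμ).ne']

theorem besselRatio_pos {μ c : ℝ} (hμ : 0 < μ) (hc : 0 ≤ c) : 0 < besselRatio μ c := by
  have h1 := besselSeries_pos hμ (by positivity : 0 ≤ μ ^ 2 * (c * (1 + c)))
  have h2 := besselSeries_pos (by linarith : 0 < μ + 1)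
    (by positivity : 0 ≤ μ ^ 2 * (c * (1 + c)))
  rw [besselRatio]
  positivity

theorem hasDerivAt_besselArg (μ c : ℝ) :
    HasDerivAt (fun c : ℝ => μ ^ 2 * (c * (1 + c))) (μ ^ 2 * (1 + 2 * c)) c := by
  refine (((hasDerivAt_id c).mul ((hasDerivAt_id c).const_add 1)).const_mul (μ ^ 2)).congr_deriv ?_
  simp only [id]
  ring

theorem hasDerivAt_besselSeries_arg {μ : ℝ} (hμ : 0 < μ) (c : ℝ) :
    HasDerivAt (fun c : ℝ => besselSeries μ (μ ^ 2 * (c * (1 + c))))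
      (besselSeries (μ + 1) (μ ^ 2 * (c * (1 + c))) * (μ ^ 2 * (1 + 2 * c))) c :=
  HasDerivAt.comp c (hasDerivAt_besselSeries hμ _) (hasDerivAt_besselArg μ c)

/-- The exponent in `besselFactor` removes the leading part `1/(1+c)` of the ratio, which is the
positive root of `1 - R - c(1+c)R² = 0` for `c > 0`. -/
theorem hasDerivAt_log_besselFactor {μ c : ℝ} (hμ : 0 < μ) (hc : 0 ≤ c) :
    HasDerivAt (fun c => Real.log (besselFactor μ c))
      (μ * (1 + 2 * c) * (besselRatio μ c - (1 + c)⁻¹)) c := by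
  have hg := besselSeries_pos hμ (by positivity : 0 ≤ μ ^ 2 * (c * (1 + c)))
  have hG := Real.Gamma_pos_of_pos hμ
  have h1c : (0 : ℝ) < 1 + c := by linarith
  have h1 := hasDerivAt_besselSeries_arg hμ c
  have h2 : HasDerivAt (fun c : ℝ => Real.exp (-(μ * (2 * c - Real.log (1 + c)))))
      (Real.exp (-(μ * (2 * c - Real.log (1 + c)))) * (-(μ * (2 - 1 / (1 + c))))) c := by
    have h3 : HasDerivAt (fun c : ℝ => 2 * c) 2 c := by simpa using (hasDerivAt_id c).const_mul 2
    exact (((h3.sub (((hasDerivAt_id c).const_add 1).log h1c.ne')).const_mul μ).neg).exp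
  have h4 := ((h1.const_mul (Real.Gamma μ)).mul h2).log (besselFactor_pos hμ hc).ne'
  refine h4.congr_deriv ?_
  have he := Real.exp_pos (-(μ * (2 * c - Real.log (1 + c))))
  simp only [besselRatio, Pi.mul_apply]
  set g := besselSeries μ (μ ^ 2 * (c * (1 + c)))
  set g₁ := besselSeries (μ + 1) (μ ^ 2 * (c * (1 + c)))
  field_simp
  ring

/-- The Riccati equation. -/
theorem hasDerivAt_besselRatio {μ c : ℝ} (hμ : 0 < μ) (hc : 0 ≤ c) :
    ∃ d, HasDerivAt (besselRatio μ) d c ∧ μ⁻¹ * (c * (1 + c) / (1 + 2 * c)) * d =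
      1 - besselRatio μ c - c * (1 + c) * besselRatio μ c ^ 2 := by
  have hg := besselSeries_pos hμ (by positivity : 0 ≤ μ ^ 2 * (c * (1 + c)))
  have h1 := hasDerivAt_besselSeries_arg hμ c
  have h2 : HasDerivAt (fun c : ℝ => besselSeries (μ + 1) (μ ^ 2 * (c * (1 + c))))
      (besselSeries (μ + 2) (μ ^ 2 * (c * (1 + c))) * (μ ^ 2 * (1 + 2 * c))) c := by
    have := hasDerivAt_besselSeries (μ := μ + 1) (by linarith) (μ ^ 2 * (c * (1 + c)))
    rw [show μ + 1 + 1 = μ + 2 by ring] at this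
    exact HasDerivAt.comp c this (hasDerivAt_besselArg μ c)
  refine ⟨_, (h2.const_mul μ).div h1 hg.ne', ?_⟩
  have hrec := besselSeries_rec hμ (μ ^ 2 * (c * (1 + c)))
  have h3 : (1 + 2 * c) ≠ 0 := by positivity
  rw [besselRatio]
  set g := besselSeries μ (μ ^ 2 * (c * (1 + c)))
  set g₁ := besselSeries (μ + 1) (μ ^ 2 * (c * (1 + c)))
  set g₂ := besselSeries (μ + 2) (μ ^ 2 * (c * (1 + c)))
  field_simp
  linear_combination (-g) * hrec

/-- At a maximum over an interval starting at `0`, the derivative of the square is nonnegative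
after multiplication by a weight that vanishes at `0`. -/
theorem exists_max_sq {D D' m : ℝ → ℝ} {W : ℝ} (hW : 0 ≤ W)
    (hD : ∀ c ∈ Icc 0 W, HasDerivAt D (D' c) c) (hm0 : m 0 = 0) (hm : ∀ c ∈ Icc 0 W, 0 ≤ m c) :
    ∃ c ∈ Icc 0 W, (∀ b ∈ Icc 0 W, |D b| ≤ |D c|) ∧ 0 ≤ m c * (D' c * D c) := by
  obtain ⟨c, hc, hmax⟩ := isCompact_Icc.exists_isMaxOn (nonempty_Icc.2 hW)
    (fun c hc => (hD c hc).continuousAt.continuousWithinAt.abs : ContinuousOn (fun c => |D c|) _)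
  have hmax : ∀ b ∈ Icc 0 W, |D b| ≤ |D c| := fun b hb => hmax hb
  refine ⟨c, hc, hmax, ?_⟩
  rcases hc.1.eq_or_lt with h0 | h0
  · rw [← h0, hm0, zero_mul]
  · refine mul_nonneg (hm c hc) ?_
    have h1 : HasDerivAt (fun b => D b ^ 2) (2 * D c * D' c) c := by
      refine ((hD c hc).pow 2).congr_deriv ?_
      simp
    -- Only left difference quotients are used, so a maximum at the right end `W` is allowed.
    have h2 : Tendsto (slope (fun b => D b ^ 2) c) (𝓝[<] c) (𝓝 (2 * D c * D' c)) :=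
      (hasDerivAt_iff_tendsto_slope.1 h1).mono_left
        (nhdsWithin_mono c fun b hb => ne_of_lt hb)
    have h3 : ∀ᶠ b in 𝓝[<] c, 0 ≤ slope (fun b => D b ^ 2) c b := by
      filter_upwards [Ioo_mem_nhdsLT h0] with b hb
      rw [slope_def_field]
      have h4 : D b ^ 2 ≤ D c ^ 2 := sq_le_sq.2 (hmax b ⟨hb.1.le, hb.2.le.trans hc.2⟩)
      exact div_nonneg_of_nonpos (by linarith) (by linarith [hb.2])
    have h5 := ge_of_tendsto h2 h3
    linarith

theorem exists_abs_sum_le {f : ℕ → ℝ → ℝ} (hf : ∀ k, SmoothHalf (f k)) (N : ℕ) (W : ℝ) :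
    ∃ B, 0 ≤ B ∧ ∀ h ∈ Icc (0 : ℝ) 1, ∀ c ∈ Icc 0 W,
      |∑ k ∈ Finset.range N, h ^ k * f k c| ≤ B := by
  have h1 : ∀ k, ∃ B, ∀ c ∈ Icc 0 W, ‖f k c‖ ≤ B := fun k =>
    isCompact_Icc.exists_bound_of_continuousOn (hf k).continuousOn
  choose B hB using h1
  refine ⟨∑ k ∈ Finset.range N, |B k|, by positivity, fun h hh c hc => ?_⟩
  refine (Finset.abs_sum_le_sum_abs _ _).trans (Finset.sum_le_sum fun k _ => ?_)
  rw [abs_mul, abs_pow, abs_of_nonneg hh.1]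
  have h2 : h ^ k ≤ 1 := pow_le_one₀ hh.1 hh.2
  have h3 : |f k c| ≤ |B k| := (hB k c hc).trans (le_abs_self _)
  nlinarith [abs_nonneg (f k c), pow_nonneg hh.1 k]

/-- The truncated expansion of the normalized logarithmic derivative. -/
noncomputable def ratioApprox (N : ℕ) (h c : ℝ) : ℝ :=
  (1 + c)⁻¹ + h * ((∑ k ∈ Finset.range N, h ^ k * deriv (wkbCoeff k) c) / (1 + 2 * c) /
    wkbSum N h c)

/-- The truncated expansion satisfies the Riccati equation up to a residual of high order. -/
theorem hasDerivAt_ratioApprox (N : ℕ) {h c : ℝ} (hc : 0 ≤ c) (hS : wkbSum (N + 1) h c ≠ 0) :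
    ∃ d, HasDerivAt (ratioApprox (N + 1) h) d c ∧ h * (c * (1 + c) / (1 + 2 * c)) * d =
      1 - ratioApprox (N + 1) h c - c * (1 + c) * ratioApprox (N + 1) h c ^ 2 +
        h ^ (N + 2) * (c * (1 + c) / (1 + 2 * c) * wkbOp (wkbCoeff N) c / wkbSum (N + 1) h c) := by
  have hc' : -(1 / 2) < c := by linarith
  have h1 := ((hasDerivAt_deriv_wkbSum (N + 1) h hc').div (hasDerivAt_wkbSum (N + 1) h hc') hS).const_mul h
  have h1c : 1 + c ≠ 0 := by positivity
  have h2c : 1 + 2 * c ≠ 0 := by positivity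
  have h2 : HasDerivAt (fun c : ℝ => (1 + c)⁻¹) (-1 / (1 + c) ^ 2) c := by
    exact (((hasDerivAt_id c).const_add 1).inv h1c).congr_deriv (by simp)
  refine ⟨_, h2.add h1, ?_⟩
  have h3 := wkbSum_transport N h hc'
  rw [ratioApprox]
  set P := wkbSum (N + 1) h c
  set P₁ := ∑ k ∈ Finset.range (N + 1), h ^ k * deriv (wkbCoeff k) c
  set P₂ := ∑ k ∈ Finset.range (N + 1), h ^ k * wkbOp (wkbCoeff k) c
  set w := wkbOp (wkbCoeff N) c
  field_simp at h3 ⊢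
  linear_combination (h * P * (1 + 2 * c)) * h3

theorem smoothHalf_weight : SmoothHalf fun c => c * (1 + c) / (1 + 2 * c) := fun c hc =>
  ContDiffAt.div (by fun_prop) (by fun_prop) (by linarith)

theorem wkbSum_succ_eq (N : ℕ) (h c : ℝ) : wkbSum (N + 1) h c =
    wkbCoeff 0 c + h * ∑ k ∈ Finset.range N, h ^ k * wkbCoeff (k + 1) c := by
  rw [wkbSum, Finset.sum_range_succ', Finset.mul_sum, pow_zero, one_mul, add_comm]
  congr 1
  exact Finset.sum_congr rfl fun k _ => by ring

theorem wkbSum_succ_zero (N : ℕ) (h : ℝ) : wkbSum (N + 1) h 0 = 1 := by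
  rw [wkbSum_succ_eq]
  simp [wkbCoeff]

/-- The leading coefficient is at least `1` and the other terms contribute `O(h)`. -/
theorem exists_half_le_wkbSum (N : ℕ) (W : ℝ) :
    ∃ h₀, 0 < h₀ ∧ h₀ ≤ 1 ∧ ∀ h ∈ Ioo 0 h₀, ∀ c ∈ Icc 0 W, 1 / 2 ≤ wkbSum (N + 1) h c := by
  obtain ⟨B, hB0, hB⟩ := exists_abs_sum_le (fun k => smoothHalf_wkbCoeff (k + 1)) N W
  refine ⟨min 1 (1 / (2 * (B + 1))), by positivity, min_le_left _ _, fun h hh c hc => ?_⟩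
  have h1 : h < 1 / (2 * (B + 1)) := hh.2.trans_le (min_le_right _ _)
  have h2 : h ≤ 1 := hh.2.le.trans (min_le_left _ _)
  have h3 := (abs_le.1 (hB h ⟨hh.1.le, h2⟩ c hc)).1
  have h4 : h * (2 * (B + 1)) < 1 := by rwa [lt_div_iff₀ (by positivity)] at h1
  rw [wkbSum_succ_eq]
  have h5 := one_le_wkbCoeff_zero hc.1
  have h6 := mul_le_mul_of_nonneg_left h3 hh.1.le
  nlinarith [hh.1]

/-- The main part is at least `1/(1+W)`, the correction at least `-2Bh`. This sign is what makes the
nonlinear term of the Riccati equation harmless. -/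
theorem exists_ratioApprox_nonneg (N : ℕ) {W : ℝ} (hW : 0 ≤ W) :
    ∃ h₀, 0 < h₀ ∧ ∀ h ∈ Ioo 0 h₀, ∀ c ∈ Icc 0 W, 0 ≤ ratioApprox (N + 1) h c := by
  obtain ⟨h₁, h₁0, h₁1, h₁w⟩ := exists_half_le_wkbSum N W
  obtain ⟨B, hB0, hB⟩ := exists_abs_sum_le (fun k => (smoothHalf_wkbCoeff k).deriv) (N + 1) W
  refine ⟨min h₁ (1 / ((2 * B + 1) * (1 + W))), by positivity, fun h hh c hc => ?_⟩
  have h2 : h < h₁ := hh.2.trans_le (min_le_left _ _)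
  have h3 : h < 1 / ((2 * B + 1) * (1 + W)) := hh.2.trans_le (min_le_right _ _)
  have h4 := h₁w h ⟨hh.1, h2⟩ c hc
  have h5 := hB h ⟨hh.1.le, h2.le.trans h₁1⟩ c hc
  rw [lt_div_iff₀ (by positivity)] at h3
  have hc0 := hc.1
  rw [ratioApprox, div_div]
  set P := wkbSum (N + 1) h c
  set P₁ := ∑ k ∈ Finset.range (N + 1), h ^ k * deriv (wkbCoeff k) c
  have h6 : -(2 * B) ≤ P₁ / ((1 + 2 * c) * P) := by
    rw [le_div_iff₀ (by positivity)]
    have h7 := (abs_le.1 h5).1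
    have h8 : 1 / 2 ≤ (1 + 2 * c) * P := by nlinarith
    nlinarith
  have h7 : (1 + W)⁻¹ ≤ (1 + c)⁻¹ := by
    gcongr
    exact hc.2
  have h8 : h * (2 * B + 1) ≤ (1 + W)⁻¹ := by
    rw [le_inv_comm₀ (by have := hh.1; positivity) (by positivity),
      ← one_div, le_div_iff₀ (by have := hh.1; positivity)]
    linarith
  have h9 := mul_le_mul_of_nonneg_left h6 hh.1.le
  nlinarith [hh.1]

/-- With weight `w = c(1+c)/(1+2c)`, the difference `D` of the ratio `R` and its approximation `R_N`
satisfies `h w D' = -D (1 + c(1+c)(R + R_N)) - h^(N+2) ρ`, where `R + R_N ≥ 0`. At a maximum of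
`|D|` one has `w D' D ≥ 0`, so `D² ≤ h^(N+2) |ρ| |D|`. The weight vanishes at `c = 0`, so no
boundary value is needed. -/
theorem exists_besselRatio_sub_le (N : ℕ) {W : ℝ} (hW : 0 ≤ W) :
    ∃ C h₀, 0 ≤ C ∧ 0 < h₀ ∧ ∀ h ∈ Ioo 0 h₀, ∀ c ∈ Icc 0 W,
      |besselRatio h⁻¹ c - ratioApprox (N + 1) h c| ≤ C * h ^ (N + 2) := by
  obtain ⟨h₁, h₁0, h₁1, h₁w⟩ := exists_half_le_wkbSum N W
  obtain ⟨h₂, h₂0, h₂w⟩ := exists_ratioApprox_nonneg N hW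
  obtain ⟨B, hB⟩ := isCompact_Icc.exists_bound_of_continuousOn (s := Icc 0 W)
    (f := fun c => c * (1 + c) / (1 + 2 * c) * wkbOp (wkbCoeff N) c)
    (smoothHalf_weight.continuousOn.mul (smoothHalf_wkbCoeff N).wkbOp.continuousOn)
  have hB0 : 0 ≤ B := (norm_nonneg _).trans (hB 0 ⟨le_rfl, hW⟩)
  refine ⟨2 * B, min h₁ h₂, by positivity, by positivity, fun h hh => ?_⟩
  have hh0 := hh.1
  have hh1 : h ∈ Ioo 0 h₁ := ⟨hh.1, hh.2.trans_le (min_le_left _ _)⟩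
  have hh2 : h ∈ Ioo 0 h₂ := ⟨hh.1, hh.2.trans_le (min_le_right _ _)⟩
  have key : ∀ c, ∃ d, c ∈ Icc 0 W →
      HasDerivAt (fun c => besselRatio h⁻¹ c - ratioApprox (N + 1) h c) d c ∧
      h * (c * (1 + c) / (1 + 2 * c)) * d =
        -((besselRatio h⁻¹ c - ratioApprox (N + 1) h c) *
          (1 + c * (1 + c) * (besselRatio h⁻¹ c + ratioApprox (N + 1) h c))) -
        h ^ (N + 2) * (c * (1 + c) / (1 + 2 * c) * wkbOp (wkbCoeff N) c /
          wkbSum (N + 1) h c) := by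
    intro c
    by_cases hc : c ∈ Icc 0 W
    · have hS : wkbSum (N + 1) h c ≠ 0 := by linarith [h₁w h hh1 c hc]
      obtain ⟨d₁, hd₁, e₁⟩ := hasDerivAt_besselRatio (inv_pos.2 hh0) hc.1
      obtain ⟨d₂, hd₂, e₂⟩ := hasDerivAt_ratioApprox N hc.1 hS
      refine ⟨d₁ - d₂, fun _ => ⟨hd₁.sub hd₂, ?_⟩⟩
      rw [inv_inv] at e₁
      linear_combination e₁ - e₂
    · exact ⟨0, fun h => (hc h).elim⟩
  choose D' hD' using key
  obtain ⟨c, hc, hmax, hle⟩ := exists_max_sq (m := fun c => h * (c * (1 + c) / (1 + 2 * c))) hW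
    (fun c hc => (hD' c hc).1) (by simp) (fun c hc => by have := hc.1; positivity)
  intro b hb
  refine (hmax b hb).trans ?_
  have e := (hD' c hc).2
  have hS := h₁w h hh1 c hc
  have hR := besselRatio_pos (inv_pos.2 hh0) hc.1
  have hA := h₂w h hh2 c hc
  have hw := hB c hc
  have hc0 := hc.1
  rw [← mul_assoc, e] at hle
  set D := besselRatio h⁻¹ c - ratioApprox (N + 1) h c
  rw [Real.norm_eq_abs] at hw
  have hρ : |c * (1 + c) / (1 + 2 * c) * wkbOp (wkbCoeff N) c / wkbSum (N + 1) h c| ≤ 2 * B := by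
    rw [abs_div, abs_of_pos (by linarith : 0 < wkbSum (N + 1) h c), div_le_iff₀ (by linarith)]
    nlinarith
  set ρ := c * (1 + c) / (1 + 2 * c) * wkbOp (wkbCoeff N) c / wkbSum (N + 1) h c
  have h1 : 0 ≤ D ^ 2 * (c * (1 + c) * (besselRatio h⁻¹ c + ratioApprox (N + 1) h c)) := by
    positivity
  have h2 : |D| * |D| ≤ h ^ (N + 2) * (2 * B) * |D| := by
    have h3 : D * D ≤ h ^ (N + 2) * (-(ρ * D)) := by nlinarith
    have h4 : -(ρ * D) ≤ 2 * B * |D| := by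
      refine (neg_le_abs _).trans ?_
      rw [abs_mul]
      gcongr
    rw [abs_mul_abs_self, mul_assoc]
    exact h3.trans (by gcongr)
  rcases (abs_nonneg D).eq_or_lt with h0 | h0
  · rw [← h0]
    positivity
  · have := le_of_mul_le_mul_right h2 h0
    linarith

/-- The uniform expansion of the Bessel factor. -/
theorem exists_besselFactor_sub_le (N : ℕ) {W : ℝ} (hW : 0 ≤ W) :
    ∃ C h₀, 0 ≤ C ∧ 0 < h₀ ∧ ∀ h ∈ Ioo 0 h₀, ∀ c ∈ Icc 0 W,
      |besselFactor h⁻¹ c - wkbSum (N + 1) h c| ≤ C * h ^ (N + 1) := by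
  obtain ⟨h₁, h₁0, h₁1, h₁w⟩ := exists_half_le_wkbSum N W
  obtain ⟨C, h₂, hC, h₂0, h₂w⟩ := exists_besselRatio_sub_le N hW
  obtain ⟨B, hB0, hB⟩ := exists_abs_sum_le smoothHalf_wkbCoeff (N + 1) W
  set E := (1 + 2 * W) * C * W with hE
  have hE0 : 0 ≤ E := by positivity
  refine ⟨2 * B * E, min (min h₁ h₂) (1 / (E + 1)), by positivity, by positivity,
    fun h hh c hc => ?_⟩
  have hh0 := hh.1
  have hh1 : h ∈ Ioo 0 h₁ :=
    ⟨hh.1, hh.2.trans_le ((min_le_left _ _).trans (min_le_left _ _))⟩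
  have hh2 : h ∈ Ioo 0 h₂ :=
    ⟨hh.1, hh.2.trans_le ((min_le_left _ _).trans (min_le_right _ _))⟩
  have hh3 : h < 1 / (E + 1) := hh.2.trans_le (min_le_right _ _)
  have hhle : h ≤ 1 := hh1.2.le.trans h₁1
  -- The logarithmic difference vanishes at `c = 0`, and its derivative is `h⁻¹` times the ratio
  -- error, hence `O(h^(N+1))`.
  set G : ℝ → ℝ := fun c => Real.log (besselFactor h⁻¹ c) - Real.log (wkbSum (N + 1) h c)
  have hG : ∀ b ∈ Icc 0 W, HasDerivAt G
      (h⁻¹ * (1 + 2 * b) * (besselRatio h⁻¹ b - ratioApprox (N + 1) h b)) b := by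
    intro b hb
    have hb0 := hb.1
    have hS := h₁w h hh1 b hb
    have h3 := (hasDerivAt_log_besselFactor (inv_pos.2 hh0) hb.1).sub
      ((hasDerivAt_wkbSum (N + 1) h (by linarith)).log (by linarith))
    refine h3.congr_deriv ?_
    rw [ratioApprox]
    have h4 : (1 + 2 * b) ≠ 0 := by positivity
    have h5 : wkbSum (N + 1) h b ≠ 0 := by linarith
    field_simp
    ring
  have hG0 : G 0 = 0 := by
    simp only [G, besselFactor_zero (inv_pos.2 hh0), wkbSum_succ_zero, sub_self]
  have hGc : |G c| ≤ E * h ^ (N + 1) := by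
    have h3 := (convex_Icc 0 W).norm_image_sub_le_of_norm_hasDerivWithin_le
      (C := (1 + 2 * W) * C * h ^ (N + 1))
      (fun b hb => (hG b hb).hasDerivWithinAt) (fun b hb => ?_)
      (⟨le_rfl, hW⟩ : (0 : ℝ) ∈ Icc 0 W) hc
    · rw [hG0, sub_zero, sub_zero, Real.norm_eq_abs, Real.norm_eq_abs, abs_of_nonneg hc.1] at h3
      refine h3.trans ?_
      rw [hE]
      have : 0 ≤ (1 + 2 * W) * C * h ^ (N + 1) := by positivity
      nlinarith [hc.2]
    · have h4 := h₂w h hh2 b hb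
      have hb0 := hb.1
      rw [Real.norm_eq_abs, abs_mul, abs_of_pos (by positivity : 0 < h⁻¹ * (1 + 2 * b))]
      calc h⁻¹ * (1 + 2 * b) * |besselRatio h⁻¹ b - ratioApprox (N + 1) h b|
          ≤ h⁻¹ * (1 + 2 * W) * (C * h ^ (N + 2)) := by
            gcongr
            exact hb.2
        _ = (1 + 2 * W) * C * h ^ (N + 1) := by
            rw [pow_succ h (N + 1)]
            field_simp
  -- Needed to linearize `exp (G c) - 1`; the bound `1/(E+1)` on `h` was chosen for this.
  have hG1 : |G c| ≤ 1 := by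
    refine hGc.trans ?_
    rw [lt_div_iff₀ (by positivity)] at hh3
    have : h ^ (N + 1) ≤ h := pow_le_of_le_one hh0.le hhle (by simp)
    nlinarith
  have hS := h₁w h hh1 c hc
  have hF := besselFactor_pos (inv_pos.2 hh0) hc.1
  have h6 : besselFactor h⁻¹ c = wkbSum (N + 1) h c * Real.exp (G c) := by
    simp only [G]
    rw [Real.exp_sub, Real.exp_log hF, Real.exp_log (by linarith)]
    field_simp
  rw [h6, show wkbSum (N + 1) h c * Real.exp (G c) - wkbSum (N + 1) h c =
    wkbSum (N + 1) h c * (Real.exp (G c) - 1) by ring, abs_mul]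
  have h7 := Real.abs_exp_sub_one_le hG1
  have h8 : |wkbSum (N + 1) h c| ≤ B := hB h ⟨hh0.le, hhle⟩ c hc
  calc |wkbSum (N + 1) h c| * |Real.exp (G c) - 1| ≤ B * (2 * (E * h ^ (N + 1))) := by
        gcongr
        exact h7.trans (by gcongr)
    _ = 2 * B * E * h ^ (N + 1) := by ring

/-! ### The coefficients of the uniform expansion of the Marcum function -/

theorem contDiffAt_derivSnd {f : ℝ × ℝ → ℝ} {u : ℝ × ℝ} (hf : ContDiffAt ℝ (⊤ : ℕ∞) f u) :
    ContDiffAt ℝ (⊤ : ℕ∞) (derivSnd f) u := by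
  have h1 : ContDiffAt ℝ (⊤ : ℕ∞) (fun v => fderiv ℝ f v ((0 : ℝ), (1 : ℝ))) u :=
    (hf.fderiv_right (m := (⊤ : ℕ∞)) le_rfl).clm_apply contDiffAt_const
  refine h1.congr_of_eventuallyEq ?_
  have h2 : ContDiffAt ℝ 1 f u := hf.of_le (by exact_mod_cast le_top)
  filter_upwards [h2.eventually (by simp)] with v hv
  have h3 := (hv.differentiableAt (by simp)).hasFDerivAt
  have h4 : HasDerivAt (fun a : ℝ => ((v.1, a) : ℝ × ℝ)) ((0 : ℝ), (1 : ℝ)) v.2 :=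
    (hasDerivAt_const _ _).prodMk (hasDerivAt_id _)
  exact (HasFDerivAt.comp_hasDerivAt v.2 (f := fun a : ℝ => ((v.1, a) : ℝ × ℝ)) h3 h4).deriv

theorem hasDerivAt_derivSnd {f : ℝ × ℝ → ℝ} {u : ℝ × ℝ} (hf : ContDiffAt ℝ (⊤ : ℕ∞) f u) :
    HasDerivAt (fun a => f (u.1, a)) (derivSnd f u) u.2 := by
  have h3 := (hf.differentiableAt (by simp)).hasFDerivAt
  have h4 : HasDerivAt (fun a : ℝ => ((u.1, a) : ℝ × ℝ)) ((0 : ℝ), (1 : ℝ)) u.2 :=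
    (hasDerivAt_const _ _).prodMk (hasDerivAt_id _)
  exact (HasFDerivAt.comp_hasDerivAt u.2 (f := fun a : ℝ => ((u.1, a) : ℝ × ℝ)) h3
    h4).differentiableAt.hasDerivAt

/-- The Hadamard quotient at `a = 1` in the second variable. -/
noncomputable def quotAtOne (f : ℝ × ℝ → ℝ) (u : ℝ × ℝ) : ℝ :=
  dquot (fun q : ℝ × ℝ => f (q.1, 1 + q.2)) (u.1, u.2 - 1)

theorem eq_add_mul_quotAtOne (f : ℝ × ℝ → ℝ) (u : ℝ × ℝ) :
    f u = f (u.1, 1) + (u.2 - 1) * quotAtOne f u := by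
  have := dquot_mul (fun q : ℝ × ℝ => f (q.1, 1 + q.2)) (u.1, u.2 - 1)
  simpa [quotAtOne] using this

theorem contDiffAt_quotAtOne {f : ℝ × ℝ → ℝ} {u : ℝ × ℝ}
    (h1 : ContDiffAt ℝ (⊤ : ℕ∞) f (u.1, 1)) (hf : ContDiffAt ℝ (⊤ : ℕ∞) f u) :
    ContDiffAt ℝ (⊤ : ℕ∞) (quotAtOne f) u := by
  have hs : ContDiff ℝ (⊤ : ℕ∞) fun q : ℝ × ℝ => ((q.1, 1 + q.2) : ℝ × ℝ) := by fun_prop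
  have ht : ContDiff ℝ (⊤ : ℕ∞) fun q : ℝ × ℝ => ((q.1, q.2 - 1) : ℝ × ℝ) := by fun_prop
  refine ContDiffAt.comp u (contDiffAt_infty_dquot ?_ ?_) ht.contDiffAt
  · exact ContDiffAt.comp _ (by simpa using h1) hs.contDiffAt
  · exact ContDiffAt.comp _ (by simpa using hf) hs.contDiffAt

theorem quotAtOne_one {f : ℝ × ℝ → ℝ} (x : ℝ) : quotAtOne f (x, 1) = derivSnd f (x, 1) := by
  have : deriv (fun s => f (x, 1 + s)) 0 = deriv (fun a => f (x, a)) (1 + 0) :=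
    deriv_comp_const_add (fun a => f (x, a)) 1 0
  simp only [quotAtOne, dquot, derivSnd, sub_self, if_true]
  rw [this, add_zero]

/-- The coefficients of the amplitude. -/
noncomputable def ampCoeff (k : ℕ) (u : ℝ × ℝ) : ℝ :=
  (1 + 2 * (u.1 * u.2)) / (u.2 * (1 + u.1 * u.2)) * wkbCoeff k (u.1 * u.2)

/-- The constant that makes a source term divisible by the derivative of the phase. -/
noncomputable def constPart (G : ℝ × ℝ → ℝ) (u : ℝ × ℝ) : ℝ :=
  G (u.1, 1) / derivSnd zetaParam (u.1, 1)

/-- The quotient of the regularized source term by the derivative of the phase. -/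
noncomputable def phaseQuot (G : ℝ × ℝ → ℝ) (u : ℝ × ℝ) : ℝ :=
  quotAtOne (fun u => G u - constPart G u * derivSnd zetaParam u) u / (2 * u.1 + u.2⁻¹)

/-- The source terms of the recursion. -/
noncomputable def sourceTerm : ℕ → ℝ × ℝ → ℝ
  | 0 => ampCoeff 0
  | k + 1 => fun u => ampCoeff (k + 1) u + derivSnd (phaseQuot (sourceTerm k)) u

theorem contDiffAt_ampCoeff (k : ℕ) {u : ℝ × ℝ} (hu : u ∈ paramDomain) :
    ContDiffAt ℝ (⊤ : ℕ∞) (ampCoeff k) u := by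
  have h1 : 0 < 1 + u.1 * u.2 := by nlinarith [hu.2.1]
  have h2 : ContDiff ℝ (⊤ : ℕ∞) fun u : ℝ × ℝ => u.1 * u.2 := by fun_prop
  have h3 : ContDiff ℝ (⊤ : ℕ∞) fun u : ℝ × ℝ => 1 + 2 * (u.1 * u.2) := by fun_prop
  have h4 : ContDiff ℝ (⊤ : ℕ∞) fun u : ℝ × ℝ => u.2 * (1 + u.1 * u.2) := by fun_prop
  refine (h3.contDiffAt.div h4.contDiffAt (mul_pos hu.1 h1).ne').mul ?_
  exact ContDiffAt.comp u (smoothHalf_wkbCoeff k (u.1 * u.2) (by nlinarith [hu.2.1])) h2.contDiffAt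

theorem contDiffAt_constPart {G : ℝ × ℝ → ℝ}
    (hG : ∀ u ∈ paramDomain, ContDiffAt ℝ (⊤ : ℕ∞) G u) {u : ℝ × ℝ} (hu : u ∈ paramDomain) :
    ContDiffAt ℝ (⊤ : ℕ∞) (constPart G) u := by
  have h1 := one_mem_paramDomain hu
  have hs : ContDiff ℝ (⊤ : ℕ∞) fun u : ℝ × ℝ => ((u.1, 1) : ℝ × ℝ) := by fun_prop
  exact (ContDiffAt.comp u (f := fun u : ℝ × ℝ => ((u.1, 1) : ℝ × ℝ)) (hG _ h1)
    hs.contDiffAt).div (ContDiffAt.comp u (f := fun u : ℝ × ℝ => ((u.1, 1) : ℝ × ℝ))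
      (contDiffAt_derivSnd (contDiffAt_zetaParam h1)) hs.contDiffAt)
    (derivSnd_zetaParam_pos h1).ne'

theorem contDiffAt_phaseQuot {G : ℝ × ℝ → ℝ}
    (hG : ∀ u ∈ paramDomain, ContDiffAt ℝ (⊤ : ℕ∞) G u) {u : ℝ × ℝ} (hu : u ∈ paramDomain) :
    ContDiffAt ℝ (⊤ : ℕ∞) (phaseQuot G) u := by
  have key : ∀ u ∈ paramDomain, ContDiffAt ℝ (⊤ : ℕ∞)
      (fun u => G u - constPart G u * derivSnd zetaParam u) u := fun u hu =>
    (hG u hu).sub ((contDiffAt_constPart hG hu).mul (contDiffAt_derivSnd (contDiffAt_zetaParam hu)))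
  refine (contDiffAt_quotAtOne (key _ (one_mem_paramDomain hu)) (key _ hu)).div ?_
    (two_mul_add_inv_pos hu).ne'
  exact (by fun_prop : ContDiffAt ℝ (⊤ : ℕ∞) (fun u : ℝ × ℝ => 2 * u.1) u).add
    (contDiffAt_snd.inv hu.1.ne')

theorem contDiffAt_sourceTerm (k : ℕ) :
    ∀ u ∈ paramDomain, ContDiffAt ℝ (⊤ : ℕ∞) (sourceTerm k) u := by
  induction k with
  | zero => exact fun u hu => contDiffAt_ampCoeff 0 hu
  | succ k ih => exact fun u hu =>
      (contDiffAt_ampCoeff (k + 1) hu).add (contDiffAt_derivSnd (contDiffAt_phaseQuot ih hu))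

/-- `constPart` makes the regularized source vanish at `a = 1`, the only zero of the phase
derivative `(a-1)(2x + 1/a)`, so the division is smooth. -/
theorem phase_deriv_mul_phaseQuot (G : ℝ × ℝ → ℝ) {u : ℝ × ℝ} (hu : u ∈ paramDomain) :
    (u.2 - 1) * (2 * u.1 + u.2⁻¹) * phaseQuot G u = G u - constPart G u * derivSnd zetaParam u := by
  have h1 := eq_add_mul_quotAtOne (fun u => G u - constPart G u * derivSnd zetaParam u) u
  have h2 : G (u.1, 1) - constPart G (u.1, 1) * derivSnd zetaParam (u.1, 1) = 0 := by
    rw [constPart, div_mul_cancel₀ _ (derivSnd_zetaParam_pos (one_mem_paramDomain hu)).ne', sub_self]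
  simp only [h2, zero_add] at h1
  rw [h1, phaseQuot]
  rw [mul_assoc, mul_div_assoc', mul_div_cancel_left₀ _ (two_mul_add_inv_pos hu).ne']

theorem zetaParam_mul_derivSnd {u : ℝ × ℝ} (hu : u ∈ paramDomain) :
    zetaParam u * derivSnd zetaParam u = (u.2 - 1) * (2 * u.1 + u.2⁻¹) := by
  rw [derivSnd_zetaParam hu, zetaParam]
  have := (Real.sqrt_pos.2 hu.2.2.1).ne'
  field_simp

theorem derivSnd_zetaParam_one {x : ℝ} (hx : 0 < 1 + 2 * x) :
    derivSnd zetaParam (x, 1) = √(1 + 2 * x) := by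
  have hmem : ((x, 1) : ℝ × ℝ) ∈ paramDomain := by
    refine ⟨one_pos, ?_, ?_, hx⟩ <;> simp [logQuot_one] <;> linarith
  rw [derivSnd_zetaParam hmem]
  simp only [logQuot_one, inv_one]
  rw [add_comm, Real.div_sqrt]

theorem ampCoeff_zero (u : ℝ × ℝ) (hu : u ∈ paramDomain) :
    ampCoeff 0 u = √(1 + 2 * (u.1 * u.2)) / u.2 := by
  have h1 : 0 < 1 + u.1 * u.2 := by nlinarith [hu.2.1]
  have h2 : 0 < 1 + 2 * (u.1 * u.2) := by nlinarith [hu.2.1]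
  have h3 := Real.sqrt_pos.2 h2
  have h4 := Real.mul_self_sqrt h2.le
  have h5 := hu.1
  simp only [ampCoeff, wkbCoeff]
  generalize √(1 + 2 * (u.1 * u.2)) = r at *
  rw [← h4]
  field_simp
  rw [mul_comm u.2 u.1]
  exact div_self h1.ne'

theorem constPart_sourceTerm_zero {u : ℝ × ℝ} (hu : u ∈ paramDomain) :
    constPart (sourceTerm 0) u = 1 := by
  rw [constPart, sourceTerm, ampCoeff_zero _ (one_mem_paramDomain hu),
    derivSnd_zetaParam_one hu.2.2.2]
  simp only [mul_one, div_one]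
  exact div_self (Real.sqrt_pos.2 hu.2.2.2).ne'

/-- The leading amplitude is `f ζ_a`, so the quotient is `(f - 1)/ζ = -d₀`. -/
theorem phaseQuot_sourceTerm_zero {x a : ℝ} (hx : 0 ≤ x) (ha : 0 < a) (h1 : a ≠ 1) :
    phaseQuot (sourceTerm 0) (x, a) =
      (√(2 * x + logQuot a) / √(1 + 2 * x * a) - 1) / zetaParam (x, a) := by
  have hu := mem_paramDomain hx ha
  have h2 := phase_deriv_mul_phaseQuot (sourceTerm 0) hu
  rw [constPart_sourceTerm_zero hu, one_mul, sourceTerm, ampCoeff_zero _ hu,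
    ← zetaParam_mul_derivSnd hu] at h2
  have h3 := derivSnd_zetaParam_pos hu
  have hz := zetaParam_ne_zero hx ha h1
  have h4 : √(1 + 2 * (x * a)) / a =
      √(2 * x + logQuot a) / √(1 + 2 * x * a) * derivSnd zetaParam (x, a) := by
    rw [derivSnd_zetaParam hu]
    have h5 := Real.sqrt_pos.2 hu.2.2.1
    have h6 := Real.sqrt_pos.2 hu.2.1
    have h7 := Real.mul_self_sqrt hu.2.1.le
    simp only at h5 h6 h7 ⊢
    rw [← mul_assoc 2 x a]
    generalize √(1 + 2 * x * a) = r at *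
    generalize √(2 * x + logQuot a) = s at *
    field_simp
    linear_combination h7
  simp only at h2
  rw [h4] at h2
  rw [eq_div_iff hz]
  refine mul_right_cancel₀ h3.ne' ?_
  rw [sourceTerm]
  linear_combination h2

/-- At `a = 1` the Hadamard quotient is a derivative, computed from `logQuot 1 = 1` and `logQuot' 1
= -2/3`. This produces the limiting value of `ζ₁`. -/
theorem phaseQuot_sourceTerm_zero_one {x : ℝ} (hx : 0 ≤ x) :
    phaseQuot (sourceTerm 0) (x, 1) = -(3 * x + 1) / (3 * (2 * x + 1) ^ (3 / 2 : ℝ)) := by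
  have hu := mem_paramDomain hx one_pos
  have hs : 0 < 2 * x + 1 := by positivity
  have hr := Real.sqrt_pos.2 hs
  have hr2 := Real.mul_self_sqrt hs.le
  have h1 : HasDerivAt (fun a => ampCoeff 0 (x, a) - constPart (sourceTerm 0) (x, a) *
      derivSnd zetaParam (x, a)) (-(3 * x + 1) / (3 * √(2 * x + 1))) 1 := by
    have h2 : HasDerivAt (fun a : ℝ => √(1 + 2 * (x * a)) / a -
        (2 * x + a⁻¹) / √(2 * x + logQuot a)) (-(3 * x + 1) / (3 * √(2 * x + 1))) 1 := by
      have e1 : HasDerivAt (fun a : ℝ => 1 + 2 * (x * a)) (2 * x) 1 := by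
        simpa using (((hasDerivAt_id (1 : ℝ)).const_mul x).const_mul 2).const_add 1
      have e2 := (e1.sqrt (by simp; linarith)).div (hasDerivAt_id (1 : ℝ)) one_ne_zero
      have e3 := (hasDerivAt_inv (one_ne_zero (α := ℝ))).const_add (2 * x)
      have e4 := ((hasDerivAt_logQuot one_pos).const_add (2 * x)).sqrt (by rw [logQuot_one]; linarith)
      have e5 := e2.sub (e3.div e4 (by rw [logQuot_one]; exact hr.ne'))
      refine e5.congr_deriv ?_
      simp only [id, logQuot_one, deriv_logQuot_one, mul_one, inv_one, one_pow, div_one,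
        add_comm (1 : ℝ) (2 * x)]
      generalize √(2 * x + 1) = r at *
      have h3 : x = (r * r - 1) / 2 := by linarith
      subst h3
      field_simp
      ring
    refine h2.congr_of_eventuallyEq ?_
    filter_upwards [Ioi_mem_nhds (one_pos (α := ℝ))] with a ha
    have hu := mem_paramDomain hx ha
    rw [constPart_sourceTerm_zero hu, ampCoeff_zero _ hu, derivSnd_zetaParam hu, one_mul]
  have h3 : (2 * x + 1) ^ (3 / 2 : ℝ) = (2 * x + 1) * √(2 * x + 1) := by
    rw [show (3 / 2 : ℝ) = 1 + 1 / 2 by norm_num, Real.rpow_add hs, Real.rpow_one, Real.sqrt_eq_rpow]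
  rw [phaseQuot, quotAtOne_one, h3]
  simp only [inv_one]
  rw [show derivSnd (fun u => sourceTerm 0 u - constPart (sourceTerm 0) u * derivSnd zetaParam u)
    (x, 1) = -(3 * x + 1) / (3 * √(2 * x + 1)) from h1.deriv, div_div]
  congr 1
  ring

/-- Leading-order equation: `(exp (ζη) - 1)/ζ = (f - 1)/ζ` holds for `η = log f / ζ`. On the
transition line the tilted integral is `η` itself. -/
theorem tiltInt_marcumZeta1 {x a : ℝ} (hx : 0 ≤ x) (ha : 0 < a) :
    tiltInt (zetaParam (x, a)) 0 (marcumZeta1 x (a + x * a ^ 2)) =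
      phaseQuot (sourceTerm 0) (x, a) := by
  have hu := mem_paramDomain hx ha
  rcases eq_or_ne a 1 with rfl | h1
  · have h0 : zetaParam (x, 1) = 0 := by simp [zetaParam]
    rw [phaseQuot_sourceTerm_zero_one hx, h0, tiltInt_zero_left, marcumZeta1, if_pos (by ring)]
  · have hz := zetaParam_ne_zero hx ha h1
    rw [phaseQuot_sourceTerm_zero hx ha h1, eq_div_iff hz, mul_comm, mul_tiltInt_zero,
      marcumZeta1_param hx ha h1, mul_div_cancel₀ _ hz, Real.exp_log]
    exact div_pos (Real.sqrt_pos.2 hu.2.2.1) (Real.sqrt_pos.2 hu.2.1)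

/-! ### The exact amplitude and the derivative of the truncated expansion. -/

/-- The normalized quotient of the Gamma function by Stirling's approximation. -/
noncomputable def gammaFactor (μ : ℝ) : ℝ :=
  Real.Gamma μ * √(μ / (2 * Real.pi)) * μ ^ (-μ) * Real.exp μ

/-- The Marcum function in the coordinates `(x, a)`. -/
noncomputable def marcumParam (μ : ℝ) (u : ℝ × ℝ) : ℝ :=
  marcumQ μ (μ * u.1) (μ * (u.2 + u.1 * u.2 ^ 2))

/-- The exact amplitude. -/
noncomputable def ampExact (μ : ℝ) (u : ℝ × ℝ) : ℝ :=
  (1 + 2 * (u.1 * u.2)) / (u.2 * (1 + u.1 * u.2)) * besselFactor μ (u.1 * u.2)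

theorem gammaFactor_pos {μ : ℝ} (hμ : 0 < μ) : 0 < gammaFactor μ := by
  have := Real.Gamma_pos_of_pos hμ
  have := Real.pi_pos
  rw [gammaFactor]
  positivity

/-- With `c = xa` the Bessel argument is `μ² c (1+c)`. Once all powers are exponentials, the
exponent splits into `-μ` times the phase and the exponent inside `besselFactor`. -/
theorem gammaFactor_mul_marcumDensity {μ x a : ℝ} (hμ : 0 < μ) (hx : 0 ≤ x) (ha : 0 < a) :
    gammaFactor μ * (marcumDensity μ (μ * x) (μ * (a + x * a ^ 2)) *
      (μ * (1 + 2 * (x * a)))) =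
      √(μ / (2 * Real.pi)) * Real.exp (-(μ * marcumPhase x a)) * ampExact μ (x, a) := by
  have h1 : 0 < 1 + x * a := by positivity
  have e1 : μ * (a + x * a ^ 2) = Real.exp (Real.log μ + Real.log a + Real.log (1 + x * a)) := by
    rw [Real.exp_add, Real.exp_add, Real.exp_log hμ, Real.exp_log ha, Real.exp_log h1]
    ring
  have e2 : (μ * (a + x * a ^ 2)) ^ (μ - 1) =
      Real.exp (μ * (Real.log μ + Real.log a + Real.log (1 + x * a))) / (μ * (a + x * a ^ 2)) := by
    rw [Real.rpow_sub_one (by positivity)]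
    congr 1
    rw [e1, ← Real.exp_mul, mul_comm]
  have e3 : μ ^ (-μ) = Real.exp (-(μ * Real.log μ)) := by
    rw [Real.rpow_def_of_pos hμ]
    congr 1
    ring
  have e4 : μ * x * (μ * (a + x * a ^ 2)) = μ ^ 2 * (x * a * (1 + x * a)) := by ring
  have e5 : Real.exp (-(μ * Real.log μ)) * Real.exp μ *
      (Real.exp (μ * (Real.log μ + Real.log a + Real.log (1 + x * a))) *
        Real.exp (-(μ * (a + x * a ^ 2)) - μ * x)) =
      Real.exp (-(μ * marcumPhase x a)) * Real.exp (-(μ * (2 * (x * a) - Real.log (1 + x * a)))) := by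
    simp only [← Real.exp_add]
    congr 1
    rw [marcumPhase]
    ring
  simp only [gammaFactor, marcumDensity, ampExact, besselFactor, e2, e3, e4]
  set g := besselSeries μ (μ ^ 2 * (x * a * (1 + x * a)))
  calc _ = (Real.exp (-(μ * Real.log μ)) * Real.exp μ *
      (Real.exp (μ * (Real.log μ + Real.log a + Real.log (1 + x * a))) *
        Real.exp (-(μ * (a + x * a ^ 2)) - μ * x))) *
      (Real.Gamma μ * √(μ / (2 * Real.pi)) * g * (μ * (1 + 2 * (x * a))) /
        (μ * (a + x * a ^ 2))) := by ring
    _ = _ := by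
      rw [e5, show μ * (a + x * a ^ 2) = μ * (a * (1 + x * a)) by ring,
        mul_div_assoc, mul_div_mul_left _ _ hμ.ne']
      ring

theorem hasDerivAt_marcumParam {μ x a : ℝ} (hμ : 0 < μ) (hx : 0 ≤ x) (ha : 0 < a) :
    HasDerivAt (fun a => gammaFactor μ * marcumParam μ (x, a))
      (-(√(μ / (2 * Real.pi)) * Real.exp (-(μ * marcumPhase x a)) * ampExact μ (x, a))) a := by
  have h1 : HasDerivAt (fun a : ℝ => μ * (a + x * a ^ 2)) (μ * (1 + 2 * (x * a))) a := by
    refine (((hasDerivAt_id a).add (((hasDerivAt_id a).pow 2).const_mul x)).const_mul μ).congr_deriv ?_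
    simp only [id, show 2 - 1 = 1 from rfl]
    push_cast
    ring
  have h2 := HasDerivAt.comp a (hasDerivAt_marcumQ hμ (by positivity : 0 ≤ μ * x)
    (by positivity : 0 < μ * (a + x * a ^ 2))) h1
  refine (h2.const_mul (gammaFactor μ)).congr_deriv ?_
  rw [← gammaFactor_mul_marcumDensity hμ hx ha]
  ring

/-- The truncated expansion of `gammaFactor`. -/
noncomputable def constSum (n : ℕ) (h x : ℝ) : ℝ :=
  ∑ k ∈ Finset.range n, h ^ k * constPart (sourceTerm k) (x, 1)

/-- The truncated expansion of the remainder. -/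
noncomputable def remSum (n : ℕ) (h : ℝ) (u : ℝ × ℝ) : ℝ :=
  ∑ k ∈ Finset.range n, h ^ k * phaseQuot (sourceTerm k) u

/-- Summation of the recursion: the derivative terms reappear one order higher, apart from the last
one. -/
theorem sum_sourceTerm (n : ℕ) (h : ℝ) (u : ℝ × ℝ) :
    ∑ k ∈ Finset.range (n + 1), h ^ k * sourceTerm k u =
      ∑ k ∈ Finset.range (n + 1), h ^ k * ampCoeff k u +
      h * ∑ k ∈ Finset.range (n + 1), h ^ k * derivSnd (phaseQuot (sourceTerm k)) u -
      h ^ (n + 1) * derivSnd (phaseQuot (sourceTerm n)) u := by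
  induction n with
  | zero => simp [sourceTerm]
  | succ n ih =>
    rw [Finset.sum_range_succ, ih, Finset.sum_range_succ (fun k => h ^ k * ampCoeff k u) (n + 1),
      Finset.sum_range_succ (fun k => h ^ k * derivSnd (phaseQuot (sourceTerm k)) u) (n + 1)]
    rw [show sourceTerm (n + 1) u =
      ampCoeff (n + 1) u + derivSnd (phaseQuot (sourceTerm n)) u from rfl]
    ring

theorem sum_phaseQuot (n : ℕ) (h : ℝ) {u : ℝ × ℝ} (hu : u ∈ paramDomain) :
    zetaParam u * derivSnd zetaParam u * remSum n h u =
      ∑ k ∈ Finset.range n, h ^ k * sourceTerm k u - constSum n h u.1 * derivSnd zetaParam u := by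
  rw [remSum, constSum, Finset.mul_sum, Finset.sum_mul, ← Finset.sum_sub_distrib]
  refine Finset.sum_congr rfl fun k _ => ?_
  have h1 := phase_deriv_mul_phaseQuot (sourceTerm k) hu
  rw [← zetaParam_mul_derivSnd hu] at h1
  rw [show constPart (sourceTerm k) (u.1, 1) = constPart (sourceTerm k) u from rfl]
  linear_combination h ^ k * h1

/-- The truncated uniform expansion of the Marcum function. -/
noncomputable def marcumTrunc (n : ℕ) (μ : ℝ) (u : ℝ × ℝ) : ℝ :=
  constSum n μ⁻¹ u.1 * (1 / 2 * erfc (zetaParam u * √(μ / 2))) +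
    Real.exp (-(μ * (zetaParam u ^ 2 / 2))) * remSum n μ⁻¹ u / √(2 * Real.pi * μ)

/-- The recursion is integration by parts read backwards: the `erfc` term contributes `σ ζ_a`, the
remainder contributes `ζ ζ_a R - R'/μ`, and together they restore the amplitude except for one
uncompensated derivative of order `n + 1`. -/
theorem hasDerivAt_marcumTrunc (n : ℕ) {μ x a : ℝ} (hμ : 0 < μ) (hx : 0 ≤ x) (ha : 0 < a) :
    HasDerivAt (fun a => marcumTrunc (n + 1) μ (x, a))
      (-(√(μ / (2 * Real.pi)) * Real.exp (-(μ * marcumPhase x a)) *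
        (∑ k ∈ Finset.range (n + 1), μ⁻¹ ^ k * ampCoeff k (x, a) -
          μ⁻¹ ^ (n + 1) * derivSnd (phaseQuot (sourceTerm n)) (x, a)))) a := by
  have hu := mem_paramDomain hx ha
  have hπ := Real.pi_pos
  have hZ : HasDerivAt (fun a => zetaParam (x, a)) (derivSnd zetaParam (x, a)) a :=
    hasDerivAt_derivSnd (contDiffAt_zetaParam hu)
  have hR : HasDerivAt (fun a => remSum (n + 1) μ⁻¹ (x, a))
      (∑ k ∈ Finset.range (n + 1), μ⁻¹ ^ k * derivSnd (phaseQuot (sourceTerm k)) (x, a)) a :=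
    HasDerivAt.fun_sum fun k _ => (hasDerivAt_derivSnd
      (contDiffAt_phaseQuot (contDiffAt_sourceTerm k) hu)).const_mul _
  have h1 := ((HasDerivAt.comp a (hasDerivAt_erfc _) (hZ.mul_const √(μ / 2))).const_mul
    (1 / 2)).const_mul (constSum (n + 1) μ⁻¹ x)
  have h2 : HasDerivAt (fun a => Real.exp (-(μ * (zetaParam (x, a) ^ 2 / 2))))
      (Real.exp (-(μ * (zetaParam (x, a) ^ 2 / 2))) *
        (-(μ * (zetaParam (x, a) * derivSnd zetaParam (x, a))))) a := by
    refine (((hZ.pow 2).div_const 2).const_mul μ).neg.exp.congr_deriv ?_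
    simp only [show 2 - 1 = 1 from rfl, Pi.neg_apply, Pi.pow_apply]
    push_cast
    ring
  have h3 := h1.add ((h2.mul hR).div_const √(2 * Real.pi * μ))
  refine h3.congr_deriv ?_
  have e1 : (zetaParam (x, a) * √(μ / 2)) ^ 2 = μ * (zetaParam (x, a) ^ 2 / 2) := by
    rw [mul_pow, Real.sq_sqrt (by positivity)]
    ring
  have e2 : √(μ / (2 * Real.pi)) = μ / √(2 * Real.pi * μ) := by
    rw [Real.sqrt_eq_iff_mul_self_eq (by positivity) (by positivity), div_mul_div_comm,
      Real.mul_self_sqrt (by positivity)]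
    field_simp
  have e3 : 1 / 2 * (2 / √Real.pi) * √(μ / 2) = μ / √(2 * Real.pi * μ) := by
    rw [← e2, Real.sqrt_div hμ.le, Real.sqrt_div hμ.le, Real.sqrt_mul (by norm_num) Real.pi]
    field_simp
  have h4 := sum_phaseQuot (n + 1) μ⁻¹ hu
  have h5 := sum_sourceTerm n μ⁻¹ (x, a)
  rw [← zetaParam_sq hx ha, e2]
  simp only [e1]
  rw [h5] at h4
  simp only at h4
  set E := Real.exp (-(μ * (zetaParam (x, a) ^ 2 / 2)))
  set Z' := derivSnd zetaParam (x, a)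
  set A := ∑ k ∈ Finset.range (n + 1), μ⁻¹ ^ k * ampCoeff k (x, a)
  set R' := ∑ k ∈ Finset.range (n + 1), μ⁻¹ ^ k * derivSnd (phaseQuot (sourceTerm k)) (x, a)
  set R := remSum (n + 1) μ⁻¹ (x, a)
  set σ := constSum (n + 1) μ⁻¹ x
  set d := derivSnd (phaseQuot (sourceTerm n)) (x, a)
  have hs : 0 < √(2 * Real.pi * μ) := by positivity
  have e4 : σ * (1 / 2 * (-(2 / √Real.pi * E) * (Z' * √(μ / 2)))) =
      -(σ * E * Z' * (μ / √(2 * Real.pi * μ))) := by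
    rw [← e3]
    ring
  rw [e4]
  have e5 : μ * μ⁻¹ = 1 := mul_inv_cancel₀ hμ.ne'
  generalize √(2 * Real.pi * μ) = s at *
  generalize μ⁻¹ ^ (n + 1) = p at *
  generalize μ⁻¹ = h at *
  field_simp
  linear_combination (-(E * μ)) * h4 - E * R' * e5

/-! ### The uniform asymptotic expansion of the Marcum function -/

theorem marcumPhase_monotone {x a b : ℝ} (hx : 0 ≤ x) (ha : 1 ≤ a) (hab : a ≤ b) :
    marcumPhase x a ≤ marcumPhase x b := by
  rw [← zetaParam_sq hx (by linarith), ← zetaParam_sq hx (by linarith)]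
  have h1 := (zetaParam_strictMonoOn hx).monotoneOn (mem_Ioi.2 (by linarith : 0 < a))
    (mem_Ioi.2 (by linarith : 0 < b)) hab
  have h2 : 0 ≤ zetaParam (x, a) := zetaParam_nonneg ha
  gcongr

theorem marcumPhase_antitone {x a b : ℝ} (hx : 0 ≤ x) (ha : 0 < a) (hab : a ≤ b) (hb : b ≤ 1) :
    marcumPhase x b ≤ marcumPhase x a := by
  rw [← zetaParam_sq hx (by linarith), ← zetaParam_sq hx ha]
  have h1 := (zetaParam_strictMonoOn hx).monotoneOn (mem_Ioi.2 ha)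
    (mem_Ioi.2 (by linarith : 0 < b)) hab
  have h2 : zetaParam (x, b) ≤ 0 := zetaParam_nonpos hb
  have h3 : zetaParam (x, b) ^ 2 ≤ zetaParam (x, a) ^ 2 := by nlinarith
  linarith

theorem marcumPhase_nonneg {x a : ℝ} (hx : 0 ≤ x) (ha : 0 < a) : 0 ≤ marcumPhase x a := by
  rw [← zetaParam_sq hx ha]
  positivity

theorem half_erfc_zetaParam_le {μ x a : ℝ} (hμ : 0 < μ) (hx : 0 ≤ x) (ha : 1 ≤ a) :
    1 / 2 * erfc (zetaParam (x, a) * √(μ / 2)) ≤ Real.exp (-(μ * marcumPhase x a)) := by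
  have h0 : 0 ≤ zetaParam (x, a) * √(μ / 2) :=
    mul_nonneg (zetaParam_nonneg (u := (x, a)) ha) (Real.sqrt_nonneg _)
  have h1 := erfc_le_exp h0
  have h2 := erfc_pos (zetaParam (x, a) * √(μ / 2))
  rw [mul_pow, Real.sq_sqrt (by positivity), show -(zetaParam (x, a) ^ 2 * (μ / 2)) =
    -(μ * (zetaParam (x, a) ^ 2 / 2)) by ring, zetaParam_sq hx (by linarith)] at h1
  linarith

theorem one_sub_half_erfc_zetaParam_le {μ x a : ℝ} (hμ : 0 < μ) (hx : 0 ≤ x) (ha : 0 < a)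
    (ha1 : a ≤ 1) :
    1 - 1 / 2 * erfc (zetaParam (x, a) * √(μ / 2)) ≤ Real.exp (-(μ * marcumPhase x a)) := by
  have h0 : 0 ≤ -(zetaParam (x, a) * √(μ / 2)) := neg_nonneg.2
    (mul_nonpos_of_nonpos_of_nonneg (zetaParam_nonpos (u := (x, a)) ha1) (Real.sqrt_nonneg _))
  have h1 := erfc_le_exp h0
  have h2 := erfc_pos (-(zetaParam (x, a) * √(μ / 2)))
  rw [neg_sq, mul_pow, Real.sq_sqrt (by positivity), show -(zetaParam (x, a) ^ 2 * (μ / 2)) =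
    -(μ * (zetaParam (x, a) ^ 2 / 2)) by ring, zetaParam_sq hx (by linarith)] at h1
  rw [erfc_neg] at h1 h2
  linarith

theorem half_erfc_le_one (z : ℝ) : 1 / 2 * erfc z ≤ 1 := by
  have := erfc_pos (-z)
  rw [erfc_neg] at this
  linarith

theorem one_le_sqrt_two_pi_mul {μ : ℝ} (hμ : 1 ≤ μ) : 1 ≤ √(2 * Real.pi * μ) := by
  rw [Real.one_le_sqrt]
  nlinarith [Real.pi_gt_three]

theorem sqrt_two_pi_mul_le {μ : ℝ} (hμ : 1 ≤ μ) : √(2 * Real.pi * μ) ≤ 3 * μ := by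
  refine Real.sqrt_le_iff.2 ⟨by linarith, ?_⟩
  nlinarith [Real.pi_lt_four, mul_le_mul_of_nonneg_right Real.pi_lt_four.le (by linarith : 0 ≤ μ)]

theorem sqrt_div_two_pi_le {μ : ℝ} (hμ : 1 ≤ μ) : √(μ / (2 * Real.pi)) ≤ μ := by
  have := Real.pi_gt_three
  refine Real.sqrt_le_iff.2 ⟨by linarith, ?_⟩
  rw [div_le_iff₀ (by positivity)]
  nlinarith

theorem abs_remainder_term_le {μ x a B : ℝ} {n : ℕ} (hμ : 1 ≤ μ) (hx : 0 ≤ x) (ha : 0 < a)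
    (hR : |remSum n μ⁻¹ (x, a)| ≤ B) :
    |Real.exp (-(μ * (zetaParam (x, a) ^ 2 / 2))) * remSum n μ⁻¹ (x, a) / √(2 * Real.pi * μ)| ≤
      B * Real.exp (-(μ * marcumPhase x a)) := by
  have h1 := one_le_sqrt_two_pi_mul hμ
  have hB : 0 ≤ B := (abs_nonneg _).trans hR
  rw [zetaParam_sq hx ha, abs_div, abs_mul, Real.abs_exp, abs_of_nonneg (Real.sqrt_nonneg _),
    div_le_iff₀ (by linarith)]
  have he := Real.exp_pos (-(μ * marcumPhase x a))
  calc Real.exp (-(μ * marcumPhase x a)) * |remSum n μ⁻¹ (x, a)|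
      ≤ Real.exp (-(μ * marcumPhase x a)) * B := by gcongr
    _ ≤ B * Real.exp (-(μ * marcumPhase x a)) * √(2 * Real.pi * μ) := by
      rw [mul_comm]
      exact le_mul_of_one_le_right (by positivity) h1

/-- For `a ≥ 1` the Marcum function, the `erfc` term and the remainder are each bounded by a
multiple of `exp (-μ · phase)`. -/
theorem abs_marcumParam_sub_trunc_le {μ x a A B : ℝ} {n : ℕ} (hμ : 1 ≤ μ) (hx : 0 ≤ x)
    (ha : 1 ≤ a) (hσ : |constSum n μ⁻¹ x| ≤ A) (hR : |remSum n μ⁻¹ (x, a)| ≤ B) :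
    |gammaFactor μ * marcumParam μ (x, a) - marcumTrunc n μ (x, a)| ≤
      (gammaFactor μ + A + B) * Real.exp (-(μ * marcumPhase x a)) := by
  have hμ0 : 0 < μ := by linarith
  have ha0 : 0 < a := by linarith
  have hγ := gammaFactor_pos hμ0
  have h1 := abs_remainder_term_le hμ hx ha0 hR
  have h2 := half_erfc_zetaParam_le hμ0 hx ha
  have h3 : marcumParam μ (x, a) ≤ Real.exp (-(μ * marcumPhase x a)) :=
    marcumQ_le_exp_phase hμ0 hx ha
  have h4 : 0 ≤ marcumParam μ (x, a) := marcumQ_nonneg hμ0 (by positivity) (by positivity)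
  have h5 := erfc_pos (zetaParam (x, a) * √(μ / 2))
  rw [marcumTrunc]
  set E := Real.exp (-(μ * marcumPhase x a))
  have hE : 0 < E := Real.exp_pos _
  have h6 : |constSum n μ⁻¹ x * (1 / 2 * erfc (zetaParam (x, a) * √(μ / 2)))| ≤ A * E := by
    rw [abs_mul, abs_of_pos (by positivity : 0 < 1 / 2 * erfc (zetaParam (x, a) * √(μ / 2)))]
    exact mul_le_mul hσ h2 (by positivity) ((abs_nonneg _).trans hσ)
  have h7 : |gammaFactor μ * marcumParam μ (x, a)| ≤ gammaFactor μ * E := by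
    rw [abs_of_nonneg (by positivity)]
    gcongr
  rw [abs_le] at *
  constructor <;> nlinarith

/-- For `a ≤ 1` the complements to `1` are the small quantities; passing to them leaves the constant
`gammaFactor - constSum`. -/
theorem abs_one_sub_marcumParam_sub_trunc_le {μ x a A B : ℝ} {n : ℕ} (hμ : 1 ≤ μ) (hx : 0 ≤ x)
    (ha0 : 0 < a) (ha : a ≤ 1) (hσ : |constSum n μ⁻¹ x| ≤ A) (hR : |remSum n μ⁻¹ (x, a)| ≤ B) :
    |gammaFactor μ * marcumParam μ (x, a) - marcumTrunc n μ (x, a) -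
        (gammaFactor μ - constSum n μ⁻¹ x)| ≤
      (gammaFactor μ + A + B) * Real.exp (-(μ * marcumPhase x a)) := by
  have hμ0 : 0 < μ := by linarith
  have hγ := gammaFactor_pos hμ0
  have h1 := abs_remainder_term_le hμ hx ha0 hR
  have h2 := one_sub_half_erfc_zetaParam_le hμ0 hx ha0 ha
  have h3 : 1 - marcumParam μ (x, a) ≤ Real.exp (-(μ * marcumPhase x a)) :=
    one_sub_marcumQ_le_exp_phase hμ0 hx ha0 ha
  have h4 : 0 ≤ 1 - marcumParam μ (x, a) :=
    sub_nonneg.2 (marcumQ_le_one hμ0 (by positivity) (by positivity))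
  have h5 := half_erfc_le_one (zetaParam (x, a) * √(μ / 2))
  rw [marcumTrunc]
  set E := Real.exp (-(μ * marcumPhase x a))
  have hE : 0 < E := Real.exp_pos _
  have h6 : |constSum n μ⁻¹ x * (1 - 1 / 2 * erfc (zetaParam (x, a) * √(μ / 2)))| ≤ A * E := by
    rw [abs_mul, abs_of_nonneg (sub_nonneg.2 h5)]
    exact mul_le_mul hσ h2 (by linarith) ((abs_nonneg _).trans hσ)
  have h7 : |gammaFactor μ * (1 - marcumParam μ (x, a))| ≤ gammaFactor μ * E := by
    rw [abs_of_nonneg (by positivity)]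
    gcongr
  rw [abs_le] at *
  constructor <;> nlinarith

/-- The mean value estimate on an interval on which the derivative has a constant bound. -/
theorem abs_sub_le_of_hasDerivAt {W W' : ℝ → ℝ} {a b B : ℝ} (hab : a ≤ b)
    (hW : ∀ c ∈ Icc a b, HasDerivAt W (W' c) c) (hB : ∀ c ∈ Icc a b, |W' c| ≤ B) :
    |W a - W b| ≤ B * (b - a) := by
  have h := (convex_Icc a b).norm_image_sub_le_of_norm_hasDerivWithin_le
    (fun c hc => (hW c hc).hasDerivWithinAt) hB ⟨hab, le_rfl⟩ ⟨le_rfl, hab⟩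
  rwa [Real.norm_eq_abs, Real.norm_eq_abs, abs_sub_comm a b, abs_of_nonneg (sub_nonneg.2 hab)] at h

/-- The passage from a bound for the derivative of the error to a bound for the error. -/
theorem marcum_error_le {n : ℕ} {μ x ℓ L A B δ : ℝ} (hμ : 4 ≤ μ) (hx : 0 ≤ x) (hℓ : 0 < ℓ)
    (hℓ1 : ℓ < 1) (hL : 1 < L) (hδ : 0 ≤ δ) (hσ : |constSum n μ⁻¹ x| ≤ A)
    (hR : ∀ a ∈ Icc ℓ L, |remSum n μ⁻¹ (x, a)| ≤ B) {W' : ℝ → ℝ}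
    (hW : ∀ a ∈ Icc ℓ L, HasDerivAt
      (fun a => gammaFactor μ * marcumParam μ (x, a) - marcumTrunc n μ (x, a)) (W' a) a)
    (hW' : ∀ a ∈ Icc ℓ L, |W' a| ≤ δ * Real.exp (-(μ * marcumPhase x a)))
    (h1ℓ : 1 ≤ marcumPhase x ℓ) (h1L : 1 ≤ marcumPhase x L) :
    |gammaFactor μ - constSum n μ⁻¹ x| ≤ 4 * ((2 * A + B) * Real.exp (-μ) + δ * (L - ℓ)) ∧
    ∀ a ∈ Icc ℓ L, marcumPhase x a + 1 ≤ marcumPhase x ℓ → marcumPhase x a + 1 ≤ marcumPhase x L →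
      |erfcRemainder zetaParam gammaFactor marcumParam μ (x, a) - remSum n μ⁻¹ (x, a)| ≤
        3 * μ * (δ * (L - ℓ) + (gammaFactor μ + A + B) * Real.exp (-μ) +
          |gammaFactor μ - constSum n μ⁻¹ x|) := by
  have hμ0 : 0 < μ := by linarith
  have hγ := gammaFactor_pos hμ0
  have hA : 0 ≤ A := (abs_nonneg _).trans hσ
  have hB : 0 ≤ B := (abs_nonneg _).trans (hR ℓ ⟨le_rfl, by linarith⟩)
  set W : ℝ → ℝ := fun a => gammaFactor μ * marcumParam μ (x, a) - marcumTrunc n μ (x, a) with hWdef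
  set K := gammaFactor μ - constSum n μ⁻¹ x with hK
  -- Integrating away from `a = 1` the phase increases, so the exponential at `a` bounds the whole
  -- interval; on the left of `1` likewise.
  have hright : ∀ a ∈ Icc 1 L, |W a - W L| ≤ δ * (L - ℓ) * Real.exp (-(μ * marcumPhase x a)) := by
    intro a ha
    have hsub : ∀ c ∈ Icc a L, c ∈ Icc ℓ L := fun c hc => ⟨by linarith [hc.1, ha.1], hc.2⟩
    refine (abs_sub_le_of_hasDerivAt (B := δ * Real.exp (-(μ * marcumPhase x a))) ha.2
      (fun c hc => hW c (hsub c hc)) fun c hc => (hW' c (hsub c hc)).trans ?_).trans ?_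
    · have := marcumPhase_monotone hx ha.1 hc.1
      gcongr
    · rw [mul_right_comm]
      gcongr
      linarith [ha.1]
  have hleft : ∀ a ∈ Icc ℓ 1, |W ℓ - W a| ≤ δ * (L - ℓ) * Real.exp (-(μ * marcumPhase x a)) := by
    intro a ha
    have hsub : ∀ c ∈ Icc ℓ a, c ∈ Icc ℓ L := fun c hc => ⟨hc.1, by linarith [hc.2, ha.2]⟩
    refine (abs_sub_le_of_hasDerivAt (B := δ * Real.exp (-(μ * marcumPhase x a))) ha.1
      (fun c hc => hW c (hsub c hc)) fun c hc => (hW' c (hsub c hc)).trans ?_).trans ?_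
    · have := marcumPhase_antitone hx (by linarith [hc.1]) hc.2 ha.2
      gcongr
    · rw [mul_right_comm]
      gcongr
      linarith [ha.2]
  have hWL : |W L| ≤ (gammaFactor μ + A + B) * Real.exp (-(μ * marcumPhase x L)) :=
    abs_marcumParam_sub_trunc_le (by linarith) hx hL.le hσ (hR L ⟨by linarith, le_rfl⟩)
  have hWℓ : |W ℓ - K| ≤ (gammaFactor μ + A + B) * Real.exp (-(μ * marcumPhase x ℓ)) :=
    abs_one_sub_marcumParam_sub_trunc_le (by linarith) hx hℓ hℓ1.le hσ (hR ℓ ⟨le_rfl, by linarith⟩)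
  constructor
  -- Following `W` from `ℓ` to `L` through `1` bounds `K` in terms of `gammaFactor μ`, which is
  -- itself at most `|K| + A`. The factor `1/5`, from `μ ≥ 4`, lets `|K|` be absorbed.
  · have hE : Real.exp (-μ) ≤ 1 / 5 := by
      rw [Real.exp_neg, ← one_div]
      refine one_div_le_one_div_of_le (by norm_num) ?_
      linarith [Real.add_one_le_exp μ]
    have e1 : Real.exp (-(μ * marcumPhase x L)) ≤ Real.exp (-μ) := by
      rw [Real.exp_le_exp]
      nlinarith
    have e2 : Real.exp (-(μ * marcumPhase x ℓ)) ≤ Real.exp (-μ) := by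
      rw [Real.exp_le_exp]
      nlinarith
    have e3 : Real.exp (-(μ * marcumPhase x 1)) ≤ 1 := by
      rw [Real.exp_le_one_iff]
      have := marcumPhase_nonneg hx (one_pos (α := ℝ))
      nlinarith
    have h1 := (hright 1 ⟨le_rfl, hL.le⟩).trans
      (mul_le_mul_of_nonneg_left e3 (mul_nonneg hδ (by linarith)))
    have h2 := (hleft 1 ⟨hℓ1.le, le_rfl⟩).trans
      (mul_le_mul_of_nonneg_left e3 (mul_nonneg hδ (by linarith)))
    have h3 := hWL.trans (mul_le_mul_of_nonneg_left e1 (by positivity))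
    have h4 := hWℓ.trans (mul_le_mul_of_nonneg_left e2 (by positivity))
    have h5 : gammaFactor μ ≤ |K| + A := by
      have := le_abs_self K
      have := (abs_le.1 hσ).2
      linarith
    have h6 : |K| ≤ 2 * ((gammaFactor μ + A + B) * Real.exp (-μ)) + 2 * (δ * (L - ℓ)) := by
      rw [mul_one] at h1 h2
      rw [abs_le] at h1 h2 h3 h4
      rw [abs_le]
      constructor <;> linarith
    have hE0 := Real.exp_pos (-μ)
    have h7 : gammaFactor μ * Real.exp (-μ) ≤ |K| * (1 / 5) + A * Real.exp (-μ) := by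
      nlinarith [abs_nonneg K]
    have h8 : 0 ≤ δ * (L - ℓ) := mul_nonneg hδ (by linarith)
    have h9 : 0 ≤ A * Real.exp (-μ) := by positivity
    have h10 : 0 ≤ B * Real.exp (-μ) := by positivity
    linarith
  · intro a ha hφℓ hφL
    have ha0 : 0 < a := by linarith [ha.1]
    set E := Real.exp (-(μ * marcumPhase x a)) with hE
    have hE0 : 0 < E := Real.exp_pos _
    -- The unit gap between the phases at the end and at `a` makes the end value negligible relative
    -- to `E`.
    have e1 : Real.exp (-(μ * marcumPhase x L)) ≤ Real.exp (-μ) * E := by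
      rw [hE, ← Real.exp_add, Real.exp_le_exp]
      nlinarith
    have e2 : Real.exp (-(μ * marcumPhase x ℓ)) ≤ Real.exp (-μ) * E := by
      rw [hE, ← Real.exp_add, Real.exp_le_exp]
      nlinarith
    have h3 := hWL.trans (mul_le_mul_of_nonneg_left e1 (by positivity))
    have h4 := hWℓ.trans (mul_le_mul_of_nonneg_left e2 (by positivity))
    -- Subtracting `K` times half the `erfc` replaces `constSum` by `gammaFactor` in front of
    -- `erfc`. For `a ≥ 1` that term is itself small; for `a ≤ 1` it is close to `K`, the
    -- approximate value of `W` at `ℓ`.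
    have hmain : |W a - K * (1 / 2 * erfc (zetaParam (x, a) * √(μ / 2)))| ≤
        (δ * (L - ℓ) + (gammaFactor μ + A + B) * Real.exp (-μ) + |K|) * E := by
      rcases le_total 1 a with h1a | h1a
      · have h5 := hright a ⟨h1a, ha.2⟩
        have h6 : |K * (1 / 2 * erfc (zetaParam (x, a) * √(μ / 2)))| ≤ |K| * E := by
          rw [abs_mul]
          have := erfc_pos (zetaParam (x, a) * √(μ / 2))
          rw [abs_of_pos (by positivity : 0 < 1 / 2 * erfc (zetaParam (x, a) * √(μ / 2)))]
          gcongr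
          exact half_erfc_zetaParam_le hμ0 hx h1a
        rw [abs_le] at h3 h5 h6 ⊢
        constructor <;> linarith
      · have h5 := hleft a ⟨ha.1, h1a⟩
        have h6 : |K * (1 - 1 / 2 * erfc (zetaParam (x, a) * √(μ / 2)))| ≤ |K| * E := by
          rw [abs_mul, abs_of_nonneg (sub_nonneg.2 (half_erfc_le_one _))]
          gcongr
          exact one_sub_half_erfc_zetaParam_le hμ0 hx ha0 h1a
        rw [abs_le] at h4 h5 h6 ⊢
        constructor <;> linarith
    have hs0 : 0 < √(2 * Real.pi * μ) := by
      have := Real.pi_pos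
      positivity
    have heq : erfcRemainder zetaParam gammaFactor marcumParam μ (x, a) - remSum n μ⁻¹ (x, a) =
        √(2 * Real.pi * μ) * E⁻¹ *
          (W a - K * (1 / 2 * erfc (zetaParam (x, a) * √(μ / 2)))) := by
      have e3 : Real.exp (μ * zetaParam (x, a) ^ 2 / 2) = E⁻¹ := by
        rw [hE, ← Real.exp_neg, neg_neg, ← zetaParam_sq hx ha0]
        congr 1
        ring
      simp only [erfcRemainder, hWdef, marcumTrunc, e3, zetaParam_sq hx ha0, hK, ← hE]
      field_simp
      ring
    rw [heq, abs_mul, abs_of_pos (by positivity)]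
    calc √(2 * Real.pi * μ) * E⁻¹ * |W a - K * (1 / 2 * erfc (zetaParam (x, a) * √(μ / 2)))|
        ≤ 3 * μ * E⁻¹ *
          ((δ * (L - ℓ) + (gammaFactor μ + A + B) * Real.exp (-μ) + |K|) * E) := by
          gcongr
          exact sqrt_two_pi_mul_le (by linarith)
      _ = _ := by
          field_simp

theorem exists_abs_sum_le_rect {f : ℕ → ℝ × ℝ → ℝ}
    (hf : ∀ k, ∀ u ∈ paramDomain, ContDiffAt ℝ (⊤ : ℕ∞) (f k) u) (n : ℕ) (X : ℝ) {ℓ : ℝ} (L : ℝ)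
    (hℓ : 0 < ℓ) :
    ∃ B, 0 ≤ B ∧ ∀ h ∈ Icc (0 : ℝ) 1, ∀ x ∈ Icc 0 X, ∀ a ∈ Icc ℓ L,
      |∑ k ∈ Finset.range n, h ^ k * f k (x, a)| ≤ B := by
  have h1 : ∀ k, ∃ B, ∀ u ∈ Icc 0 X ×ˢ Icc ℓ L, ‖f k u‖ ≤ B := fun k =>
    (isCompact_Icc.prod isCompact_Icc).exists_bound_of_continuousOn fun u hu =>
      (hf k u (mem_paramDomain hu.1.1 (hℓ.trans_le hu.2.1))).continuousAt.continuousWithinAt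
  choose B hB using h1
  refine ⟨∑ k ∈ Finset.range n, |B k|, by positivity, fun h hh x hx a ha => ?_⟩
  refine (Finset.abs_sum_le_sum_abs _ _).trans (Finset.sum_le_sum fun k _ => ?_)
  rw [abs_mul, abs_pow, abs_of_nonneg hh.1]
  have h2 : h ^ k ≤ 1 := pow_le_one₀ hh.1 hh.2
  have h3 : |f k (x, a)| ≤ |B k| := (hB k (x, a) ⟨hx, ha⟩).trans (le_abs_self _)
  nlinarith [abs_nonneg (f k (x, a)), pow_nonneg hh.1 k]

theorem exp_neg_inv_le (n : ℕ) {h : ℝ} (hh : 0 < h) : Real.exp (-h⁻¹) ≤ n.factorial * h ^ n := by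
  have h1 := Real.pow_div_factorial_le_exp h⁻¹ (by positivity) n
  rw [Real.exp_neg, inv_le_comm₀ (Real.exp_pos _) (by positivity)]
  refine le_trans (le_of_eq ?_) h1
  rw [inv_pow]
  field_simp

theorem sum_range_add_two (f : ℕ → ℝ) (h : ℝ) (N : ℕ) :
    ∑ k ∈ Finset.range (N + 2), h ^ k * f k =
      ∑ k ∈ Finset.range N, h ^ k * f k + h ^ N * ∑ k ∈ Finset.range 2, h ^ k * f (N + k) := by
  rw [Finset.sum_range_add, Finset.mul_sum]
  congr 1
  exact Finset.sum_congr rfl fun k _ => by ring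

theorem exists_amp_sub_le (N : ℕ) {X ℓ L : ℝ} (hX : 0 ≤ X) (hℓ : 0 < ℓ) (hL : 0 < L) :
    ∃ C h₀, 0 ≤ C ∧ 0 < h₀ ∧ ∀ h ∈ Ioo 0 h₀, ∀ x ∈ Icc 0 X, ∀ a ∈ Icc ℓ L,
      |ampExact h⁻¹ (x, a) - ∑ k ∈ Finset.range (N + 1), h ^ k * ampCoeff k (x, a)| ≤
        C * h ^ (N + 1) := by
  obtain ⟨C, h₀, hC, hh₀, hb⟩ := exists_besselFactor_sub_le N (W := X * L) (by positivity)
  -- The prefactor is at most `2/ℓ`, since `1 + 2c ≤ 2 (1 + c)` and `a ≥ ℓ`.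
  refine ⟨2 / ℓ * C, h₀, by positivity, hh₀, fun h hh x hx a ha => ?_⟩
  have ha0 : 0 < a := hℓ.trans_le ha.1
  have hx0 := hx.1
  have h1 := hb h hh (x * a) ⟨by positivity, mul_le_mul hx.2 ha.2 ha0.le hX⟩
  have h2 : ∑ k ∈ Finset.range (N + 1), h ^ k * ampCoeff k (x, a) =
      (1 + 2 * (x * a)) / (a * (1 + x * a)) * wkbSum (N + 1) h (x * a) := by
    rw [wkbSum, Finset.mul_sum]
    refine Finset.sum_congr rfl fun k _ => ?_
    rw [ampCoeff]
    ring
  rw [h2, ampExact, ← mul_sub, abs_mul, abs_of_nonneg (by positivity), mul_assoc]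
  refine mul_le_mul ?_ h1 (abs_nonneg _) (by positivity)
  rw [div_le_div_iff₀ (by positivity) hℓ]
  have h3 : 0 ≤ x * a := by positivity
  nlinarith [ha.1, mul_le_mul_of_nonneg_left ha.1 h3]

/-- The error estimate is run with `N + 2` terms: one power of `h` pays for `√(μ/2π) ≤ μ` in the
derivative, another for `√(2πμ) ≤ 3μ` in the normalization. The two surplus terms are then absorbed
into `C h^N`. -/
theorem exists_marcum_expansion_rect (N : ℕ) {X ℓ L : ℝ} (hX : 0 ≤ X) (hℓ : 0 < ℓ) (hℓ1 : ℓ < 1)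
    (hL : 1 < L) : ∃ C h₀, 0 < h₀ ∧ ∀ h ∈ Ioo 0 h₀, ∀ x ∈ Icc 0 X,
      1 ≤ marcumPhase x ℓ → 1 ≤ marcumPhase x L →
      |gammaFactor h⁻¹ - constSum N h x| ≤ C * h ^ N ∧
      ∀ a ∈ Icc ℓ L, marcumPhase x a + 1 ≤ marcumPhase x ℓ →
        marcumPhase x a + 1 ≤ marcumPhase x L →
        |erfcRemainder zetaParam gammaFactor marcumParam h⁻¹ (x, a) - remSum N h (x, a)| ≤
          C * h ^ N := by
  obtain ⟨CA, h₁, hCA, hh₁, hamp⟩ := exists_amp_sub_le (N + 1) hX hℓ (by linarith : 0 < L)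
  obtain ⟨D, hD, hDb⟩ := exists_abs_sum_le_rect
    (f := fun _ => derivSnd (phaseQuot (sourceTerm (N + 1))))
    (fun k u hu => contDiffAt_derivSnd (contDiffAt_phaseQuot (contDiffAt_sourceTerm _) hu)) 1 X L hℓ
  have hσs : ∀ k, ∀ u ∈ paramDomain, ContDiffAt ℝ (⊤ : ℕ∞) (constPart (sourceTerm k)) u :=
    fun k u hu => contDiffAt_constPart (contDiffAt_sourceTerm k) hu
  have hRs : ∀ k, ∀ u ∈ paramDomain, ContDiffAt ℝ (⊤ : ℕ∞) (phaseQuot (sourceTerm k)) u :=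
    fun k u hu => contDiffAt_phaseQuot (contDiffAt_sourceTerm k) hu
  obtain ⟨A, hA, hAb⟩ := exists_abs_sum_le_rect hσs (N + 2) X L hℓ
  obtain ⟨B, hB, hBb⟩ := exists_abs_sum_le_rect hRs (N + 2) X L hℓ
  obtain ⟨A', hA', hAb'⟩ := exists_abs_sum_le_rect (fun k => hσs (N + k)) 2 X L hℓ
  obtain ⟨B', hB', hBb'⟩ := exists_abs_sum_le_rect (fun k => hRs (N + k)) 2 X L hℓ
  set F : ℝ := ((N + 1).factorial : ℝ) with hF
  have hF0 : 0 ≤ F := by positivity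
  set CK := 4 * ((2 * A + B) * F + (CA + D) * (L - ℓ)) with hCK
  have hLℓ : 0 ≤ L - ℓ := by linarith
  have hCK0 : 0 ≤ CK := by positivity
  set CR := 3 * ((CA + D) * (L - ℓ) + (CK + A + A + B) * F + CK) with hCR
  have hCR0 : 0 ≤ CR := by positivity
  -- `h < 1/4` provides the `μ ≥ 4` required by `marcum_error_le`.
  refine ⟨CK + CR + A' + B', min h₁ (1 / 4), by positivity, fun h hh x hx h1ℓ h1L => ?_⟩
  have hh0 := hh.1
  have hh1 : h ∈ Ioo 0 h₁ := ⟨hh.1, hh.2.trans_le (min_le_left _ _)⟩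
  have hh4 : h < 1 / 4 := hh.2.trans_le (min_le_right _ _)
  have hhI : h ∈ Icc (0 : ℝ) 1 := ⟨hh0.le, by linarith⟩
  have hμ : 4 ≤ h⁻¹ := by
    rw [le_inv_comm₀ (by norm_num) hh0]
    linarith
  have hmem1 : (1 : ℝ) ∈ Icc ℓ L := ⟨hℓ1.le, hL.le⟩
  have hE : Real.exp (-h⁻¹) ≤ F * h ^ (N + 1) := exp_neg_inv_le (N + 1) hh0
  have hderiv := fun (a : ℝ) (ha : a ∈ Icc ℓ L) =>
    (hasDerivAt_marcumParam (inv_pos.2 hh0) hx.1 (hℓ.trans_le ha.1)).sub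
      (hasDerivAt_marcumTrunc (N + 1) (inv_pos.2 hh0) hx.1 (hℓ.trans_le ha.1))
  have key := marcum_error_le (n := N + 2) (A := A) (B := B) (δ := (CA + D) * h ^ (N + 1))
    hμ hx.1 hℓ hℓ1 hL (by positivity) (by rw [inv_inv]; exact hAb h hhI x hx 1 hmem1)
    (fun a ha => by rw [inv_inv]; exact hBb h hhI x hx a ha) hderiv
    (fun a ha => by
      have e1 := hamp h hh1 x hx a ha
      have e2 := hDb h hhI x hx a ha
      simp only [Finset.sum_range_one, pow_zero, one_mul] at e2
      rw [inv_inv]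
      set E := Real.exp (-(h⁻¹ * marcumPhase x a))
      have hE0 : 0 < E := Real.exp_pos _
      set S := ∑ k ∈ Finset.range (N + 1 + 1), h ^ k * ampCoeff k (x, a)
      set d := derivSnd (phaseQuot (sourceTerm (N + 1))) (x, a)
      have e3 : |ampExact h⁻¹ (x, a) - S + h ^ (N + 2) * d| ≤ (CA + D) * h ^ (N + 2) := by
        refine (abs_add_le _ _).trans ?_
        rw [abs_mul, abs_of_pos (pow_pos hh0 _), add_mul]
        refine add_le_add e1 ?_
        rw [mul_comm D]
        gcongr
      have e4 : √(h⁻¹ / (2 * Real.pi)) ≤ h⁻¹ := sqrt_div_two_pi_le (by linarith)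
      rw [show -(√(h⁻¹ / (2 * Real.pi)) * E * ampExact h⁻¹ (x, a)) -
        -(√(h⁻¹ / (2 * Real.pi)) * E * (S - h ^ (N + 1 + 1) * d)) =
        -(√(h⁻¹ / (2 * Real.pi)) * E * (ampExact h⁻¹ (x, a) - S + h ^ (N + 2) * d)) by ring,
        abs_neg, abs_mul, abs_of_nonneg (by positivity)]
      calc √(h⁻¹ / (2 * Real.pi)) * E * |ampExact h⁻¹ (x, a) - S + h ^ (N + 2) * d|
          ≤ h⁻¹ * E * ((CA + D) * h ^ (N + 2)) := by gcongr
        _ = (CA + D) * h ^ (N + 1) * E := by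
          rw [pow_succ h (N + 1)]
          field_simp)
    h1ℓ h1L
  rw [inv_inv] at key
  have hpow : h ^ (N + 1) ≤ h ^ N := pow_le_pow_of_le_one hh0.le (by linarith) (by lia)
  have hpow1 : h ^ (N + 1) ≤ 1 := pow_le_one₀ hh0.le (by linarith)
  have hN0 : 0 < h ^ N := pow_pos hh0 N
  have hK : |gammaFactor h⁻¹ - constSum (N + 2) h x| ≤ CK * h ^ (N + 1) := by
    refine key.1.trans ?_
    rw [hCK]
    have := mul_le_mul_of_nonneg_left hE (by positivity : 0 ≤ 2 * A + B)
    linarith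
  refine ⟨?_, fun a ha h2ℓ h2L => ?_⟩
  · have e1 : constSum (N + 2) h x = constSum N h x + h ^ N *
        ∑ k ∈ Finset.range 2, h ^ k * constPart (sourceTerm (N + k)) (x, 1) :=
      sum_range_add_two _ _ _
    have e2 := hAb' h hhI x hx 1 hmem1
    set t := ∑ k ∈ Finset.range 2, h ^ k * constPart (sourceTerm (N + k)) (x, 1)
    have e3 : |h ^ N * t| ≤ A' * h ^ N := by
      rw [abs_mul, abs_of_pos hN0, mul_comm]
      gcongr
    rw [show gammaFactor h⁻¹ - constSum N h x =
      (gammaFactor h⁻¹ - constSum (N + 2) h x) + h ^ N * t by rw [e1]; ring]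
    refine (abs_add_le _ _).trans ?_
    have e4 := mul_le_mul_of_nonneg_left hpow hCK0
    have e5 : 0 ≤ (CR + B') * h ^ N := by positivity
    linarith
  · have e1 : remSum (N + 2) h (x, a) = remSum N h (x, a) + h ^ N *
        ∑ k ∈ Finset.range 2, h ^ k * phaseQuot (sourceTerm (N + k)) (x, a) :=
      sum_range_add_two _ _ _
    have e2 := hBb' h hhI x hx a ha
    set t := ∑ k ∈ Finset.range 2, h ^ k * phaseQuot (sourceTerm (N + k)) (x, a)
    have e3 : |h ^ N * t| ≤ B' * h ^ N := by
      rw [abs_mul, abs_of_pos hN0, mul_comm]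
      gcongr
    have hγ : gammaFactor h⁻¹ ≤ CK + A := by
      have g1 := (abs_le.1 hK).2
      have g2 := (abs_le.1 (hAb h hhI x hx 1 hmem1)).2
      have g3 := mul_le_mul_of_nonneg_left hpow1 hCK0
      rw [constSum] at g1
      linarith
    have hγ0 := gammaFactor_pos (inv_pos.2 hh0)
    have e4 : |erfcRemainder zetaParam gammaFactor marcumParam h⁻¹ (x, a) -
        remSum (N + 2) h (x, a)| ≤ CR * h ^ N := by
      refine (key.2 a ha h2ℓ h2L).trans ?_
      calc _ ≤ 3 * h⁻¹ * ((CA + D) * h ^ (N + 1) * (L - ℓ) +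
              (CK + A + A + B) * (F * h ^ (N + 1)) + CK * h ^ (N + 1)) := by gcongr
        _ = CR * h ^ N := by
          rw [hCR, pow_succ]
          field_simp
    rw [show erfcRemainder zetaParam gammaFactor marcumParam h⁻¹ (x, a) - remSum N h (x, a) =
      (erfcRemainder zetaParam gammaFactor marcumParam h⁻¹ (x, a) - remSum (N + 2) h (x, a)) +
        h ^ N * t by rw [e1]; ring]
    refine (abs_add_le _ _).trans ?_
    have e5 : 0 ≤ (CK + A') * h ^ N := by positivity
    linarith

/-- The region of the coordinates `(x, a)`. -/
def paramRegion : Set (ℝ × ℝ) := {u | 0 ≤ u.1 ∧ 0 < u.2}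

theorem log_phase_le_marcumPhase {x a : ℝ} (hx : 0 ≤ x) (ha : 0 < a) :
    a - 1 - Real.log a ≤ marcumPhase x a := by
  rw [← zetaParam_sq hx ha]
  exact log_phase_le_zetaParam_sq hx ha

/-- The uniform asymptotic expansion of the Marcum function, near a point. -/
theorem exists_marcum_expansion (N : ℕ) {u : ℝ × ℝ} (hu : u ∈ paramRegion) :
    ∃ C : ℝ, ∀ᶠ q : (ℝ × ℝ) × ℝ in 𝓝 (u, 0), 0 < q.2 → q.1 ∈ paramRegion →
      |gammaFactor q.2⁻¹ - ∑ k ∈ Finset.range N, q.2 ^ k * constPart (sourceTerm k) q.1| ≤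
        C * q.2 ^ N ∧
      |erfcRemainder zetaParam gammaFactor marcumParam q.2⁻¹ q.1 -
        ∑ k ∈ Finset.range N, q.2 ^ k * phaseQuot (sourceTerm k) q.1| ≤ C * q.2 ^ N := by
  -- Near `u` the phase exceeds its value at `u` by less than `1`, so the margin `2` leaves the
  -- required gap `1` at both ends; it also forces nearby `a` into `[ℓ, L]`.
  obtain ⟨ℓ, L, hℓ, hℓ1, hL, hsmall, hlarge⟩ := exists_log_phase_ge (marcumPhase u.1 u.2 + 2)
  obtain ⟨C, h₀, hh₀, hC⟩ := exists_marcum_expansion_rect N (X := u.1 + 1)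
    (by linarith [hu.1]) hℓ hℓ1 hL
  refine ⟨C, ?_⟩
  have hcont : ContinuousAt (fun q : (ℝ × ℝ) × ℝ => marcumPhase q.1.1 q.1.2) (u, 0) := by
    have h1 : ContinuousAt (fun q : (ℝ × ℝ) × ℝ => Real.log q.1.2) (u, 0) :=
      ContinuousAt.log (by fun_prop) hu.2.ne'
    unfold marcumPhase
    fun_prop
  have hc1 : ∀ᶠ q : (ℝ × ℝ) × ℝ in 𝓝 (u, 0), marcumPhase q.1.1 q.1.2 < marcumPhase u.1 u.2 + 1 :=
    hcont.eventually_lt_const (by simp)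
  have hc2 : ∀ᶠ q : (ℝ × ℝ) × ℝ in 𝓝 (u, 0), q.1.1 < u.1 + 1 :=
    (by fun_prop : ContinuousAt (fun q : (ℝ × ℝ) × ℝ => q.1.1) (u, 0)).eventually_lt_const (by simp)
  have hc3 : ∀ᶠ q : (ℝ × ℝ) × ℝ in 𝓝 (u, 0), q.2 < h₀ :=
    (by fun_prop : ContinuousAt (fun q : (ℝ × ℝ) × ℝ => q.2) (u, 0)).eventually_lt_const hh₀
  filter_upwards [hc1, hc2, hc3] with q hq1 hq2 hq3 hq0 hq
  obtain ⟨⟨x, a⟩, h⟩ := q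
  have hx : 0 ≤ x := hq.1
  have ha : 0 < a := hq.2
  simp only at hq1 hq2 hq3 hq0 ⊢
  have hL0 : 0 < L := by linarith
  have pℓ := (hsmall ℓ hℓ le_rfl).trans_le (log_phase_le_marcumPhase hx hℓ)
  have pL := (hlarge L le_rfl).trans_le (log_phase_le_marcumPhase hx hL0)
  have pa := log_phase_le_marcumPhase hx ha
  have pu := marcumPhase_nonneg hu.1 hu.2
  have haℓ : ℓ ≤ a := by
    by_contra! hlt
    have := hsmall a ha hlt.le
    linarith
  have haL : a ≤ L := by
    by_contra! hlt
    have := hlarge a hlt.le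
    linarith
  obtain ⟨r1, r2⟩ := hC h ⟨hq0, hq3⟩ x ⟨hx, hq2.le⟩ (by linarith) (by linarith)
  exact ⟨r1, r2 a ⟨haℓ, haL⟩ (by linarith) (by linarith)⟩

/-! ### The asymptotic inversion -/

/-- The region of the coordinates `(y, a)`. -/
def paramRegionSnd : Set (ℝ × ℝ) := {v | 0 < v.2 ∧ v.2 ≤ v.1}

theorem paramOfSnd_mem {v : ℝ × ℝ} (hv : v ∈ paramRegionSnd) : paramOfSnd v ∈ paramRegion :=
  ⟨div_nonneg (sub_nonneg.2 hv.2) (sq_nonneg _), hv.1⟩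

theorem param_paramOfSnd {v : ℝ × ℝ} (hv : 0 < v.2) :
    (paramOfSnd v).2 + (paramOfSnd v).1 * (paramOfSnd v).2 ^ 2 = v.1 := by
  simp only [paramOfSnd]
  field_simp
  ring

theorem paramOfSnd_lt {y a b : ℝ} (ha : 0 < a) (hb : b ≤ y) (hab : a < b) :
    (paramOfSnd (y, b)).1 < (paramOfSnd (y, a)).1 := by
  simp only [paramOfSnd]
  have hb0 : 0 < b := ha.trans hab
  have h2 : a ^ 2 < b ^ 2 := by nlinarith
  calc (y - b) / b ^ 2 ≤ (y - b) / a ^ 2 := by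
        gcongr
    _ < (y - a) / a ^ 2 := by gcongr

theorem inversionData_right : InversionData paramDomain paramRegion zetaParam
    (fun u => marcumZeta1 u.1 (u.2 + u.1 * u.2 ^ 2)) (fun k => constPart (sourceTerm k))
    (fun k => phaseQuot (sourceTerm k)) gammaFactor marcumParam where
  subset _ hu := mem_paramDomain hu.1 hu.2
  contDiffAt_Z _ hu := contDiffAt_zetaParam hu
  contDiffAt_σ k _ hu := contDiffAt_constPart (contDiffAt_sourceTerm k) hu
  contDiffAt_S k _ hu := contDiffAt_phaseQuot (contDiffAt_sourceTerm k) hu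
  σ_zero _ hu := constPart_sourceTerm_zero hu
  derivSnd_pos _ hu := derivSnd_zetaParam_pos hu
  tiltInt_e _ hu := tiltInt_marcumZeta1 hu.1 hu.2
  between _ _ _ _ ha _ hab _ := ⟨ha.1, ha.2.trans_le hab⟩
  anti μ x a b hμ ha hb hab := by
    have hx : 0 ≤ x := ha.1
    have ha0 : 0 < a := ha.2
    have hb0 : 0 < b := hb.2
    refine marcumQ_strictAntiOn hμ (by positivity : 0 ≤ μ * x)
      (mem_Ici.2 (by positivity)) (mem_Ici.2 (by positivity)) ?_
    refine mul_lt_mul_of_pos_left ?_ hμ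
    have := mul_le_mul_of_nonneg_left (pow_le_pow_left₀ ha0.le hab.le 2) hx
    simp only
    linarith
  κ_pos _ hμ := gammaFactor_pos hμ
  expansion N _ hu := exists_marcum_expansion N hu

/-- All data are pulled back along `paramOfSnd`. Raising `a` with `y` fixed lowers `x`, and `Q`
increases in `x`, so `Q` again decreases in `a`. -/
theorem inversionData_left : InversionData paramDomainSnd paramRegionSnd
    (fun v => zetaParam (paramOfSnd v)) (fun v => marcumZeta1 (paramOfSnd v).1 v.1)
    (fun k v => constPart (sourceTerm k) (paramOfSnd v))
    (fun k v => phaseQuot (sourceTerm k) (paramOfSnd v)) gammaFactor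
    (fun μ v => marcumParam μ (paramOfSnd v)) where
  subset _ hv := mem_paramDomainSnd hv.1 hv.2
  contDiffAt_Z v hv := ContDiffAt.comp v (contDiffAt_zetaParam hv) (contDiffAt_paramOfSnd hv.1)
  contDiffAt_σ k v hv := ContDiffAt.comp v (contDiffAt_constPart (contDiffAt_sourceTerm k) hv)
    (contDiffAt_paramOfSnd hv.1)
  contDiffAt_S k v hv := ContDiffAt.comp v (contDiffAt_phaseQuot (contDiffAt_sourceTerm k) hv)
    (contDiffAt_paramOfSnd hv.1)
  σ_zero _ hv := constPart_sourceTerm_zero hv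
  derivSnd_pos _ hv := derivSnd_zetaParam_paramOfSnd_pos hv
  tiltInt_e v hv := by
    have h := tiltInt_marcumZeta1 (paramOfSnd_mem hv).1 (paramOfSnd_mem hv).2
    rwa [param_paramOfSnd hv.1] at h
  between _ _ _ _ ha hc hab hbc := ⟨ha.1.trans_le hab, hbc.trans hc.2⟩
  anti μ y a b hμ ha hb hab := by
    have h1 := (paramOfSnd_mem ha).1
    have h2 := (paramOfSnd_mem hb).1
    have h3 := paramOfSnd_lt ha.1 hb.2 hab
    have hy : 0 < y := ha.1.trans_le ha.2
    simp only [marcumParam]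
    rw [param_paramOfSnd ha.1, param_paramOfSnd hb.1]
    exact marcumQ_strictMonoOn_left hμ (mul_pos hμ hy) (mem_Ici.2 (by positivity))
      (mem_Ici.2 (by positivity)) (mul_lt_mul_of_pos_left h3 hμ)
  κ_pos _ hμ := gammaFactor_pos hμ
  expansion N v hv := by
    obtain ⟨C, hC⟩ := exists_marcum_expansion N (paramOfSnd_mem hv)
    refine ⟨C, ?_⟩
    have h1 : Tendsto (fun q : (ℝ × ℝ) × ℝ => (paramOfSnd q.1, q.2)) (𝓝 (v, 0))
        (𝓝 (paramOfSnd v, 0)) := by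
      have h2 : ContinuousAt (fun q : (ℝ × ℝ) × ℝ => paramOfSnd q.1) (v, 0) :=
        ContinuousAt.comp (x := ((v, 0) : (ℝ × ℝ) × ℝ)) (g := paramOfSnd) (f := Prod.fst)
          (contDiffAt_paramOfSnd hv.1).continuousAt continuousAt_fst
      exact h2.prodMk continuousAt_snd
    filter_upwards [h1.eventually hC] with q hq hq0 hqT
    exact hq hq0 (paramOfSnd_mem hqT)

/-- Coefficients at `(x, ζ₀)` are those at the base point `(x, a₀)`, with `a₀` the unique solution
of `ζ = ζ₀`. The phase is at least `a - 1 - log a`, so bounded `ζ₀` keeps `a₀` in a compact interval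
independent of `x`. -/
theorem exists_inversion_right : ∃ c : ℕ → ℝ → ℝ → ℝ,
    (∀ x y₀ : ℝ, 0 ≤ x → 0 < y₀ → c 1 x (marcumZeta x y₀) = marcumZeta1 x y₀) ∧
    ∀ (N : ℕ) (M : ℝ), 0 < M → ∃ C μ₀ : ℝ, 0 < μ₀ ∧
      ∀ μ x q ζ₀ y : ℝ, μ₀ ≤ μ → 0 ≤ x → x ≤ M → |ζ₀| ≤ M → 0 < y →
        1 / 2 * erfc (ζ₀ * √(μ / 2)) = q →
        marcumQ μ (μ * x) (μ * y) = q →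
        |marcumZeta x y - (ζ₀ + ∑ n ∈ Finset.Icc 1 N, c n x ζ₀ / μ ^ n)| ≤ C / μ ^ (N + 1) := by
  obtain ⟨c, hc1, hc⟩ := inversionData_right.inversion
  have hex : ∀ x ζ : ℝ, ∃ a, 0 ≤ x → 0 < a ∧ zetaParam (x, a) = ζ := fun x ζ => by
    by_cases hx : 0 ≤ x
    · obtain ⟨a, ha⟩ := exists_zetaParam_eq hx ζ
      exact ⟨a, fun _ => ha⟩
    · exact ⟨0, fun h => (hx h).elim⟩
  choose a₀ ha₀ using hex
  refine ⟨fun n x ζ => c (x, a₀ x ζ) n, fun x y₀ hx hy₀ => ?_, fun N M hM => ?_⟩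
  · obtain ⟨a, ha, rfl⟩ := exists_param hx hy₀
    obtain ⟨h1, h2⟩ := ha₀ x (marcumZeta x (a + x * a ^ 2)) hx
    rw [marcumZeta_param hx ha] at h1 h2 ⊢
    have h3 := (zetaParam_strictMonoOn hx).injOn (mem_Ioi.2 h1) (mem_Ioi.2 ha) h2
    simp only [h3]
    exact hc1 (x, a) ⟨hx, ha⟩
  · obtain ⟨ℓ, L, hℓ, -, -, hsmall, hlarge⟩ := exists_log_phase_ge (M ^ 2 / 2)
    obtain ⟨C, μ₀, hμ₀, hb⟩ := hc N (Icc 0 M ×ˢ Icc ℓ L) (isCompact_Icc.prod isCompact_Icc)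
      fun u hu => ⟨hu.1.1, hℓ.trans_le hu.2.1⟩
    refine ⟨C, μ₀, hμ₀, fun μ x q ζ₀ y hμ hx hxM hζ hy hq hQ => ?_⟩
    obtain ⟨a, ha, rfl⟩ := exists_param hx hy
    obtain ⟨h1, h2⟩ := ha₀ x ζ₀ hx
    have h3 : a₀ x ζ₀ - 1 - Real.log (a₀ x ζ₀) ≤ M ^ 2 / 2 := by
      have := log_phase_le_zetaParam_sq hx h1
      rw [h2] at this
      have := sq_le_sq' (by linarith [neg_abs_le ζ₀]) ((le_abs_self ζ₀).trans hζ)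
      linarith
    have h4 : ℓ ≤ a₀ x ζ₀ := by
      by_contra! hlt
      linarith [hsmall _ h1 hlt.le]
    have h5 : a₀ x ζ₀ ≤ L := by
      by_contra! hlt
      linarith [hlarge _ hlt.le]
    have h6 := hb μ hμ (x, a₀ x ζ₀) ⟨⟨hx, hxM⟩, ⟨h4, h5⟩⟩ a ⟨hx, ha⟩
    rw [h2, hq] at h6
    rw [marcumZeta_param hx ha]
    exact h6 hQ

theorem exists_inversion_left : ∃ c : ℕ → ℝ → ℝ → ℝ,
    (∀ x₀ y : ℝ, 0 ≤ x₀ → 0 < y → c 1 y (marcumZeta x₀ y) = marcumZeta1 x₀ y) ∧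
    ∀ (N : ℕ) (δ M : ℝ), 0 < δ → 0 < M → ∃ C μ₀ : ℝ, 0 < μ₀ ∧
      ∀ μ y q ζ₀ x : ℝ, μ₀ ≤ μ → δ ≤ y → y ≤ M → |ζ₀| ≤ M → ζ₀ ≤ marcumZeta 0 y → 0 ≤ x →
        1 / 2 * erfc (ζ₀ * √(μ / 2)) = q →
        marcumQ μ (μ * x) (μ * y) = q →
        |marcumZeta x y - (ζ₀ + ∑ n ∈ Finset.Icc 1 N, c n y ζ₀ / μ ^ n)| ≤ C / μ ^ (N + 1) := by
  obtain ⟨c, hc1, hc⟩ := inversionData_left.inversion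
  have hex : ∀ y ζ : ℝ, ∃ a, 0 < y → ζ ≤ marcumZeta 0 y →
      a ∈ Ioc 0 y ∧ zetaParam (paramOfSnd (y, a)) = ζ := fun y ζ => by
    by_cases h : 0 < y ∧ ζ ≤ marcumZeta 0 y
    · obtain ⟨a, ha⟩ := exists_zetaParam_paramOfSnd_eq (ζ := ζ) h.1 (by
        rw [← marcumZeta_zero_left h.1]
        exact h.2)
      exact ⟨a, fun _ _ => ha⟩
    · exact ⟨0, fun h1 h2 => (h ⟨h1, h2⟩).elim⟩
  choose a₀ ha₀ using hex
  refine ⟨fun n y ζ => c (y, a₀ y ζ) n, fun x y hx hy => ?_, fun N δ M hδ hM => ?_⟩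
  · obtain ⟨a, ha, rfl⟩ := exists_param hx hy
    have hay : a ≤ a + x * a ^ 2 := le_add_of_nonneg_right (by positivity)
    have hZ := marcumZeta_param hx ha
    have h0 : marcumZeta x (a + x * a ^ 2) ≤ marcumZeta 0 (a + x * a ^ 2) := by
      have h := (zetaParam_paramOfSnd_strictMonoOn (a + x * a ^ 2)).monotoneOn
        (⟨ha, hay⟩ : a ∈ Ioc 0 (a + x * a ^ 2)) ⟨hy, le_rfl⟩ hay
      simp only [paramOfSnd_param ha] at h
      rw [marcumZeta_zero_left hy, hZ]
      refine h.trans (le_of_eq ?_)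
      simp [paramOfSnd]
    obtain ⟨h1, h2⟩ := ha₀ _ _ hy h0
    rw [hZ] at h1 h2 ⊢
    have h3 := (zetaParam_paramOfSnd_strictMonoOn (a + x * a ^ 2)).injOn h1
      (⟨ha, hay⟩ : a ∈ Ioc 0 (a + x * a ^ 2)) (by simp only [h2, paramOfSnd_param ha])
    simp only [h3]
    have h4 := hc1 (a + x * a ^ 2, a) ⟨ha, hay⟩
    simpa only [paramOfSnd_param ha] using h4
  · obtain ⟨ℓ, L, hℓ, -, -, hsmall, -⟩ := exists_log_phase_ge (M ^ 2 / 2)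
    -- Here `a₀ ≤ y ≤ M` already bounds `a₀` above, so only the lower bound uses the phase; the
    -- closed condition `a ≤ y` keeps the set inside the region `x ≥ 0`.
    have hK : IsCompact ((Icc δ M ×ˢ Icc ℓ M) ∩ {v : ℝ × ℝ | v.2 ≤ v.1}) :=
      (isCompact_Icc.prod isCompact_Icc).inter_right (isClosed_le continuous_snd continuous_fst)
    obtain ⟨C, μ₀, hμ₀, hb⟩ := hc N _ hK fun u hu => ⟨hℓ.trans_le hu.1.2.1, hu.2⟩
    refine ⟨C, μ₀, hμ₀, fun μ y q ζ₀ x hμ hδy hyM hζ hζ0 hx hq hQ => ?_⟩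
    have hy : 0 < y := hδ.trans_le hδy
    obtain ⟨h1, h2⟩ := ha₀ y ζ₀ hy hζ0
    have h3 : a₀ y ζ₀ - 1 - Real.log (a₀ y ζ₀) ≤ M ^ 2 / 2 := by
      have := log_phase_le_zetaParam_sq (paramOfSnd_mem (v := (y, a₀ y ζ₀)) h1).1 h1.1
      rw [show ((paramOfSnd (y, a₀ y ζ₀)).1, a₀ y ζ₀) = paramOfSnd (y, a₀ y ζ₀) from rfl, h2] at this
      have := sq_le_sq' (by linarith [neg_abs_le ζ₀]) ((le_abs_self ζ₀).trans hζ)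
      linarith
    have h4 : ℓ ≤ a₀ y ζ₀ := by
      by_contra! hlt
      linarith [hsmall _ h1.1 hlt.le]
    obtain ⟨a, ha, rfl⟩ := exists_param hx hy
    have hay : a ≤ a + x * a ^ 2 := le_add_of_nonneg_right (by positivity)
    have h6 := hb μ hμ (a + x * a ^ 2, a₀ (a + x * a ^ 2) ζ₀)
      ⟨⟨⟨hδy, hyM⟩, ⟨h4, h1.2.trans hyM⟩⟩, h1.2⟩ a ⟨ha, hay⟩
    simp only [h2, hq, paramOfSnd_param ha] at h6
    rw [marcumZeta_param hx ha]
    exact h6 hQ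

/-! ### The transition `Q = 1/2` -/

/-- With `s = √(2x+1)` and `r = √(2x + logQuot a)`, the difference equals `(a-1)(x(a-1) + s(s-r))`.
Since `s² - r² = 1 - logQuot a = O(a-1)`, it is `O((a-1)²)`, while `ζ² ≥ (a-1)² min logQuot` on the
compact interval containing `a`. -/
theorem exists_transition_local {M : ℝ} (hM : 0 ≤ M) : ∃ C, 0 ≤ C ∧ ∀ x y : ℝ, 0 ≤ x → x ≤ M →
    0 < y → |marcumZeta x y| ≤ 1 →
      |y - x - 1 - √(2 * x + 1) * marcumZeta x y| ≤ C * marcumZeta x y ^ 2 := by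
  obtain ⟨ℓ, L, hℓ, hℓ1, hL, hsmall, hlarge⟩ := exists_log_phase_ge (1 / 2)
  have h1mem : (1 : ℝ) ∈ Icc ℓ L := ⟨hℓ1.le, hL.le⟩
  obtain ⟨b, hbI, hb⟩ := isCompact_Icc.exists_isMinOn ⟨1, h1mem⟩
    (fun a ha => (contDiffAt_logQuot (hℓ.trans_le ha.1)).continuousAt.continuousWithinAt :
      ContinuousOn logQuot (Icc ℓ L))
  have hm := logQuot_pos (hℓ.trans_le hbI.1)
  obtain ⟨B, hB⟩ := isCompact_Icc.exists_bound_of_continuousOn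
    (fun a ha => (contDiffAt_deriv_logQuot (hℓ.trans_le ha.1)).continuousAt.continuousWithinAt :
      ContinuousOn (deriv logQuot) (Icc ℓ L))
  have hB0 : 0 ≤ B := (norm_nonneg _).trans (hB 1 h1mem)
  refine ⟨(M + B) / logQuot b, by positivity, fun x y hx hxM hy hζ => ?_⟩
  obtain ⟨a, ha, rfl⟩ := exists_param hx hy
  rw [marcumZeta_param hx ha] at hζ ⊢
  have h3 : a - 1 - Real.log a ≤ 1 / 2 := by
    have := log_phase_le_zetaParam_sq hx ha
    have := (sq_le_one_iff_abs_le_one _).2 hζ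
    linarith
  have h4 : ℓ ≤ a := by
    by_contra! hlt
    linarith [hsmall _ ha hlt.le]
  have h5 : a ≤ L := by
    by_contra! hlt
    linarith [hlarge _ hlt.le]
  have hmin : logQuot b ≤ logQuot a := hb ⟨h4, h5⟩
  have h6 : |logQuot a - 1| ≤ B * |a - 1| := by
    have := (convex_Icc ℓ L).norm_image_sub_le_of_norm_hasDerivWithin_le
      (fun c hc => (hasDerivAt_logQuot (hℓ.trans_le hc.1)).hasDerivWithinAt) hB h1mem ⟨h4, h5⟩
    rwa [logQuot_one, Real.norm_eq_abs, Real.norm_eq_abs] at this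
  have hs : 0 < 2 * x + 1 := by positivity
  have hr : 0 < 2 * x + logQuot a := by linarith
  have hs2 := Real.mul_self_sqrt hs.le
  have hr2 := Real.mul_self_sqrt hr.le
  have hs0 := Real.sqrt_pos.2 hs
  have hr0 := Real.sqrt_pos.2 hr
  rw [zetaParam]
  simp only
  set s := √(2 * x + 1)
  set r := √(2 * x + logQuot a)
  have h7 : |s * (s - r)| ≤ B * |a - 1| := by
    refine le_trans ?_ h6
    have e : logQuot a - 1 = -((s - r) * (s + r)) := by nlinarith
    rw [e, abs_neg, mul_comm s, abs_mul, abs_mul, abs_of_pos hs0, abs_of_pos (by linarith : 0 < s + r)]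
    gcongr
    linarith
  have h8 : |x * (a - 1) + s * (s - r)| ≤ (M + B) * |a - 1| := by
    refine (abs_add_le _ _).trans ?_
    rw [abs_mul, abs_of_nonneg hx, add_mul]
    gcongr
  have h9 : a + x * a ^ 2 - x - 1 - s * ((a - 1) * r) =
      (a - 1) * (x * (a - 1) + s * (s - r)) := by
    linear_combination (-(a - 1)) * hs2
  rw [h9, abs_mul]
  calc |a - 1| * |x * (a - 1) + s * (s - r)| ≤ |a - 1| * ((M + B) * |a - 1|) := by gcongr
    _ = (M + B) * (a - 1) ^ 2 := by
      rw [← sq_abs (a - 1)]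
      ring
    _ ≤ (M + B) / logQuot b * ((a - 1) * r) ^ 2 := by
      rw [mul_pow, sq r, hr2, div_mul_eq_mul_div, le_div_iff₀ hm, mul_assoc]
      gcongr
      linarith

/-- `Q = 1/2` means `ζ₀ = 0`, so `ζ = ζ₁/μ + O(μ⁻²)` with the limiting `ζ₁`; multiplication by
`√(2x+1)` gives the correction, and the quadratic error in `ζ` is again `O(μ⁻²)`. -/
theorem exists_transition {M : ℝ} (hM : 0 < M) : ∃ C μ₀ : ℝ, 0 < μ₀ ∧
    ∀ μ x y : ℝ, μ₀ ≤ μ → 0 ≤ x → x ≤ M → 0 < y →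
      marcumQ μ (μ * x) (μ * y) = 1 / 2 →
      |y - (x + 1 - (3 * x + 1) / (3 * μ * (2 * x + 1)))| ≤ C / μ ^ 2 := by
  obtain ⟨c, hc1, hc⟩ := exists_inversion_right
  obtain ⟨C₁, μ₁, hμ₁, hb⟩ := hc 1 M hM
  obtain ⟨C₂, hC₂, hloc⟩ := exists_transition_local hM.le
  set A := (3 * M + 1) / 3 + |C₁| with hA
  have hA0 : 0 < A := by positivity
  refine ⟨C₂ * A ^ 2 + (2 * M + 1) * |C₁|, max μ₁ (max 1 A), by positivity,
    fun μ x y hμ hx hxM hy hQ => ?_⟩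
  have hμ1 : μ₁ ≤ μ := (le_max_left _ _).trans hμ
  have hμ2 : 1 ≤ μ := ((le_max_left _ _).trans (le_max_right _ _)).trans hμ
  have hμ3 : A ≤ μ := ((le_max_right _ _).trans (le_max_right _ _)).trans hμ
  have hμ0 : 0 < μ := by linarith
  have hs : 0 < 2 * x + 1 := by positivity
  have hs0 := Real.sqrt_pos.2 hs
  have hs2 := Real.mul_self_sqrt hs.le
  have hs1 : 1 ≤ √(2 * x + 1) := by
    rw [Real.one_le_sqrt]
    linarith
  have h0 : marcumZeta x (x + 1) = 0 := by simp [marcumZeta]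
  have h3 : (2 * x + 1) ^ (3 / 2 : ℝ) = (2 * x + 1) * √(2 * x + 1) := by
    rw [show (3 / 2 : ℝ) = 1 + 1 / 2 by norm_num, Real.rpow_add hs, Real.rpow_one,
      Real.sqrt_eq_rpow]
  have e1 : c 1 x 0 = -(3 * x + 1) / (3 * ((2 * x + 1) * √(2 * x + 1))) := by
    have := hc1 x (x + 1) hx (by positivity)
    rwa [h0, marcumZeta1, if_pos rfl, h3] at this
  have e2 := hb μ x (1 / 2) 0 y hμ1 hx hxM (by simpa using hM.le) hy (by simp [erfc_zero]) hQ
  rw [Finset.Icc_self, Finset.sum_singleton, zero_add, e1, pow_one] at e2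
  have e2 := e2.trans (div_le_div_of_nonneg_right (le_abs_self C₁) (by positivity))
  norm_num at e2
  have h4 : |-(3 * x + 1) / (3 * ((2 * x + 1) * √(2 * x + 1)))| ≤ (3 * M + 1) / 3 := by
    rw [abs_div, abs_neg, abs_of_pos (by positivity : 0 < 3 * x + 1), abs_of_pos (by positivity)]
    have : 1 ≤ (2 * x + 1) * √(2 * x + 1) := by nlinarith
    gcongr
    linarith
  have h5 : |marcumZeta x y| ≤ A / μ := by
    have g1 : |-(3 * x + 1) / (3 * ((2 * x + 1) * √(2 * x + 1))) / μ| ≤ (3 * M + 1) / 3 / μ := by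
      rw [abs_div, abs_of_pos hμ0]
      gcongr
    have g2 : |C₁| / μ ^ 2 ≤ |C₁| / μ := by
      gcongr
      nlinarith
    have g3 := abs_sub_abs_le_abs_sub (marcumZeta x y)
      (-(3 * x + 1) / (3 * ((2 * x + 1) * √(2 * x + 1))) / μ)
    norm_num at g1 g3
    rw [hA, add_div]
    linarith
  have h6 : |marcumZeta x y| ≤ 1 := h5.trans ((div_le_one hμ0).2 hμ3)
  have h7 := hloc x y hx hxM hy h6
  have h8 : marcumZeta x y ^ 2 ≤ A ^ 2 / μ ^ 2 := by
    rw [← sq_abs, ← div_pow]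
    gcongr
  have h9 : y - (x + 1 - (3 * x + 1) / (3 * μ * (2 * x + 1))) =
      (y - x - 1 - √(2 * x + 1) * marcumZeta x y) + √(2 * x + 1) *
        (marcumZeta x y - -(3 * x + 1) / (3 * ((2 * x + 1) * √(2 * x + 1))) / μ) := by
    field_simp
    ring
  have h10 : √(2 * x + 1) ≤ 2 * M + 1 := Real.sqrt_le_iff.2 ⟨by linarith, by nlinarith⟩
  rw [h9]
  refine (abs_add_le _ _).trans ?_
  rw [abs_mul, abs_of_pos hs0, add_div]
  refine add_le_add (h7.trans ?_) ?_
  · rw [mul_div_assoc]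
    gcongr
  · rw [mul_div_assoc]
    refine mul_le_mul h10 ?_ (abs_nonneg _) (by linarith)
    norm_num
    exact e2

theorem exists_transition_unscaled {M : ℝ} (hM : 0 < M) : ∃ C μ₀ : ℝ, 0 < μ₀ ∧
    ∀ μ x y : ℝ, μ₀ ≤ μ → 0 ≤ x → x ≤ M * μ → 0 < y →
      marcumQ μ x y = 1 / 2 →
      |y - (x + μ - (3 * (x / μ) + 1) / (3 * (2 * (x / μ) + 1)))| ≤ C / μ := by
  obtain ⟨C, μ₀, hμ₀, h⟩ := exists_transition hM
  refine ⟨C, μ₀, hμ₀, fun μ x y hμ hx hxM hy hQ => ?_⟩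
  have hμ0 : 0 < μ := hμ₀.trans_le hμ
  have h1 := h μ (x / μ) (y / μ) hμ (by positivity) ((div_le_iff₀ hμ0).2 hxM) (by positivity)
    (by rwa [mul_div_cancel₀ _ hμ0.ne', mul_div_cancel₀ _ hμ0.ne'])
  have h2 : 0 < 2 * (x / μ) + 1 := by positivity
  have h3 : y - (x + μ - (3 * (x / μ) + 1) / (3 * (2 * (x / μ) + 1))) =
      μ * (y / μ - (x / μ + 1 - (3 * (x / μ) + 1) / (3 * μ * (2 * (x / μ) + 1)))) := by
    generalize hg : x / μ = g at *
    have : x = g * μ := by rw [← hg]; field_simp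
    subst this
    field_simp
  rw [h3, abs_mul, abs_of_pos hμ0]
  calc _ ≤ μ * (C / μ ^ 2) := by gcongr
    _ = C / μ := by field_simp

/-- Only `Y μ = x + μ + O(1)` is used: any bounded correction disappears in the ratio as `μ → ∞`,
and the constant `k` is such a correction. -/
theorem isEquivalent_transition {x : ℝ} {Y : ℝ → ℝ} (hx : 0 ≤ x)
    (hY : ∀ᶠ μ in atTop, 0 < Y μ ∧ marcumQ μ x (Y μ) = 1 / 2) :
    Asymptotics.IsEquivalent atTop Y (fun μ => x + μ - (3 * x + 1) / (3 * (2 * x + 1))) := by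
  obtain ⟨C, μ₀, hμ₀, h⟩ := exists_transition_unscaled one_pos
  set k := (3 * x + 1) / (3 * (2 * x + 1)) with hk
  have h1 : (fun μ => Y μ - (x + μ - k)) =O[atTop] (fun _ => (1 : ℝ)) := by
    refine Asymptotics.IsBigO.of_bound (|C| + 2 + |k|) ?_
    filter_upwards [hY, eventually_ge_atTop μ₀, eventually_ge_atTop x, eventually_ge_atTop 1]
      with μ hμY hμ hμx hμ1
    have hμ0 : 0 < μ := by linarith
    have e1 := h μ x (Y μ) hμ hx (by linarith) hμY.1 hμY.2
    have e2 : C / μ ≤ |C| := (div_le_div_of_nonneg_right (le_abs_self C) hμ0.le).trans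
      (div_le_self (abs_nonneg C) hμ1)
    have e3 : 0 ≤ x / μ := by positivity
    have e4 : |(3 * (x / μ) + 1) / (3 * (2 * (x / μ) + 1))| ≤ 2 := by
      rw [abs_of_nonneg (by positivity), div_le_iff₀ (by positivity)]
      linarith
    rw [norm_one, mul_one, Real.norm_eq_abs]
    have e5 := neg_abs_le k
    have e6 := le_abs_self k
    rw [abs_le] at e1 e4 ⊢
    constructor <;> linarith
  have h2 : Tendsto (fun μ : ℝ => ‖x + μ - k‖) atTop atTop := by
    refine tendsto_norm_atTop_atTop.comp ?_
    have := tendsto_atTop_add_const_right atTop (-k) (tendsto_atTop_add_const_left atTop x tendsto_id)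
    exact this
  exact h1.trans_isLittleO ((Asymptotics.isLittleO_const_left).2 (Or.inr h2))

theorem mainTheorem3 :
    -- the two expressions for `f`, and its relation to `d₀`
    (∀ x y : ℝ, 0 ≤ x → 0 < y → y ≠ x + 1 →
      marcumF x y = -(marcumZeta x y * (1 + √(1 + 4 * x * y))) /
          ((1 + √(1 + 4 * x * y) - 2 * y) * (1 + 4 * x * y) ^ (1 / 4 : ℝ)) ∧
      marcumF x y = 1 - marcumZeta x y * marcumD0 x y ∧
      0 < marcumF x y) ∧
    -- `ζ₀` is well defined by `q`
    (∀ μ q : ℝ, 0 < μ → 0 < q → q < 1 →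
      ∃! ζ₀ : ℝ, 1 / 2 * erfc (ζ₀ * √(μ / 2)) = q) ∧
    -- inversion with respect to `y`: the solutions exist and are unique
    (∀ x ζ₀ : ℝ, 0 ≤ x → ∃! y : ℝ, 0 < y ∧ marcumZeta x y = ζ₀) ∧
    (∀ μ x q : ℝ, 0 < μ → 0 ≤ x → 0 < q → q < 1 →
      ∃! y : ℝ, 0 < y ∧ marcumQ μ (μ * x) (μ * y) = q) ∧
    -- inversion with respect to `x`: the solutions exist and are unique
    (∀ y ζ₀ : ℝ, 0 < y → ζ₀ ≤ marcumZeta 0 y → ∃! x : ℝ, 0 ≤ x ∧ marcumZeta x y = ζ₀) ∧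
    (∀ μ y q : ℝ, 0 < μ → 0 < y → marcumQ μ 0 (μ * y) < q → q < 1 →
      ∃! x : ℝ, 0 ≤ x ∧ marcumQ μ (μ * x) (μ * y) = q) ∧
    -- inversion with respect to `y`: the expansion, with coefficients depending on `x` and `ζ₀` only
    (∃ c : ℕ → ℝ → ℝ → ℝ,
      (∀ x y₀ : ℝ, 0 ≤ x → 0 < y₀ → c 1 x (marcumZeta x y₀) = marcumZeta1 x y₀) ∧
      ∀ (N : ℕ) (M : ℝ), 0 < M → ∃ C μ₀ : ℝ, 0 < μ₀ ∧
        ∀ μ x q ζ₀ y : ℝ, μ₀ ≤ μ → 0 ≤ x → x ≤ M → |ζ₀| ≤ M → 0 < y →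
          1 / 2 * erfc (ζ₀ * √(μ / 2)) = q →
          marcumQ μ (μ * x) (μ * y) = q →
          |marcumZeta x y - (ζ₀ + ∑ n ∈ Finset.Icc 1 N, c n x ζ₀ / μ ^ n)| ≤ C / μ ^ (N + 1)) ∧
    -- inversion with respect to `x`: the expansion, with coefficients depending on `y` and `ζ₀` only
    (∃ c : ℕ → ℝ → ℝ → ℝ,
      (∀ x₀ y : ℝ, 0 ≤ x₀ → 0 < y → c 1 y (marcumZeta x₀ y) = marcumZeta1 x₀ y) ∧
      ∀ (N : ℕ) (δ M : ℝ), 0 < δ → 0 < M → ∃ C μ₀ : ℝ, 0 < μ₀ ∧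
        ∀ μ y q ζ₀ x : ℝ, μ₀ ≤ μ → δ ≤ y → y ≤ M → |ζ₀| ≤ M → ζ₀ ≤ marcumZeta 0 y → 0 ≤ x →
          1 / 2 * erfc (ζ₀ * √(μ / 2)) = q →
          marcumQ μ (μ * x) (μ * y) = q →
          |marcumZeta x y - (ζ₀ + ∑ n ∈ Finset.Icc 1 N, c n y ζ₀ / μ ^ n)| ≤ C / μ ^ (N + 1)) ∧
    -- the transition `Q = 1/2`, in scaled variables
    (∀ M : ℝ, 0 < M → ∃ C μ₀ : ℝ, 0 < μ₀ ∧
      ∀ μ x y : ℝ, μ₀ ≤ μ → 0 ≤ x → x ≤ M → 0 < y →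
        marcumQ μ (μ * x) (μ * y) = 1 / 2 →
        |y - (x + 1 - (3 * x + 1) / (3 * μ * (2 * x + 1)))| ≤ C / μ ^ 2) ∧
    -- the transition `Q = 1/2`, in the original variables
    (∀ M : ℝ, 0 < M → ∃ C μ₀ : ℝ, 0 < μ₀ ∧
      ∀ μ x y : ℝ, μ₀ ≤ μ → 0 ≤ x → x ≤ M * μ → 0 < y →
        marcumQ μ x y = 1 / 2 →
        |y - (x + μ - (3 * (x / μ) + 1) / (3 * (2 * (x / μ) + 1)))| ≤ C / μ) ∧
    (∀ (x : ℝ) (Y : ℝ → ℝ), 0 ≤ x →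
      (∀ᶠ μ in Filter.atTop, 0 < Y μ ∧ marcumQ μ x (Y μ) = 1 / 2) →
      Asymptotics.IsEquivalent Filter.atTop Y
        (fun μ => x + μ - (3 * x + 1) / (3 * (2 * x + 1)))) := by
  refine ⟨fun x y hx hy hxy => marcumF_identities hx hy hxy,
    fun μ q hμ hq0 hq1 => existsUnique_half_erfc_mul_eq (by positivity) hq0 hq1,
    fun x ζ hx => existsUnique_marcumZeta_right hx ζ, fun μ x q hμ hx hq0 hq1 => ?_,
    fun y ζ hy hζ => existsUnique_marcumZeta_left hy hζ, fun μ y q hμ hy hq0 hq1 => ?_,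
    exists_inversion_right, exists_inversion_left, fun M hM => exists_transition hM,
    fun M hM => exists_transition_unscaled hM, fun x Y hx hY => isEquivalent_transition hx hY⟩
  · obtain ⟨Y, ⟨hY0, hY⟩, hu⟩ :=
      existsUnique_marcumQ_right hμ (by positivity : 0 ≤ μ * x) hq0 hq1
    refine ⟨Y / μ, ⟨by positivity, by rwa [mul_div_cancel₀ _ hμ.ne']⟩, fun y hy => ?_⟩
    rw [← hu (μ * y) ⟨mul_pos hμ hy.1, hy.2⟩, mul_div_cancel_left₀ _ hμ.ne']
  · obtain ⟨X, ⟨hX0, hX⟩, hu⟩ :=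
      existsUnique_marcumQ_left hμ (by positivity : 0 < μ * y) hq0.le hq1
    refine ⟨X / μ, ⟨by positivity, by rwa [mul_div_cancel₀ _ hμ.ne']⟩, fun x hx => ?_⟩
    rw [← hu (μ * x) ⟨mul_nonneg hμ.le hx.1, hx.2⟩, mul_div_cancel_left₀ _ hμ.ne']
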